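/- A *Stick representation* of a bipartite graph $G=(A\cup B,E)$ assigns to the vertices of $A$ horizontal segments and to the vertices of $B$ vertical segments in the plane, such that the left end-points of all horizontal segments and the bottom end-points of all vertical segments lie on a common line of slope $-1$ (the ground line), distinct vertices get distinct segments, and two distinct vertices are adjacent if and only if their segments intersect. A $0$-$1$ matrix has the *simultaneous consecutive ones property* if its rows and columns can be permuted so that the ones in each row and in each column appear consecutively. Let $G=(A\cup B,E)$ be a finite bipartite graph and let $M$ be its bipartite adjacency matrix, with rows corresponding to $A$ and columns corresponding to $B$ (entry $1$ for adjacent pairs, $0$ otherwise). If $M$ has the simultaneous consecutive ones property, then $G$ admits a Stick representation. Moreover, such a representation can be computed in $O(|A||B|)$ time: there are a single word-RAM program $P$ (unit-cost arithmetic and memory access, all stored words polynomially bounded in $|A|+|B|$) and a constant $C$ such that, for every such $G$ with $M$ having the simultaneous consecutive ones property, and for all enumerations of $A$ and of $B$, the program $P$, given $|A|$, $|B|$ and the correspondingly ordered matrix $M$ as input, halts after at most $C\cdot\max(1,|A|)\cdot\max(1,|B|)$ steps and outputs the integer coordinates of the end-points of the segments of a Stick representation of $G$. -/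

import Mathlib

universe u

open Set

/-! ### Stick representations -/

/-- The horizontal segment in the plane with left end-point `(x, y)` and right end-point
`(x', y)`. -/
def horizontalSegment (x y x' : ℝ) : Set (ℝ × ℝ) := Icc x x' ×ˢ {y}

/-- The vertical segment in the plane with bottom end-point `(x, y)` and top end-point
`(x, y')`. -/
def verticalSegment (x y y' : ℝ) : Set (ℝ × ℝ) := {x} ×ˢ Icc y y'

/-- The assignment `S` of sets in the plane to vertices is a Stick representation of `G`:
vertices of `A` are (nondegenerate) horizontal segments, vertices of `B` are (nondegenerate)
vertical segments, all left end-points of horizontal segments and all bottom end-points of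
vertical segments lie on a common ground line `x + y = c` of slope `-1`, and `G` is the
intersection graph of these segments. -/
def IsStickRepresentation {V : Type u} (G : SimpleGraph V) (A B : Set V)
    (S : V → Set (ℝ × ℝ)) : Prop :=
  ∃ c : ℝ,
    (∀ v ∈ A, ∃ x y x' : ℝ, x < x' ∧ x + y = c ∧ S v = horizontalSegment x y x') ∧
    (∀ v ∈ B, ∃ x y y' : ℝ, y < y' ∧ x + y = c ∧ S v = verticalSegment x y y') ∧
    Function.Injective S ∧
    ∀ u v : V, u ≠ v → (G.Adj u v ↔ (S u ∩ S v).Nonempty)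

/-! ### Bipartite adjacency matrices and the simultaneous consecutive ones property -/

open Classical in
/-- The bipartite adjacency matrix of `G`, with rows `A` and columns `B`. -/
noncomputable def bipartiteAdjMatrix {V : Type u} (G : SimpleGraph V) (A B : Finset V) :
    Matrix A B ℕ :=
  fun a b => if G.Adj a b then 1 else 0

/-- In every row and in every column of the (ordered) matrix `M` the ones are consecutive. -/
def HasConsecutiveOnes {n m : ℕ} (M : Matrix (Fin n) (Fin m) ℕ) : Prop :=
  (∀ i, ∀ p q r : Fin m, p ≤ q → q ≤ r → M i p = 1 → M i r = 1 → M i q = 1) ∧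
  (∀ p, ∀ i j k : Fin n, i ≤ j → j ≤ k → M i p = 1 → M k p = 1 → M j p = 1)

/-- The simultaneous consecutive ones property: rows and columns can be ordered such that in
each row and in each column the ones are consecutive. -/
def HasSimultaneousConsecutiveOnes {R C : Type u} [Fintype R] [Fintype C]
    (M : Matrix R C ℕ) : Prop :=
  ∃ (σ : Fin (Fintype.card R) ≃ R) (τ : Fin (Fintype.card C) ≃ C),
    HasConsecutiveOnes (M.submatrix σ τ)

/-! ### A word RAM with a step count

Programs are structured (`while`) programs over finitely many word registers and finitely many
word arrays with random access; every elementary operation has unit cost. -/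

/-- Memory contents: `reg x` is the content of register `x`, and `mem a i` is the content of
cell `i` of array `a`. -/
structure RAMState where
  reg : ℕ → ℕ
  mem : ℕ → ℕ → ℕ

/-- Expressions. Subtraction is truncated, division is integer division (with value `0` for
divisor `0`), and a comparison has value `1` if it holds and `0` otherwise. -/
inductive RAMExpr where
  | const (k : ℕ)
  | reg (x : ℕ)
  | read (a : ℕ) (i : RAMExpr)
  | add (e f : RAMExpr)
  | sub (e f : RAMExpr)
  | mul (e f : RAMExpr)
  | div (e f : RAMExpr)
  | lt (e f : RAMExpr)
  | eq (e f : RAMExpr)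

/-- The value of an expression. -/
def RAMExpr.eval (s : RAMState) : RAMExpr → ℕ
  | const k => k
  | reg x => s.reg x
  | read a i => s.mem a (i.eval s)
  | add e f => e.eval s + f.eval s
  | sub e f => e.eval s - f.eval s
  | mul e f => e.eval s * f.eval s
  | div e f => e.eval s / f.eval s
  | lt e f => if e.eval s < f.eval s then 1 else 0
  | eq e f => if e.eval s = f.eval s then 1 else 0

/-- The time to evaluate an expression: one step for each constant, register access, array
access, arithmetic operation and comparison. -/
def RAMExpr.cost : RAMExpr → ℕ
  | const _ => 1
  | reg _ => 1
  | read _ i => i.cost + 1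
  | add e f => e.cost + f.cost + 1
  | sub e f => e.cost + f.cost + 1
  | mul e f => e.cost + f.cost + 1
  | div e f => e.cost + f.cost + 1
  | lt e f => e.cost + f.cost + 1
  | eq e f => e.cost + f.cost + 1

/-- Programs. -/
inductive RAMProgram where
  | skip
  /-- `assign x e` is `x := e`. -/
  | assign (x : ℕ) (e : RAMExpr)
  /-- `store a i e` is `a[i] := e`. -/
  | store (a : ℕ) (i e : RAMExpr)
  | seq (p q : RAMProgram)
  /-- A test `e` succeeds if the value of `e` is nonzero. -/
  | ite (e : RAMExpr) (p q : RAMProgram)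
  | while (e : RAMExpr) (p : RAMProgram)

/-- `Runs W p s t s'`: started in state `s`, the program `p` halts after exactly `t` steps in
state `s'`, and every value that is stored on the way, and every address that is written to,
is a word, i.e. less than `W`. (A program that attempts to store a larger value does not halt
properly: no `Runs` statement holds for it. As each program has only finitely many expressions,
each of fixed size, intermediate values then fit into a constant number of words.) -/
inductive RAMProgram.Runs (W : ℕ) : RAMProgram → RAMState → ℕ → RAMState → Prop where
  | skip (s : RAMState) : Runs W .skip s 1 s
  | assign (s : RAMState) (x : ℕ) (e : RAMExpr) (he : e.eval s < W) :
      Runs W (.assign x e) s (e.cost + 1)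
        { s with reg := Function.update s.reg x (e.eval s) }
  | store (s : RAMState) (a : ℕ) (i e : RAMExpr) (hi : i.eval s < W) (he : e.eval s < W) :
      Runs W (.store a i e) s (i.cost + e.cost + 1)
        { s with mem := Function.update s.mem a
                          (Function.update (s.mem a) (i.eval s) (e.eval s)) }
  | seq {p q : RAMProgram} {s s' s'' : RAMState} {t t' : ℕ} (hp : Runs W p s t s')
      (hq : Runs W q s' t' s'') : Runs W (.seq p q) s (t + t') s''
  | ite_true {e : RAMExpr} {p q : RAMProgram} {s s' : RAMState} {t : ℕ} (he : e.eval s ≠ 0)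
      (hp : Runs W p s t s') : Runs W (.ite e p q) s (e.cost + 1 + t) s'
  | ite_false {e : RAMExpr} {p q : RAMProgram} {s s' : RAMState} {t : ℕ} (he : e.eval s = 0)
      (hq : Runs W q s t s') : Runs W (.ite e p q) s (e.cost + 1 + t) s'
  | while_true {e : RAMExpr} {p : RAMProgram} {s s' s'' : RAMState} {t t' : ℕ}
      (he : e.eval s ≠ 0) (hp : Runs W p s t s') (hw : Runs W (.while e p) s' t' s'') :
      Runs W (.while e p) s (e.cost + 1 + t + t') s''
  | while_false {e : RAMExpr} {p : RAMProgram} {s : RAMState} (he : e.eval s = 0) :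
      Runs W (.while e p) s (e.cost + 1) s

/-- The initial state for an `n × m` input matrix `M`: registers `0` and `1` hold `n` and `m`,
array `0` holds the entries of `M` row by row, and everything else is `0`. -/
def matrixInput {n m : ℕ} (M : Matrix (Fin n) (Fin m) ℕ) : RAMState where
  reg x := if x = 0 then n else if x = 1 then m else 0
  mem a k :=
    if h : a = 0 ∧ k / m < n ∧ k % m < m then M ⟨k / m, h.2.1⟩ ⟨k % m, h.2.2⟩ else 0

/-- The segment of the `i`-th row that is output in state `s`: cells `i` of arrays `1`, `2`, `3`
hold the coordinates `x`, `y` of its left end-point and the `x`-coordinate of its right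
end-point. -/
def outputRowSegment (s : RAMState) (i : ℕ) : Set (ℝ × ℝ) :=
  horizontalSegment (s.mem 1 i) (s.mem 2 i) (s.mem 3 i)

/-- The segment of the `j`-th column that is output in state `s`: cells `j` of arrays `4`, `5`,
`6` hold the coordinates `x`, `y` of its bottom end-point and the `y`-coordinate of its top
end-point. -/
def outputColumnSegment (s : RAMState) (j : ℕ) : Set (ℝ × ℝ) :=
  verticalSegment (s.mem 4 j) (s.mem 5 j) (s.mem 6 j)

/-! It suffices to order the rows so that the rows of every column are consecutive. Given such
positions, let the left ends of the horizontal segments descend along the ground line in this order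
and let all segments run to one common abscissa. The vertical segment of a column stands just right
of the left end of its last row and reaches up to the level of its first row. It then meets exactly
the rows between its first and its last row, which are the rows of the column (`Drawing.entry_iff`).
No order of the columns is needed.

The work lies in finding the row order in time proportional to the size of the matrix. Let `f` and
`g` be unknown orders of rows and columns in which everything is consecutive. In a connected
component every row is an interval `[lo, hi]` for `g`. Let `s` be the row starting leftmost and `e`
the row ending rightmost, the longest ones in case of ties; by symmetry `s` comes before `e` in `f`.
Connectivity and convexity of the columns force `lo` and `hi` to increase from `s` to `e`, the rows
before `s` to be nested and to grow towards `s`, and the rows after `e` to be nested and to shrink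
(`lo_mono`, `hi_mono` and their reflections).

The program does not see `f`, so the middle part is replaced by the core of `IsCore`, which is
defined by incidences alone. Every row between `s` and `e` is a core row (`not_core_left`,
`not_core_right`), and core rows are totally ordered by their pairs of ends (`core_chain`). A
breadth first search from `s` recovers this order: sort by distance, then by the number of columns
in the preceding layer, decreasingly, then by length (`core_key`). The other rows split into a chain
inside `s` and a chain inside `e` (`exists_coloring`). Placing the first chain in increasing order,
then the core, then the second chain in decreasing order makes every column consecutive
(`convex_rowLe`).

The ends `s` and `e` come from two searches. In the last layer of a search from a row that no row
extends on both sides, a row with the most columns of that layer is an end of the component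
(`exists_end`). A longest row of each component is a valid seed for the first search, and the end
found in this way is a valid seed for the second, which yields the opposite end (`PassOut.ends`).
Left and right may come out exchanged; mirroring `g` absorbs this. The two chains are found greedily
by decreasing length. Rows that fit below both chains are kept pending as one group, until an
incomparable row separates them (`ChainSplit`); a representative per group makes the later decision
a single assignment.

All steps are run on the word RAM by a Hoare-style logic for `Runs` (`Ends`) with explicit running
times. Positions are mixed-radix numbers, hence polynomially bounded. -/

/-! ### Connected biconvex incidence relations -/

/-- On the set `K` of rows the relation `E` is connected, the row `x` is the interval
`[lo x, hi x]` with respect to the order `g` of the columns, and the columns are convex with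
respect to the order `f` of the rows. -/
structure IsBiconvexOn (E : ℕ → ℕ → Prop) (f g lo hi : ℕ → ℤ) (K : Set ℕ) : Prop where
  row : ∀ x ∈ K, ∀ c, E x c ↔ lo x ≤ g c ∧ g c ≤ hi x
  lo_mem : ∀ x ∈ K, ∃ c, E x c ∧ g c = lo x
  hi_mem : ∀ x ∈ K, ∃ c, E x c ∧ g c = hi x
  col : ∀ c x y z, E x c → E z c → f x ≤ f y → f y ≤ f z → E y c
  conn : ∀ S : Set ℕ, ∀ x ∈ K, ∀ y ∈ K, x ∈ S → y ∉ S →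
    ∃ x ∈ K, ∃ y ∈ K, x ∈ S ∧ y ∉ S ∧ ∃ c, E x c ∧ E y c
  closed : ∀ x ∈ K, ∀ c y, E x c → E y c → y ∈ K

/-- The row `s` starts leftmost, and is longest among the rows doing so. -/
def IsLeftEnd (lo hi : ℕ → ℤ) (K : Set ℕ) (s : ℕ) : Prop :=
  s ∈ K ∧ ∀ v ∈ K, lo s ≤ lo v ∧ (lo v = lo s → hi v ≤ hi s)

/-- The row `s` ends rightmost, and is longest among the rows doing so. -/
def IsRightEnd (lo hi : ℕ → ℤ) (K : Set ℕ) (s : ℕ) : Prop :=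
  s ∈ K ∧ ∀ v ∈ K, hi v ≤ hi s ∧ (hi v = hi s → lo s ≤ lo v)

/-- The row `x` is contained in the row `y`. -/
def RowSub (E : ℕ → ℕ → Prop) (x y : ℕ) : Prop := ∀ c, E x c → E y c

/-- The columns of `s` that lie in a row not contained in `s`, or in `e`, lie in `x`, unless `x`
is not contained in `s`. -/
def IsCore (E : ℕ → ℕ → Prop) (s e x : ℕ) : Prop :=
  ¬ RowSub E x s ∨ ∀ c, E s c → (∃ z, E z c ∧ (¬ RowSub E z s ∨ z = e)) → E x c

/-- Distances `rd` of rows and `cd` of columns from the row `s` in a breadth first search. -/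
structure IsBFS (E : ℕ → ℕ → Prop) (K : Set ℕ) (s : ℕ) (rd cd : ℕ → ℕ) : Prop where
  col_le : ∀ x ∈ K, ∀ c, E x c → cd c ≤ rd x
  row_le : ∀ x ∈ K, ∀ c, E x c → rd x ≤ cd c + 1
  col_eq : ∀ x ∈ K, ∀ c, E x c → ∃ y, E y c ∧ cd c = rd y
  row_eq : ∀ x ∈ K, x ≠ s → ∃ c, E x c ∧ rd x = cd c + 1
  mem : s ∈ K
  seed : rd s = 1
  pos : ∀ x ∈ K, 1 ≤ rd x

section

variable {E : ℕ → ℕ → Prop} {f g lo hi : ℕ → ℤ} {K : Set ℕ} {s : ℕ} {rd cd : ℕ → ℕ}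

theorem IsLeftEnd.mirror {s : ℕ} (h : IsLeftEnd lo hi K s) :
    IsRightEnd (fun x => - hi x) (fun x => - lo x) K s :=
  ⟨h.1, fun v hv => ⟨by have := (h.2 v hv).1; simp only; omega, fun e => by
    have := (h.2 v hv).2 (by simp only at e; omega); simp only; omega⟩⟩

theorem IsRightEnd.mirror {s : ℕ} (h : IsRightEnd lo hi K s) :
    IsLeftEnd (fun x => - hi x) (fun x => - lo x) K s :=
  ⟨h.1, fun v hv => ⟨by have := (h.2 v hv).1; simp only; omega, fun e => by
    have := (h.2 v hv).2 (by simp only at e; omega); simp only; omega⟩⟩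

/-! ### Symmetries, connectivity, and monotonicity of the interval ends. -/

namespace IsBiconvexOn

/-- Reversing the columns here, and the rows in `flip`, turns each statement about left ends and
rows after `s` into its three companions. -/
theorem mirror (h : IsBiconvexOn E f g lo hi K) :
    IsBiconvexOn E f (fun c => - g c) (fun x => - hi x) (fun x => - lo x) K where
  row x hx c := by rw [h.row x hx c]; constructor <;> rintro ⟨h1, h2⟩ <;> constructor <;> omega
  lo_mem x hx := by
    obtain ⟨c, h1, h2⟩ := h.hi_mem x hx
    exact ⟨c, h1, by omega⟩
  hi_mem x hx := by
    obtain ⟨c, h1, h2⟩ := h.lo_mem x hx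
    exact ⟨c, h1, by omega⟩
  col := h.col
  conn := h.conn
  closed := h.closed

theorem flip (h : IsBiconvexOn E f g lo hi K) :
    IsBiconvexOn E (fun x => - f x) g lo hi K where
  row := h.row
  lo_mem := h.lo_mem
  hi_mem := h.hi_mem
  col c x y z h1 h2 h3 h4 := h.col c z y x h2 h1 (by omega) (by omega)
  conn := h.conn
  closed := h.closed

theorem lo_le_hi (h : IsBiconvexOn E f g lo hi K) {x : ℕ} (hx : x ∈ K) : lo x ≤ hi x := by
  obtain ⟨c, h1, h2⟩ := h.lo_mem x hx
  have := (h.row x hx c).1 h1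
  omega

theorem sub_iff (h : IsBiconvexOn E f g lo hi K) {x y : ℕ} (hx : x ∈ K) (hy : y ∈ K) :
    RowSub E x y ↔ lo y ≤ lo x ∧ hi x ≤ hi y := by
  constructor
  · intro hs
    obtain ⟨c, h1, h2⟩ := h.lo_mem x hx
    obtain ⟨d, h3, h4⟩ := h.hi_mem x hx
    have h5 := (h.row y hy c).1 (hs c h1)
    have h6 := (h.row y hy d).1 (hs d h3)
    omega
  · rintro ⟨h1, h2⟩ c hc
    have := (h.row x hx c).1 hc
    exact (h.row y hy c).2 ⟨by omega, by omega⟩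

/-- Connectivity applied to the set of rows starting before `v`: a row of this set shares a column
with a row outside it, so it reaches `lo v`. -/
theorem exists_crossing (h : IsBiconvexOn E f g lo hi K) {u v : ℕ} (hu : u ∈ K) (hv : v ∈ K)
    (huv : lo u < lo v) : ∃ w ∈ K, lo w < lo v ∧ lo v ≤ hi w := by
  obtain ⟨x, hx, y, hy, h1, h2, c, h3, h4⟩ :=
    h.conn {w | lo w < lo v} u hu v hv huv (by simp)
  have h5 := (h.row x hx c).1 h3
  have h6 := (h.row y hy c).1 h4
  simp only [mem_ofPred_eq] at h1 h2
  exact ⟨x, hx, h1, by omega⟩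

theorem exists_crossing' (h : IsBiconvexOn E f g lo hi K) {u v : ℕ} (hu : u ∈ K) (hv : v ∈ K)
    (huv : hi v < hi u) : ∃ w ∈ K, hi v < hi w ∧ lo w ≤ hi v := by
  obtain ⟨w, h1, h2, h3⟩ := h.mirror.exists_crossing hu hv (by omega)
  exact ⟨w, h1, by omega, by omega⟩

/-- All rows that start before a row `y` are on the same side of `y`. -/
theorem same_side (h : IsBiconvexOn E f g lo hi K) {s y : ℕ} (hs : s ∈ K)
    (hmin : ∀ v ∈ K, lo s ≤ lo v) (hy : y ∈ K) :
    ∀ (k : ℕ) (w : ℕ), w ∈ K → (lo w - lo s).toNat ≤ k → lo w < lo y →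
      (f w < f y ↔ f s < f y) := by
  -- Two rows sharing a column that misses `y` cannot have `y` between them. The induction links `w`
  -- to `s` through columns to the left of `lo y`.
  have common : ∀ w w' c, E w c → E w' c → ¬ E y c → (f w < f y → f w' < f y) := by
    intro w w' c h1 h2 h3 h4
    by_contra h5
    exact h3 (h.col c w y w' h1 h2 (by omega) (by omega))
  intro k
  induction k with
  | zero =>
    intro w hw h1 h2
    have h3 := hmin w hw
    obtain ⟨c, h4, h5⟩ := h.lo_mem w hw
    have h6 := h.lo_le_hi hs
    have h7 : E s c := (h.row s hs c).2 ⟨by omega, by omega⟩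
    have h8 : ¬ E y c := fun h8 => by have := (h.row y hy c).1 h8; omega
    exact ⟨common w s c h4 h7 h8, common s w c h7 h4 h8⟩
  | succ k ih =>
    intro w hw h1 h2
    rcases (hmin w hw).lt_or_eq with h3 | h3
    · obtain ⟨w', hw', h4, h5⟩ := h.exists_crossing hs hw h3
      have h6 := hmin w' hw'
      rw [← ih w' hw' (by omega) (by omega)]
      obtain ⟨c, h7, h8⟩ := h.lo_mem w hw
      have h9 : E w' c := (h.row w' hw' c).2 ⟨by omega, by omega⟩
      have h10 : ¬ E y c := fun h8 => by have := (h.row y hy c).1 h8; omega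
      exact ⟨common w w' c h7 h9 h10, common w' w c h9 h7 h10⟩
    · exact ih w hw (by omega) h2

/-- If `y` started before `x`, then `y` would lie on the same side of `x` as `s` by `same_side`,
that is, before `x`. -/
theorem lo_mono (h : IsBiconvexOn E f g lo hi K) {s x y : ℕ} (hs : s ∈ K)
    (hmin : ∀ v ∈ K, lo s ≤ lo v) (hx : x ∈ K) (hy : y ∈ K) (hsx : f s ≤ f x)
    (hxy : f x ≤ f y) : lo x ≤ lo y := by
  by_contra hlt
  rcases hsx.lt_or_eq with h1 | h1
  · have := (h.same_side hs hmin hx _ y hy le_rfl (by omega)).2 h1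
    omega
  -- `f` need not be injective: a row level with `s` contains all columns of `s`, in particular the
  -- leftmost one.
  · obtain ⟨c, h2, h3⟩ := h.lo_mem s hs
    have h4 := (h.row x hx c).1 (h.col c s x s h2 h2 (by omega) (by omega))
    have := hmin y hy
    omega

theorem lo_anti (h : IsBiconvexOn E f g lo hi K) {s x y : ℕ} (hs : s ∈ K)
    (hmin : ∀ v ∈ K, lo s ≤ lo v) (hx : x ∈ K) (hy : y ∈ K) (hsx : f x ≤ f s)
    (hxy : f y ≤ f x) : lo x ≤ lo y :=
  h.flip.lo_mono hs hmin hx hy (by omega) (by omega)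

theorem hi_mono (h : IsBiconvexOn E f g lo hi K) {e x y : ℕ} (he : e ∈ K)
    (hmax : ∀ v ∈ K, hi v ≤ hi e) (hx : x ∈ K) (hy : y ∈ K) (hye : f y ≤ f e)
    (hxy : f x ≤ f y) : hi x ≤ hi y := by
  have := h.mirror.lo_anti he (fun v hv => by have := hmax v hv; omega) hy hx hye hxy
  omega

theorem hi_anti (h : IsBiconvexOn E f g lo hi K) {e x y : ℕ} (he : e ∈ K)
    (hmax : ∀ v ∈ K, hi v ≤ hi e) (hx : x ∈ K) (hy : y ∈ K) (hye : f e ≤ f y)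
    (hxy : f y ≤ f x) : hi x ≤ hi y :=
  h.flip.hi_mono he hmax hx hy (by omega) (by omega)

/-! #### Core rows -/

/-- Translates the incidence condition `IsCore` into interval ends. Rows not contained in `s` are
those ending after `hi s`; by connectivity one of them contains the last column of `s`, so a core
row inside `s` must contain it too, and also the part of `s` met by any such row. -/
theorem core_left (h : IsBiconvexOn E f g lo hi K) {s e x : ℕ} (hs : IsLeftEnd lo hi K s)
    (he : IsRightEnd lo hi K e) (hx : x ∈ K) (hc : IsCore E s e x) :
    hi s ≤ hi x ∧ (hi x ≤ hi s → ∀ z ∈ K, hi s < hi z → lo x ≤ lo z) := by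
  have h1 := (hs.2 x hx).1
  have hsub : ∀ z ∈ K, (¬ RowSub E z s ↔ hi s < hi z) := by
    intro z hz
    have := (hs.2 z hz).1
    rw [h.sub_iff hz hs.1]
    omega
  rcases hc with hc | hc
  · rw [hsub x hx] at hc
    exact ⟨by omega, fun h => by omega⟩
  · obtain ⟨c, h2, h3⟩ := h.hi_mem s hs.1
    have key : E x c := by
      refine hc c h2 ?_
      rcases lt_or_ge (hi s) (hi e) with h4 | h4
      · obtain ⟨w, hw, h5, h6⟩ := h.exists_crossing' he.1 hs.1 h4
        exact ⟨w, (h.row w hw c).2 ⟨by omega, by omega⟩, Or.inl ((hsub w hw).2 h5)⟩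
      -- Here no row ends after `s`, so only the clause `z = e` of `IsCore` can force the last
      -- column of `s` into `x`.
      · have h5 := he.2 s hs.1
        have h7 := h.lo_le_hi hs.1
        have h6 := h5.2 (by omega)
        exact ⟨e, (h.row e he.1 c).2 ⟨by omega, by omega⟩, Or.inr rfl⟩
    have h4 := (h.row x hx c).1 key
    refine ⟨by omega, fun h5 z hz h6 => ?_⟩
    rcases le_or_gt (lo z) (hi s) with h7 | h7
    · obtain ⟨d, h8, h9⟩ := h.lo_mem z hz
      have := (hs.2 z hz).1
      have h10 := hc d ((h.row s hs.1 d).2 ⟨by omega, by omega⟩) ⟨z, h8, Or.inl ((hsub z hz).2 h6)⟩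
      have := (h.row x hx d).1 h10
      omega
    · have := h.lo_le_hi hx
      omega

theorem core_right (h : IsBiconvexOn E f g lo hi K) {s e x : ℕ} (hs : IsLeftEnd lo hi K s)
    (he : IsRightEnd lo hi K e) (hx : x ∈ K) (hc : IsCore E e s x) :
    lo x ≤ lo e ∧ (lo e ≤ lo x → ∀ z ∈ K, lo z < lo e → hi z ≤ hi x) := by
  have := h.mirror.core_left he.mirror hs.mirror hx hc
  refine ⟨by have := this.1; omega, fun h1 z hz h2 => ?_⟩
  have := this.2 (by omega) z hz (by omega)
  omega

/-- A row before `s` ends no later than `s`, and a row after `e` starts no earlier than `e`. -/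
theorem between_of_core (h : IsBiconvexOn E f g lo hi K) {s e x : ℕ} (hs : IsLeftEnd lo hi K s)
    (he : IsRightEnd lo hi K e) (hse : f s ≤ f e) (hx : x ∈ K) (h1 : hi s < hi x)
    (h2 : lo x < lo e) : f s ≤ f x ∧ f x ≤ f e := by
  constructor
  · by_contra h3
    have := h.hi_mono he.1 (fun v hv => (he.2 v hv).1) hx hs.1 hse (by omega)
    omega
  · by_contra h3
    have := h.lo_mono hs.1 (fun v hv => (hs.2 v hv).1) he.1 hx hse (by omega)
    omega

/-- A core row ends exactly where `s` ends, or starts exactly where `e` starts, or lies between `s`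
and `e`. Rows of the first kind are compared by `core_left`, of the second by `core_right`, and of
the third by monotonicity along `f`. -/
theorem core_chain_aux (h : IsBiconvexOn E f g lo hi K) {s e x y : ℕ} (hs : IsLeftEnd lo hi K s)
    (he : IsRightEnd lo hi K e) (hse : f s ≤ f e) (hx : x ∈ K) (hy : y ∈ K)
    (hx1 : IsCore E s e x) (hx2 : IsCore E e s x) (hy1 : IsCore E s e y)
    (hy2 : IsCore E e s y) :
    (lo x ≤ lo y ∧ hi x ≤ hi y) ∨ (lo y ≤ lo x ∧ hi y ≤ hi x) := by
  have ax := h.core_left hs he hx hx1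
  have ay := h.core_left hs he hy hy1
  have bx := h.core_right hs he hx hx2
  have by' := h.core_right hs he hy hy2
  rcases le_or_gt (hi x) (hi s) with h1 | h1
  · rcases le_or_gt (hi y) (hi s) with h2 | h2
    · omega
    · exact Or.inl ⟨ax.2 h1 y hy h2, by omega⟩
  rcases le_or_gt (hi y) (hi s) with h2 | h2
  · exact Or.inr ⟨ay.2 h2 x hx h1, by omega⟩
  rcases le_or_gt (lo e) (lo x) with h3 | h3
  · rcases le_or_gt (lo e) (lo y) with h4 | h4
    · omega
    · exact Or.inr ⟨by omega, bx.2 h3 y hy h4⟩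
  rcases le_or_gt (lo e) (lo y) with h4 | h4
  · exact Or.inl ⟨by omega, by'.2 h4 x hx h3⟩
  have fx := h.between_of_core hs he hse hx h1 h3
  have fy := h.between_of_core hs he hse hy h2 h4
  have lm := fun v hv => (hs.2 v hv).1
  have hm := fun v hv => (he.2 v hv).1
  rcases le_total (f x) (f y) with h5 | h5
  · exact Or.inl ⟨h.lo_mono hs.1 lm hx hy fx.1 h5, h.hi_mono he.1 hm hx hy fy.2 h5⟩
  · exact Or.inr ⟨h.lo_mono hs.1 lm hy hx fy.1 h5, h.hi_mono he.1 hm hy hx fx.2 h5⟩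

theorem core_chain (h : IsBiconvexOn E f g lo hi K) {s e x y : ℕ} (hs : IsLeftEnd lo hi K s)
    (he : IsRightEnd lo hi K e) (hx : x ∈ K) (hy : y ∈ K)
    (hx1 : IsCore E s e x) (hx2 : IsCore E e s x) (hy1 : IsCore E s e y)
    (hy2 : IsCore E e s y) :
    (lo x ≤ lo y ∧ hi x ≤ hi y) ∨ (lo y ≤ lo x ∧ hi y ≤ hi x) := by
  rcases le_total (f s) (f e) with h1 | h1
  · exact h.core_chain_aux hs he h1 hx hy hx1 hx2 hy1 hy2
  · exact h.flip.core_chain_aux hs he (by omega) hx hy hx1 hx2 hy1 hy2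

/-- A core row does not lie in the interior of another row. -/
theorem core_not_interior (h : IsBiconvexOn E f g lo hi K) {s e y w : ℕ}
    (hs : IsLeftEnd lo hi K s) (he : IsRightEnd lo hi K e) (hy : y ∈ K) (hw : w ∈ K)
    (hy1 : IsCore E s e y) (hy2 : IsCore E e s y) (h1 : lo w < lo y) (h2 : hi y < hi w) :
    False := by
  have ay := h.core_left hs he hy hy1
  have b := h.core_right hs he hy hy2
  have main : ∀ f : ℕ → ℤ, IsBiconvexOn E f g lo hi K → f s ≤ f e → False := by
    intro f h hse
    rcases le_or_gt (hi y) (hi s) with h3 | h3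
    · have := ay.2 h3 w hw (by omega)
      omega
    rcases le_or_gt (lo e) (lo y) with h4 | h4
    · have := b.2 h4 w hw (by omega)
      omega
    -- Now `y` lies between `s` and `e`, so an earlier row cannot end later and a later row cannot
    -- start earlier.
    have fy := h.between_of_core hs he hse hy h3 h4
    rcases le_total (f w) (f y) with h5 | h5
    · have := h.hi_mono he.1 (fun v hv => (he.2 v hv).1) hw hy fy.2 h5
      omega
    · have := h.lo_mono hs.1 (fun v hv => (hs.2 v hv).1) hy hw fy.1 h5
      omega
  rcases le_total (f s) (f e) with h3 | h3
  · exact main f h h3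
  · exact main _ h.flip (by omega)

/-- Suppose `x` lies between `s` and `e`. Being contained in `s`, it ends where `s` ends, so the
witness `z` against the core condition starts before `x` and precedes it in `f`. Then `z` cannot end
after `s` and cannot be `e`. -/
theorem not_core_left (h : IsBiconvexOn E f g lo hi K) {s e x : ℕ} (hs : IsLeftEnd lo hi K s)
    (he : IsRightEnd lo hi K e) (hse : f s ≤ f e) (hx : x ∈ K) (hc : ¬ IsCore E s e x) :
    f x < f s ∨ f e < f x := by
  by_contra hcon
  have h1 : f s ≤ f x := by omega
  have h2 : f x ≤ f e := by omega
  have lm := fun v hv => (hs.2 v hv).1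
  have hm := fun v hv => (he.2 v hv).1
  simp only [IsCore, not_or, not_not, not_forall] at hc
  obtain ⟨h3, c, h4, ⟨z, h5, h6⟩, h7⟩ := hc
  have hz := h.closed s hs.1 c z h4 h5
  rw [h.sub_iff hx hs.1] at h3
  have h8 := h.hi_mono he.1 hm hs.1 hx h2 h1
  rw [h.row x hx] at h7
  rw [h.row s hs.1] at h4
  rw [h.row z hz] at h5
  have h9 : lo z < lo x := by omega
  have h10 : f z < f x := by
    by_contra h11
    have := h.lo_mono hs.1 lm hx hz h1 (by omega)
    omega
  rcases h6 with h6 | h6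
  · rw [h.sub_iff hz hs.1] at h6
    have := lm z hz
    have := h.hi_mono he.1 hm hz hx h2 h10.le
    omega
  · subst h6
    omega

theorem not_core_right (h : IsBiconvexOn E f g lo hi K) {s e x : ℕ} (hs : IsLeftEnd lo hi K s)
    (he : IsRightEnd lo hi K e) (hse : f s ≤ f e) (hx : x ∈ K) (hc : ¬ IsCore E e s x) :
    f x < f s ∨ f e < f x := by
  have := h.mirror.flip.not_core_left he.mirror hs.mirror (by omega) hx hc
  omega

/-- The rows that are not in the core can be covered by two chains of rows, one of rows contained
in `s` and one of rows contained in `e`. -/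
theorem exists_coloring (h : IsBiconvexOn E f g lo hi K) {s e : ℕ} (hs : IsLeftEnd lo hi K s)
    (he : IsRightEnd lo hi K e) : ∃ χ : ℕ → Prop,
      (∀ x ∈ K, ¬ (IsCore E s e x ∧ IsCore E e s x) → χ x → RowSub E x s) ∧
      (∀ x ∈ K, ¬ (IsCore E s e x ∧ IsCore E e s x) → ¬ χ x → RowSub E x e) ∧
      (∀ x ∈ K, ∀ y ∈ K, ¬ (IsCore E s e x ∧ IsCore E e s x) →
        ¬ (IsCore E s e y ∧ IsCore E e s y) → (χ x ↔ χ y) → RowSub E x y ∨ RowSub E y x) := by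
  have main : ∀ f : ℕ → ℤ, IsBiconvexOn E f g lo hi K → f s ≤ f e → ∃ χ : ℕ → Prop,
      (∀ x ∈ K, ¬ (IsCore E s e x ∧ IsCore E e s x) → χ x → RowSub E x s) ∧
      (∀ x ∈ K, ¬ (IsCore E s e x ∧ IsCore E e s x) → ¬ χ x → RowSub E x e) ∧
      (∀ x ∈ K, ∀ y ∈ K, ¬ (IsCore E s e x ∧ IsCore E e s x) →
        ¬ (IsCore E s e y ∧ IsCore E e s y) → (χ x ↔ χ y) → RowSub E x y ∨ RowSub E y x) := by
    intro f h hse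
    have lm := fun v hv => (hs.2 v hv).1
    have hm := fun v hv => (he.2 v hv).1
    have dich : ∀ x ∈ K, ¬ (IsCore E s e x ∧ IsCore E e s x) → ¬ f x < f s → f e < f x := by
      intro x hx hc h1
      by_cases h2 : IsCore E s e x
      · exact (h.not_core_right hs he hse hx fun h3 => hc ⟨h2, h3⟩).resolve_left h1
      · exact (h.not_core_left hs he hse hx h2).resolve_left h1
    -- Towards `s` the left ends decrease and the right ends increase, so rows before `s` are
    -- nested; `down` is the same after `e`.
    have up : ∀ x ∈ K, ∀ y ∈ K, f x ≤ f y → f y ≤ f s → RowSub E x y := fun x hx y hy h1 h2 =>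
      (h.sub_iff hx hy).2 ⟨h.lo_anti hs.1 lm hy hx h2 h1, h.hi_mono he.1 hm hx hy (by omega) h1⟩
    have down : ∀ x ∈ K, ∀ y ∈ K, f y ≤ f x → f e ≤ f y → RowSub E x y := fun x hx y hy h1 h2 =>
      (h.sub_iff hx hy).2 ⟨h.lo_mono hs.1 lm hy hx (by omega) h1, h.hi_anti he.1 hm hx hy h2 h1⟩
    -- The colour records on which side of the core interval the row lies.
    refine ⟨fun x => f x < f s, fun x hx hc h1 => up x hx s hs.1 h1.le le_rfl,
      fun x hx hc h1 => down x hx e he.1 (dich x hx hc h1).le le_rfl,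
      fun x hx y hy hcx hcy hxy => ?_⟩
    by_cases h1 : f x < f s
    · have h2 := hxy.1 h1
      rcases le_total (f x) (f y) with h3 | h3
      · exact Or.inl (up x hx y hy h3 h2.le)
      · exact Or.inr (up y hy x hx h3 h1.le)
    · have h2 := dich y hy hcy fun h2 => h1 (hxy.2 h2)
      have h1 := dich x hx hcx h1
      rcases le_total (f x) (f y) with h3 | h3
      · exact Or.inr (down y hy x hx h3 h1.le)
      · exact Or.inl (down x hx y hy h3 h2.le)
  rcases le_total (f s) (f e) with h3 | h3
  · exact main f h h3
  · exact main _ h.flip (by omega)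

end IsBiconvexOn

/-! #### Breadth first search -/

theorem IsBFS.cd_pos (hB : IsBFS E K s rd cd) (h : IsBiconvexOn E f g lo hi K) {x c : ℕ}
    (hx : x ∈ K) (hc : E x c) : 1 ≤ cd c := by
  obtain ⟨y, h1, h2⟩ := hB.col_eq x hx c hc
  rw [h2]
  exact hB.pos y (h.closed x hx c y hc h1)

/-- From the start of the seed rightwards the distances of columns do not decrease. The row that
discovers `c'` either covers `c` as well, or was itself discovered through a column at or beyond `c`
of smaller distance, to which induction applies. -/
theorem IsBFS.cd_mono (hB : IsBFS E K s rd cd) (h : IsBiconvexOn E f g lo hi K) :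
    ∀ (k x c c' : ℕ), x ∈ K → E x c' → cd c' ≤ k → lo s ≤ g c → g c ≤ g c' →
      cd c ≤ cd c' := by
  intro k
  induction k with
  | zero =>
    intro x c c' hx hc' hk
    have := hB.cd_pos h hx hc'
    omega
  | succ k ih =>
    intro x c c' hx hc' hk h1 h2
    obtain ⟨y, h3, h4⟩ := hB.col_eq x hx c' hc'
    have hy := h.closed x hx c' y hc' h3
    have h5 := (h.row y hy c').1 h3
    by_cases hys : y = s
    · subst hys
      exact h4 ▸ hB.col_le y hy c ((h.row y hy c).2 ⟨h1, by omega⟩)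
    · obtain ⟨e, h6, h7⟩ := hB.row_eq y hy hys
      have h8 := (h.row y hy e).1 h6
      rcases le_total (g e) (g c) with h9 | h9
      · exact h4 ▸ hB.col_le y hy c ((h.row y hy c).2 ⟨by omega, by omega⟩)
      · have := ih y c e hy h6 (by omega) h1 h9
        omega

theorem IsBFS.cd_anti (hB : IsBFS E K s rd cd) (h : IsBiconvexOn E f g lo hi K) {x c c' : ℕ}
    (hx : x ∈ K) (hc' : E x c') (h1 : g c ≤ hi s) (h2 : g c' ≤ g c) : cd c ≤ cd c' :=
  hB.cd_mono h.mirror _ x c c' hx hc' le_rfl (by omega) (by omega)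

open Classical in
/-- Number of the columns of row `x` that satisfy `p`. -/
noncomputable def rowCount (m : ℕ) (E : ℕ → ℕ → Prop) (p : ℕ → Prop) (x : ℕ) : ℕ :=
  ((Finset.range m).filter fun c => E x c ∧ p c).card

variable {m : ℕ}

theorem rowCount_le (E : ℕ → ℕ → Prop) (p : ℕ → Prop) (x : ℕ) : rowCount m E p x ≤ m := by
  classical
  refine (Finset.card_filter_le _ _).trans (by simp)

theorem rowCount_mono {p q : ℕ → Prop} {x y : ℕ}
    (h : ∀ c, E x c → p c → E y c ∧ q c) : rowCount m E p x ≤ rowCount m E q y := by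
  classical
  exact Finset.card_le_card fun c hc => by
    simp only [Finset.mem_filter] at hc ⊢
    exact ⟨hc.1, h c hc.2.1 hc.2.2⟩

theorem eq_of_rowCount_le (hm : ∀ x c, E x c → c < m) {p q : ℕ → Prop} {x y : ℕ}
    (h : ∀ c, E x c → p c → E y c ∧ q c) (hle : rowCount m E q y ≤ rowCount m E p x) :
    ∀ c, E y c → q c → E x c ∧ p c := by
  classical
  have h1 := Finset.eq_of_subset_of_card_le (s := (Finset.range m).filter fun c => E x c ∧ p c)
    (t := (Finset.range m).filter fun c => E y c ∧ q c) (fun c hc => by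
    simp only [Finset.mem_filter] at hc ⊢
    exact ⟨hc.1, h c hc.2.1 hc.2.2⟩) hle
  intro c hc hq
  have : c ∈ (Finset.range m).filter fun c => E y c ∧ q c := by simp [hm y c hc, hc, hq]
  rw [← h1] at this
  exact (Finset.mem_filter.1 this).2

/-- If one row contains the other and has at most as many columns, then the rows are equal. -/
theorem RowSub.antisymm (hm : ∀ x c, E x c → c < m) {x y : ℕ} (h : RowSub E x y)
    (hle : rowCount m E (fun _ => True) y ≤ rowCount m E (fun _ => True) x) : RowSub E y x :=
  fun c hc => (eq_of_rowCount_le hm (fun c hc hp => ⟨h c hc, hp⟩) hle c hc trivial).1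

/-- The order of the core rows by their keys. -/
theorem IsBFS.core_key (hB : IsBFS E K s rd cd) (h : IsBiconvexOn E f g lo hi K)
    (hm : ∀ x c, E x c → c < m) {e x y : ℕ} (hs : IsLeftEnd lo hi K s)
    (he : IsRightEnd lo hi K e) (hx : x ∈ K) (hy : y ∈ K)
    (hy1 : IsCore E s e y) (hy2 : IsCore E e s y)
    (hkey : rd x < rd y ∨ rd x = rd y ∧
      (rowCount m E (fun c => cd c + 1 = rd y) y < rowCount m E (fun c => cd c + 1 = rd x) x ∨
        rowCount m E (fun c => cd c + 1 = rd y) y = rowCount m E (fun c => cd c + 1 = rd x) x ∧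
        rowCount m E (fun _ => True) x ≤ rowCount m E (fun _ => True) y))
    (hlo : lo y ≤ lo x) (hhi : hi y ≤ hi x) : lo x ≤ lo y ∧ hi x ≤ hi y := by
  have lm := fun v hv => (hs.2 v hv).1
  have two : ∀ z ∈ K, z ≠ s → 2 ≤ rd z := by
    intro z hz hzs
    obtain ⟨c, h1, h2⟩ := hB.row_eq z hz hzs
    have := hB.cd_pos h hz h1
    omega
  have hsd := hB.seed
  by_cases hys : y = s
  · by_cases hxs : x = s
    · rw [hxs, hys]; omega
    · have := two x hx hxs
      rw [hys] at hkey
      omega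
  by_cases hxs : x = s
  · have := lm y hy
    have := (h.core_left hs he hy hy1).1
    rw [hxs] at *
    omega
  -- By `cd_mono` the first column of a row has the least distance among its columns, so it
  -- determines the distance of the row.
  have rdlo : ∀ z ∈ K, z ≠ s → ∀ c, E z c → g c = lo z → rd z = cd c + 1 := by
    intro z hz hzs c hc hcl
    obtain ⟨d, h1, h2⟩ := hB.row_eq z hz hzs
    have h3 := (h.row z hz d).1 h1
    have h4 := hB.cd_mono h _ z c d hz h1 le_rfl (hcl ▸ lm z hz) (by omega)
    have := hB.row_le z hz c hc
    omega
  obtain ⟨cy, h1, h2⟩ := h.lo_mem y hy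
  obtain ⟨cx, h3, h4⟩ := h.lo_mem x hx
  have h5 := rdlo y hy hys cy h1 h2
  have h6 := rdlo x hx hxs cx h3 h4
  have h7 := hB.cd_mono h _ x cy cx hx h3 le_rfl (h2 ▸ lm y hy) (by omega)
  have hrd : rd x = rd y := by omega
  -- Suppose a column `c` of `x` in the preceding layer lies beyond `hi y`. The row `w` that
  -- discovered it will turn out to contain `y` in its interior.
  have hsub : ∀ c, E x c → cd c + 1 = rd x → E y c ∧ cd c + 1 = rd y := by
    intro c hc hcd
    refine ⟨?_, by omega⟩
    have h8 := (h.row x hx c).1 hc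
    rw [h.row y hy]
    refine ⟨by omega, ?_⟩
    by_contra h9
    obtain ⟨w, h10, h11⟩ := hB.col_eq x hx c hc
    have hw := h.closed x hx c w hc h10
    have h12 := (h.row w hw c).1 h10
    have h13 := (h.core_left hs he hy hy1).1
    by_cases hws : w = s
    · rw [hws] at h12
      omega
    · obtain ⟨d, h14, h15⟩ := hB.row_eq w hw hws
      have h16 := (h.row w hw d).1 h14
      -- The parent column `d` of `w` is one layer closer to the seed than `cy`, so it cannot lie at
      -- or after `cy`.
      have h17 : g d < g cy := by
        by_contra h18
        have := hB.cd_mono h _ w cy d hw h14 le_rfl (h2 ▸ lm y hy) (by omega)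
        omega
      exact h.core_not_interior hs he hy hw hy1 hy2 (by omega) (by omega)
  -- The inclusion and the key force equal numbers of columns in the preceding layer. Hence `x`
  -- contains the first column of `y`, so `y` is contained in `x`, and the comparison of lengths
  -- makes them equal.
  have hcnt := rowCount_mono (m := m) hsub
  have heq := eq_of_rowCount_le hm hsub (by omega)
  have h8 := (heq cy h1 (by omega)).1
  have h9 := (h.row x hx cy).1 h8
  refine ⟨by omega, ?_⟩
  have h10 : RowSub E y x := (h.sub_iff hy hx).2 ⟨by omega, hhi⟩
  have h11 := h10.antisymm hm (by omega)
  exact ((h.sub_iff hx hy).1 h11).2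

/-- The leftmost column of the component is in the last layer, because distances grow to the left of
`s`. The row `w` that discovers it also contains a column of the layer before, hence all last-layer
columns left of `s`. By maximality `R` contains these columns too, so it starts leftmost. -/
theorem IsBFS.exists_end_aux (hB : IsBFS E K s rd cd) (h : IsBiconvexOn E f g lo hi K)
    (hm : ∀ x c, E x c → c < m) (hfin : K.Finite)
    (hboth : ∀ v ∈ K, ¬ (lo v < lo s ∧ hi s < hi v)) {D R : ℕ}
    (hRK : R ∈ K)
    (hR : ∀ v ∈ K, rowCount m E (fun c => cd c = D) v < rowCount m E (fun c => cd c = D) R ∨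
      rowCount m E (fun c => cd c = D) v = rowCount m E (fun c => cd c = D) R ∧
      rowCount m E (fun _ => True) v ≤ rowCount m E (fun _ => True) R)
    (hD1 : 1 < D) (hDle : ∀ x ∈ K, ∀ c, E x c → cd c ≤ D)
    {c : ℕ} (hc : E R c) (hcD : cd c = D) (hcs : g c < lo s) :
    IsLeftEnd lo hi K R := by
  have hPR : ∀ x ∈ K, ∀ p, E x p → cd p = D → g p < lo s → E R p := by
    obtain ⟨v, hv, hvmin⟩ := hfin.exists_minimalFor lo K ⟨R, hRK⟩
    have hvmin : ∀ x ∈ K, lo v ≤ lo x := fun x hx => by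
      by_contra h1
      have := hvmin hx (by omega)
      omega
    obtain ⟨a, h1, h2⟩ := h.lo_mem v hv
    have hlh := h.lo_le_hi hB.mem
    have h3 := (h.row R hRK c).1 hc
    have h4 := hvmin R hRK
    have h5 : cd a = D := le_antisymm (hDle v hv a h1)
      (hcD ▸ hB.cd_anti h hv h1 (by omega) (by omega))
    obtain ⟨w, h6, h7⟩ := hB.col_eq v hv a h1
    have hw := h.closed v hv a w h1 h6
    have hws : w ≠ s := by
      rintro rfl
      have := hB.seed
      omega
    obtain ⟨e, h8, h9⟩ := hB.row_eq w hw hws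
    -- `p` lies between the leftmost column `a` and the parent column `e` of `w`, and both belong to
    -- `w`.
    have hPw : ∀ x ∈ K, ∀ p, E x p → cd p = D → g p < lo s → E w p := by
      intro x hx p hp hpD hps
      have h10 := (h.row x hx p).1 hp
      have h11 := hvmin x hx
      have h12 : g p ≤ g e := by
        by_contra h13
        have := hB.cd_anti h (c := p) hw h8 (by omega) (by omega)
        omega
      have h13 := (h.row w hw e).1 h8
      have h14 := (h.row w hw a).1 h6
      exact (h.row w hw p).2 ⟨by omega, by omega⟩
    -- By `hboth` the row `R`, which reaches left of `s`, does not reach right of it; columns inside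
    -- `s` have distance at most `1 < D`. So all last-layer columns of `R` lie left of `s`.
    have hsub : ∀ q, E R q → cd q = D → E w q ∧ cd q = D := by
      intro q hq hqD
      refine ⟨hPw R hRK q hq hqD ?_, hqD⟩
      have h10 := (h.row R hRK q).1 hq
      have h11 := hboth R hRK
      by_contra h12
      have h13 := hB.col_le s hB.mem q ((h.row s hB.mem q).2 ⟨by omega, by omega⟩)
      have := hB.seed
      omega
    have heq := eq_of_rowCount_le hm hsub (by have := hR w hw; omega)
    exact fun x hx p hp hpD hps => (heq p (hPw x hx p hp hpD hps) hpD).1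
  refine ⟨hRK, fun v hv => ?_⟩
  have hlo : lo R ≤ lo v := by
    by_contra h1
    obtain ⟨a, h2, h3⟩ := h.lo_mem v hv
    have h4 := (h.row R hRK c).1 hc
    have hlh := h.lo_le_hi hB.mem
    have h5 : cd a = D := le_antisymm (hDle v hv a h2)
      (hcD ▸ hB.cd_anti h hv h2 (by omega) (by omega))
    have := (h.row R hRK a).1 (hPR v hv a h2 h5 (by omega))
    omega
  refine ⟨hlo, fun h1 => ?_⟩
  by_contra h2
  have h3 : RowSub E R v := (h.sub_iff hRK hv).2 ⟨by omega, by omega⟩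
  have h4 := rowCount_mono (m := m) (p := fun c => cd c = D) (q := fun c => cd c = D)
    (fun c hc hp => ⟨h3 c hc, hp⟩)
  have h5 := h3.antisymm hm (by have := hR v hv; omega)
  have := ((h.sub_iff hv hRK).1 h5).2
  omega

/-- A row that contains the most columns of the last layer of a breadth first search, and is
longest among these rows, is an end. -/
theorem IsBFS.exists_end (hB : IsBFS E K s rd cd) (h : IsBiconvexOn E f g lo hi K)
    (hm : ∀ x c, E x c → c < m) (hfin : K.Finite)
    (hboth : ∀ v ∈ K, ¬ (lo v < lo s ∧ hi s < hi v)) {D R : ℕ}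
    (hRK : R ∈ K)
    (hR : ∀ v ∈ K, rowCount m E (fun c => cd c = D) v < rowCount m E (fun c => cd c = D) R ∨
      rowCount m E (fun c => cd c = D) v = rowCount m E (fun c => cd c = D) R ∧
      rowCount m E (fun _ => True) v ≤ rowCount m E (fun _ => True) R)
    (hD : ∃ x ∈ K, ∃ c, E x c ∧ cd c = D) (hDle : ∀ x ∈ K, ∀ c, E x c → cd c ≤ D) :
    (IsLeftEnd lo hi K R ∧ ∃ v ∈ K, lo v < lo s) ∨
    (IsRightEnd lo hi K R ∧ ∃ v ∈ K, hi s < hi v) ∨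
    (IsLeftEnd lo hi K R ∧ IsRightEnd lo hi K R) := by
  obtain ⟨x₀, hx₀, c₀, h1, h2⟩ := hD
  have hs1 := hB.seed
  -- Distances start at `1`, since `0` marks unvisited items; only the seed can discover columns of
  -- distance `1`.
  have one_mem : ∀ x ∈ K, ∀ c, E x c → cd c ≤ 1 → E s c := by
    intro x hx c hc hcd
    obtain ⟨y, h3, h4⟩ := hB.col_eq x hx c hc
    have hy := h.closed x hx c y hc h3
    by_cases hys : y = s
    · exact hys ▸ h3
    · obtain ⟨d, h5, h6⟩ := hB.row_eq y hy hys
      have := hB.cd_pos h hy h5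
      omega
  -- With a single layer the seed contains the whole component, `R` equals it as a set of columns,
  -- and `R` is an end on both sides.
  rcases le_or_gt D 1 with hD1 | hD1
  · have hD1 : D = 1 := by have := hB.cd_pos h hx₀ h1; omega
    have hall : ∀ x ∈ K, RowSub E x s := fun x hx c hc =>
      one_mem x hx c hc (hD1 ▸ hDle x hx c hc)
    have heq : RowSub E s R := fun c hc => by
      have h3 : rowCount m E (fun _ => True) s ≤ rowCount m E (fun c => cd c = D) s :=
        rowCount_mono fun c hc _ => ⟨hc, by
          have := hDle s hB.mem c hc
          have := hB.cd_pos h hB.mem hc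
          omega⟩
      have h4 : rowCount m E (fun c => cd c = D) R ≤ rowCount m E (fun _ => True) R :=
        rowCount_mono fun c hc _ => ⟨hc, trivial⟩
      have h5 := (hall R hRK).antisymm hm (by have := hR s hB.mem; omega)
      exact h5 c hc
    have hfull : ∀ v ∈ K, lo R ≤ lo v ∧ hi v ≤ hi R := fun v hv =>
      (h.sub_iff hv hRK).1 fun c hc => heq c (hall v hv c hc)
    exact Or.inr (Or.inr ⟨⟨hRK, fun v hv => ⟨(hfull v hv).1, fun _ => (hfull v hv).2⟩⟩,
      ⟨hRK, fun v hv => ⟨(hfull v hv).2, fun _ => (hfull v hv).1⟩⟩⟩)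
  · have hpos : ∃ c, E R c ∧ cd c = D := by
      by_contra hno
      have h3 := eq_of_rowCount_le (x := R) (y := x₀) (p := fun c => cd c = D)
        (q := fun c => cd c = D) hm (fun c hc hp => absurd ⟨c, hc, hp⟩ hno)
        (by have := hR x₀ hx₀; omega) c₀ h1 h2
      exact hno ⟨c₀, h3⟩
    obtain ⟨c, hc, hcD⟩ := hpos
    have hcs : ¬ E s c := fun h3 => by
      have := hB.col_le s hB.mem c h3
      omega
    rw [h.row s hB.mem] at hcs
    have h4 := (h.row R hRK c).1 hc
    rcases lt_or_ge (g c) (lo s) with h3 | h3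
    · exact Or.inl ⟨hB.exists_end_aux h hm hfin hboth hRK hR hD1 hDle hc hcD h3,
        R, hRK, by omega⟩
    · refine Or.inr (Or.inl ⟨?_, R, hRK, by omega⟩)
      have h5 := (hB.exists_end_aux h.mirror hm hfin (fun v hv h6 => hboth v hv (by
        omega)) hRK hR hD1 hDle hc hcD (by omega)).mirror
      simpa using h5

end

/-- The order of the rows of a component: the chain of rows below `s` (class `0`) increasing,
then the core rows (class `1`), then the chain of rows below `e` (class `2`) decreasing. -/
def RowLe (m : ℕ) (E : ℕ → ℕ → Prop) (rd cd cls : ℕ → ℕ) (x y : ℕ) : Prop :=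
  cls x < cls y ∨ cls x = cls y ∧
    (cls x = 0 ∧ rowCount m E (fun _ => True) x ≤ rowCount m E (fun _ => True) y ∨
      cls x = 1 ∧ (rd x < rd y ∨ rd x = rd y ∧
        (rowCount m E (fun c => cd c + 1 = rd y) y < rowCount m E (fun c => cd c + 1 = rd x) x ∨
          rowCount m E (fun c => cd c + 1 = rd y) y = rowCount m E (fun c => cd c + 1 = rd x) x ∧
          rowCount m E (fun _ => True) x ≤ rowCount m E (fun _ => True) y)) ∨
      cls x = 2 ∧ rowCount m E (fun _ => True) y ≤ rowCount m E (fun _ => True) x)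

/-- In the order `RowLe` of the rows every column is convex. -/
theorem IsBiconvexOn.convex_rowLe {E : ℕ → ℕ → Prop} {f g lo hi : ℕ → ℤ} {K : Set ℕ} {s e m : ℕ}
    {rd cd cls : ℕ → ℕ} (h : IsBiconvexOn E f g lo hi K) (hm : ∀ x c, E x c → c < m)
    (hs : IsLeftEnd lo hi K s) (he : IsRightEnd lo hi K e) (hB : IsBFS E K s rd cd)
    (hcls : ∀ x ∈ K, cls x ≤ 2)
    (hcore : ∀ x ∈ K, cls x = 1 ↔ IsCore E s e x ∧ IsCore E e s x)
    (hT : ∀ x ∈ K, cls x = 0 → RowSub E x s) (hE : ∀ x ∈ K, cls x = 2 → RowSub E x e)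
    (hchain : ∀ x ∈ K, ∀ y ∈ K, cls x ≠ 1 → cls x = cls y → RowSub E x y ∨ RowSub E y x)
    {x y z c : ℕ} (hx : x ∈ K) (hy : y ∈ K) (hz : z ∈ K) (hxc : E x c) (hzc : E z c)
    (hxy : RowLe m E rd cd cls x y) (hyz : RowLe m E rd cd cls y z) : E y c := by
  have hcy := hcls y hy
  have core_le : ∀ x ∈ K, ∀ y ∈ K, cls x = 1 → cls y = 1 → RowLe m E rd cd cls x y →
      lo x ≤ lo y ∧ hi x ≤ hi y := by
    intro x hx y hy h1 h2 h3
    have h4 := (hcore x hx).1 h1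
    have h5 := (hcore y hy).1 h2
    rcases h.core_chain hs he hx hy h4.1 h4.2 h5.1 h5.2 with h6 | h6
    · exact h6
    · refine hB.core_key h hm hs he hx hy h5.1 h5.2 ?_ h6.1 h6.2
      rcases h3 with h3 | ⟨-, h3 | h3 | h3⟩
      · omega
      · omega
      · exact h3.2
      · omega
  have hcases : cls y = 0 ∨ cls y = 1 ∨ cls y = 2 := by omega
  rcases hcases with h1 | h1 | h1
  · have h2 : cls x = 0 := by rcases hxy with h | h <;> omega
    have h3 : rowCount m E (fun _ => True) x ≤ rowCount m E (fun _ => True) y := by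
      rcases hxy with h | ⟨-, h | h | h⟩ <;> omega
    rcases hchain x hx y hy (by omega) (by omega) with h4 | h4
    · exact h4 c hxc
    · exact h4.antisymm hm h3 c hxc
  · have h2 := (hcore y hy).1 h1
    -- A row of class `0` is replaced by `s`, which contains it and has both ends at or before those
    -- of any core row; dually below with `e`. Then `c` is squeezed into `y`.
    have hl : ∃ x' ∈ K, E x' c ∧ lo x' ≤ lo y ∧ hi x' ≤ hi y := by
      have h3 : cls x = 0 ∨ cls x = 1 := by
        have := hcls x hx
        rcases hxy with h | h <;> omega
      rcases h3 with h3 | h3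
      · exact ⟨s, hs.1, hT x hx h3 c hxc, (hs.2 y hy).1, (h.core_left hs he hy h2.1).1⟩
      · exact ⟨x, hx, hxc, core_le x hx y hy h3 h1 hxy⟩
    have hr : ∃ z' ∈ K, E z' c ∧ lo y ≤ lo z' ∧ hi y ≤ hi z' := by
      have h3 : cls z = 2 ∨ cls z = 1 := by
        have := hcls z hz
        rcases hyz with h | h <;> omega
      rcases h3 with h3 | h3
      · exact ⟨e, he.1, hE z hz h3 c hzc, (h.core_right hs he hy h2.2).1, (he.2 y hy).1⟩
      · exact ⟨z, hz, hzc, core_le y hy z hz h1 h3 hyz⟩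
    obtain ⟨x', h3, h4, h5, h6⟩ := hl
    obtain ⟨z', h7, h8, h9, h10⟩ := hr
    have h11 := (h.row x' h3 c).1 h4
    have h12 := (h.row z' h7 c).1 h8
    exact (h.row y hy c).2 ⟨by omega, by omega⟩
  · have h2 : cls z = 2 := by
      have := hcls z hz
      rcases hyz with h | h <;> omega
    have h3 : rowCount m E (fun _ => True) z ≤ rowCount m E (fun _ => True) y := by
      rcases hyz with h | ⟨-, h | h | h⟩ <;> omega
    rcases hchain y hy z hz (by omega) (by omega) with h4 | h4
    · exact h4.antisymm hm h3 c hzc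
    · exact h4 c hzc

/-! ### A program logic for the word RAM -/

/-- The state after writing `v` to register `x`. -/
def RAMState.setReg (s : RAMState) (x v : ℕ) : RAMState :=
  { s with reg := Function.update s.reg x v }

/-- The state after writing `v` to cell `i` of array `a`. -/
def RAMState.setMem (s : RAMState) (a i v : ℕ) : RAMState :=
  { s with mem := Function.update s.mem a (Function.update (s.mem a) i v) }

@[simp] theorem RAMState.setReg_reg (s : RAMState) (x v y : ℕ) :
    (s.setReg x v).reg y = if y = x then v else s.reg y := by
  simp [RAMState.setReg, Function.update_apply]

@[simp] theorem RAMState.setReg_mem (s : RAMState) (x v : ℕ) : (s.setReg x v).mem = s.mem := rfl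

@[simp] theorem RAMState.setMem_reg (s : RAMState) (a i v : ℕ) :
    (s.setMem a i v).reg = s.reg := rfl

@[simp] theorem RAMState.setMem_mem (s : RAMState) (a i v b : ℕ) :
    (s.setMem a i v).mem b = if b = a then Function.update (s.mem a) i v else s.mem b := by
  simp only [RAMState.setMem, Function.update_apply]

namespace RAMProgram

/-- Registers that a program may write. -/
def regs : RAMProgram → List ℕ
  | skip => []
  | assign x _ => [x]
  | store _ _ _ => []
  | seq p q => p.regs ++ q.regs
  | ite _ p q => p.regs ++ q.regs
  | .while _ p => p.regs

/-- Arrays that a program may write. -/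
def arrays : RAMProgram → List ℕ
  | skip => []
  | assign _ _ => []
  | store a _ _ => [a]
  | seq p q => p.arrays ++ q.arrays
  | ite _ p q => p.arrays ++ q.arrays
  | .while _ p => p.arrays

theorem Runs.frame {W : ℕ} {p : RAMProgram} {s s' : RAMState} {t : ℕ} (h : p.Runs W s t s') :
    (∀ x, x ∉ p.regs → s'.reg x = s.reg x) ∧ (∀ a, a ∉ p.arrays → s'.mem a = s.mem a) := by
  induction h with
  | skip s => simp
  | assign s x e he =>
    exact ⟨fun y hy => Function.update_of_ne (by simpa [regs] using hy) _ _, fun _ _ => rfl⟩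
  | store s a i e hi he =>
    exact ⟨fun _ _ => rfl, fun y hy => Function.update_of_ne (by simpa [arrays] using hy) _ _⟩
  | seq _ _ ih1 ih2 =>
    constructor
    · intro x hx
      simp only [regs, List.mem_append, not_or] at hx
      rw [ih2.1 x hx.2, ih1.1 x hx.1]
    · intro x hx
      simp only [arrays, List.mem_append, not_or] at hx
      rw [ih2.2 x hx.2, ih1.2 x hx.1]
  | ite_true _ _ ih =>
    exact ⟨fun x hx => ih.1 x fun h => hx (by simp [regs, h]),
      fun x hx => ih.2 x fun h => hx (by simp [arrays, h])⟩
  | ite_false _ _ ih =>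
    exact ⟨fun x hx => ih.1 x fun h => hx (by simp [regs, h]),
      fun x hx => ih.2 x fun h => hx (by simp [arrays, h])⟩
  | while_true _ _ _ ih1 ih2 =>
    constructor
    · intro x hx
      rw [ih2.1 x hx, ih1.1 x hx]
    · intro x hx
      rw [ih2.2 x hx, ih1.2 x hx]
  | while_false _ => simp

/-- Started in state `s`, the program `p` halts, and its running time and its final state
satisfy `Q`. -/
def Ends (W : ℕ) (p : RAMProgram) (s : RAMState) (Q : ℕ → RAMState → Prop) : Prop :=
  ∃ t s', p.Runs W s t s' ∧ Q t s'

variable {W : ℕ} {p q : RAMProgram} {s : RAMState} {e : RAMExpr} {Q Q' : ℕ → RAMState → Prop}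

theorem Ends.mono (h : p.Ends W s Q) (hQ : ∀ t s', Q t s' → Q' t s') : p.Ends W s Q' := by
  obtain ⟨t, s', h1, h2⟩ := h
  exact ⟨t, s', h1, hQ t s' h2⟩

/-- The frame rule: registers and arrays that `p` does not write are unchanged. -/
theorem Ends.frame (h : p.Ends W s Q) (hQ : ∀ t s', (∀ x, x ∉ p.regs → s'.reg x = s.reg x) →
    (∀ a, a ∉ p.arrays → s'.mem a = s.mem a) → Q t s' → Q' t s') : p.Ends W s Q' := by
  obtain ⟨t, s', h1, h2⟩ := h
  exact ⟨t, s', h1, hQ t s' h1.frame.1 h1.frame.2 h2⟩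

theorem Ends.skip (h : Q 1 s) : (RAMProgram.skip).Ends W s Q := ⟨1, s, .skip s, h⟩

theorem Ends.assign {x : ℕ} (he : e.eval s < W) (h : Q (e.cost + 1) (s.setReg x (e.eval s))) :
    (RAMProgram.assign x e).Ends W s Q := ⟨_, _, .assign s x e he, h⟩

theorem Ends.store {a : ℕ} {i : RAMExpr} (hi : i.eval s < W) (he : e.eval s < W)
    (h : Q (i.cost + e.cost + 1) (s.setMem a (i.eval s) (e.eval s))) :
    (RAMProgram.store a i e).Ends W s Q := ⟨_, _, .store s a i e hi he, h⟩

theorem Ends.seq (h : p.Ends W s fun t s' => q.Ends W s' fun t' s'' => Q (t + t') s'') :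
    (RAMProgram.seq p q).Ends W s Q := by
  obtain ⟨t, s', h1, t', s'', h2, h3⟩ := h
  exact ⟨_, _, .seq h1 h2, h3⟩

theorem Ends.ite (h1 : e.eval s ≠ 0 → p.Ends W s fun t s' => Q (e.cost + 1 + t) s')
    (h2 : e.eval s = 0 → q.Ends W s fun t s' => Q (e.cost + 1 + t) s') :
    (RAMProgram.ite e p q).Ends W s Q := by
  by_cases h : e.eval s = 0
  · obtain ⟨t, s', h3, h4⟩ := h2 h
    exact ⟨_, _, .ite_false h h3, h4⟩
  · obtain ⟨t, s', h3, h4⟩ := h1 h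
    exact ⟨_, _, .ite_true h h3, h4⟩

/-- The rule for loops. The first argument of the invariant is the time used so far. -/
theorem Ends.while (I : ℕ → RAMState → Prop) (μ : RAMState → ℕ) (h0 : I 0 s)
    (hI : ∀ τ s, I τ s → e.eval s ≠ 0 →
      p.Ends W s fun t s' => μ s' < μ s ∧ I (τ + (e.cost + 1) + t) s')
    (hQ : ∀ τ s, I τ s → e.eval s = 0 → Q (τ + (e.cost + 1)) s) :
    (RAMProgram.while e p).Ends W s Q := by
  suffices H : ∀ (k : ℕ) (s : RAMState) (τ : ℕ), μ s ≤ k → I τ s →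
      (RAMProgram.while e p).Ends W s fun t s' => Q (τ + t) s' by
    simpa using H _ s 0 le_rfl h0
  intro k
  induction k with
  | zero =>
    intro s τ hk hs
    by_cases h : e.eval s = 0
    · exact ⟨_, _, .while_false h, hQ τ s hs h⟩
    · obtain ⟨t, s', h1, h2, h3⟩ := hI τ s hs h
      omega
  | succ k ih =>
    intro s τ hk hs
    by_cases h : e.eval s = 0
    · exact ⟨_, _, .while_false h, hQ τ s hs h⟩
    · obtain ⟨t, s', h1, h2, h3⟩ := hI τ s hs h
      obtain ⟨t', s'', h4, h5⟩ := ih s' _ (by omega) h3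
      refine ⟨_, _, .while_true h h1 h4, ?_⟩
      convert h5 using 1
      ring

/-- `for x := 0` to `e - 1` do `p`. -/
def forTo (x : ℕ) (e : RAMExpr) (p : RAMProgram) : RAMProgram :=
  .seq (.assign x (.const 0)) (.while (.lt (.reg x) e)
    (.seq p (.assign x (.add (.reg x) (.const 1)))))

/-- The states `s` and `s'` differ only in what `p` may write. -/
def Frame (p : RAMProgram) (s s' : RAMState) : Prop :=
  (∀ x, x ∉ p.regs → s'.reg x = s.reg x) ∧ (∀ a, a ∉ p.arrays → s'.mem a = s.mem a)

/-- The rule for counting loops. The arguments of the invariant are the number of iterations and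
the time used so far. -/
theorem Ends.forTo {x : ℕ} (N : ℕ) (I : ℕ → ℕ → RAMState → Prop) (hNW : N < W)
    (he : ∀ s', Frame (RAMProgram.forTo x e p) s s' → e.eval s' = N)
    (h0 : I 0 2 (s.setReg x 0))
    (hI : ∀ k τ s', Frame (RAMProgram.forTo x e p) s s' → s'.reg x = k → I k τ s' → k < N →
      p.Ends W s' fun t s'' => s''.reg x = k ∧
        (Frame p s' s'' → I (k + 1) (τ + (e.cost + 7) + t) (s''.setReg x (k + 1))))
    (hQ : ∀ τ s', Frame (RAMProgram.forTo x e p) s s' → I N τ s' → Q (τ + (e.cost + 3)) s') :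
    (RAMProgram.forTo x e p).Ends W s Q := by
  refine Ends.seq (Ends.assign (by simp [RAMExpr.eval]; omega) ?_)
  -- The `2` is the time of `x := 0`. A round costs `e.cost + 3` for the test and `4` for the
  -- increment besides the body.
  refine Ends.while (fun τ s' => ∃ k ≤ N, s'.reg x = k ∧ Frame (RAMProgram.forTo x e p) s s' ∧
    I k (2 + τ) s') (fun s => N - s.reg x) ⟨0, by omega, by simp [RAMExpr.eval], ⟨?_, ?_⟩, h0⟩ ?_ ?_
  · intro y hy
    simp only [RAMProgram.forTo, regs, List.mem_append, List.mem_singleton] at hy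
    simp only [RAMState.setReg_reg]
    rw [if_neg (by tauto)]
  · intro y hy
    rfl
  · rintro τ s' ⟨k, hk, hx, hF, h1⟩ h2
    have h3 : k < N := by
      simp only [RAMExpr.eval, hx, he _ hF] at h2
      by_contra h3
      simp [h3] at h2
    refine Ends.seq ((hI k _ s' hF hx h1 h3).frame ?_)
    rintro t s'' hr ha ⟨h4, h5⟩
    refine Ends.assign (by simp [RAMExpr.eval, h4]; omega) ⟨?_, k + 1, h3, ?_, ⟨?_, ?_⟩, ?_⟩
    · simp [RAMExpr.eval, h4, hx]; omega
    · simp [RAMExpr.eval, h4]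
    · intro y hy
      rw [← hF.1 y hy]
      simp only [RAMProgram.forTo, regs, List.mem_append, List.mem_singleton] at hy
      rw [RAMState.setReg_reg, if_neg (by tauto), hr y (by tauto)]
    · intro y hy
      rw [← hF.2 y hy]
      simp only [RAMProgram.forTo, arrays, List.mem_append, List.not_mem_nil] at hy
      rw [RAMState.setReg_mem, ha y (by tauto)]
    · simp only [RAMExpr.eval, h4, RAMExpr.cost]
      convert h5 ⟨hr, ha⟩ using 1
      ring
  · rintro τ s' ⟨k, hk, hx, hF, h1⟩ h2
    have h3 : k = N := by
      simp only [RAMExpr.eval, hx, he _ hF] at h2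
      by_contra h3
      simp [show k < N by omega] at h2
    subst h3
    convert hQ _ s' hF h1 using 1
    simp only [RAMExpr.cost]
    ring

/-- The rule for counting loops whose iterations take a bounded time. -/
theorem Ends.forTo_bdd {x : ℕ} (N T : ℕ) (I : ℕ → RAMState → Prop) (hNW : N < W)
    (he : ∀ s', Frame (RAMProgram.forTo x e p) s s' → e.eval s' = N)
    (h0 : I 0 (s.setReg x 0))
    (hI : ∀ k s', Frame (RAMProgram.forTo x e p) s s' → s'.reg x = k → I k s' → k < N →
      p.Ends W s' fun t s'' => s''.reg x = k ∧ t ≤ T ∧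
        (Frame p s' s'' → I (k + 1) (s''.setReg x (k + 1))))
    (hQ : ∀ τ s', Frame (RAMProgram.forTo x e p) s s' → I N s' →
      τ ≤ N * (T + e.cost + 7) + e.cost + 5 → Q τ s') :
    (RAMProgram.forTo x e p).Ends W s Q := by
  refine Ends.forTo N (fun k τ s => I k s ∧ τ ≤ 2 + k * (T + e.cost + 7)) hNW he ⟨h0, by omega⟩
    ?_ ?_
  · rintro k τ s' hF hx ⟨h1, h2⟩ hk
    refine (hI k s' hF hx h1 hk).mono ?_
    rintro t s'' ⟨h3, h4, h5⟩
    refine ⟨h3, fun hF' => ⟨h5 hF', ?_⟩⟩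
    rw [add_one_mul]
    omega
  · rintro τ s' hF ⟨h1, h2⟩
    exact hQ _ s' hF h1 (by omega)

end RAMProgram

/-! ### Filling arrays -/

namespace RAMProgram

/-- For `i < b₁` let `a[i]` be the result of initializing register `4` with `e₀` and executing the
assignment of `e` to register `4` for `j < b₂`. Registers `2` and `3` hold `i` and `j`. -/
def fill (a : ℕ) (b₁ b₂ e₀ e : RAMExpr) : RAMProgram :=
  forTo 2 b₁ (.seq (.assign 4 e₀) (.seq (forTo 3 b₂ (.assign 4 e)) (.store a (.reg 2) (.reg 4))))

theorem regs_fill (a : ℕ) (b₁ b₂ e₀ e : RAMExpr) : (fill a b₁ b₂ e₀ e).regs = [2, 4, 3, 4, 3, 2] :=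
  rfl

theorem arrays_fill (a : ℕ) (b₁ b₂ e₀ e : RAMExpr) : (fill a b₁ b₂ e₀ e).arrays = [a] := rfl

/-- The states `s` and `s'` differ only in the registers `2`, `3`, `4` and the array `a`. -/
def FillFrame (a : ℕ) (s s' : RAMState) : Prop :=
  (∀ x, x ≠ 2 → x ≠ 3 → x ≠ 4 → s'.reg x = s.reg x) ∧ (∀ b, b ≠ a → s'.mem b = s.mem b)

/-- Nearly every array of the algorithm is filled by this double loop. `G i j` is the accumulator
for the cell `i` after `j` rounds. -/
theorem Ends.fill {W a : ℕ} {b₁ b₂ e₀ e : RAMExpr} {s : RAMState} {Q : ℕ → RAMState → Prop}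
    (N M : ℕ) (G : ℕ → ℕ → ℕ) (hN : N < W) (hM : M < W)
    (hb₁ : ∀ s', FillFrame a s s' → b₁.eval s' = N)
    (hb₂ : ∀ s', FillFrame a s s' → b₂.eval s' = M)
    (he₀ : ∀ s', FillFrame a s s' → s'.reg 2 < N → e₀.eval s' = G (s'.reg 2) 0)
    (he : ∀ s', FillFrame a s s' → s'.reg 2 < N → s'.reg 3 < M →
      s'.reg 4 = G (s'.reg 2) (s'.reg 3) → e.eval s' = G (s'.reg 2) (s'.reg 3 + 1))
    (hG : ∀ i < N, ∀ j ≤ M, G i j < W)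
    (hQ : ∀ τ s', FillFrame a s s' → (∀ k, s'.mem a k = if k < N then G k M else s.mem a k) →
      τ ≤ (e.cost + e₀.cost + b₁.cost + 2 * b₂.cost + 30) * ((N + 1) * (M + 1)) → Q τ s') :
    (fill a b₁ b₂ e₀ e).Ends W s Q := by
  have toFF : ∀ {s'}, Frame (RAMProgram.fill a b₁ b₂ e₀ e) s s' → FillFrame a s s' := by
    rintro s' ⟨h1, h2⟩
    exact ⟨fun x h3 h4 h5 => h1 x (by simp [regs_fill, h3, h4, h5]),
      fun b hb => h2 b (by simp [arrays_fill, hb])⟩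
  have step : ∀ {s' s''}, FillFrame a s s' → (∀ x, x ≠ 2 → x ≠ 3 → x ≠ 4 → s''.reg x = s'.reg x) →
      (∀ b, b ≠ a → s''.mem b = s'.mem b) → FillFrame a s s'' := by
    rintro s' s'' ⟨h1, h2⟩ h3 h4
    exact ⟨fun x h5 h6 h7 => (h3 x h5 h6 h7).trans (h1 x h5 h6 h7),
      fun b hb => (h4 b hb).trans (h2 b hb)⟩
  refine Ends.forTo_bdd N ((M + 1) * (e.cost + e₀.cost + 2 * b₂.cost + 22))
    (fun i s' => ∀ k, s'.mem a k = if k < i then G k M else s.mem a k) hN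
    (fun s' h => hb₁ s' (toFF h)) (by simp) ?_ ?_
  · intro i s' hF hi hI hiN
    have hF := toFF hF
    have e0 := he₀ s' hF (by omega)
    refine Ends.seq (Ends.assign (by rw [e0]; exact hG _ (by omega) _ (by omega)) ?_)
    rw [e0]
    set s₁ := s'.setReg 4 (G (s'.reg 2) 0) with hs₁
    have hF₁ : FillFrame a s s₁ := step hF (fun x _ _ h => by simp [hs₁, h]) (fun b _ => rfl)
    have toFF₁ : ∀ {s₂}, Frame (RAMProgram.forTo 3 b₂ (.assign 4 e)) s₁ s₂ → FillFrame a s s₂ ∧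
        s₂.reg 2 = i ∧ s₂.mem a = s'.mem a := by
      rintro s₂ ⟨h1, h2⟩
      refine ⟨step hF₁ (fun x h3 h4 h5 => h1 x ?_) (fun b hb => h2 b ?_), ?_, ?_⟩
      · simp [RAMProgram.forTo, regs, h4, h5]
      · simp [RAMProgram.forTo, arrays]
      · rw [h1 2 (by simp [RAMProgram.forTo, regs])]
        simp [hs₁, hi]
      · rw [h2 a (by simp [RAMProgram.forTo, arrays])]
        rfl
    refine Ends.seq (Ends.forTo_bdd M (e.cost + 1) (fun j s₂ => s₂.reg 4 = G i j) hM
      (fun s₂ h => hb₂ s₂ (toFF₁ h).1) (by simp [hs₁, hi]) ?_ ?_)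
    · intro j s₂ hF₂ hj h4 hjM
      obtain ⟨h5, h6, h7⟩ := toFF₁ hF₂
      have h8 := he s₂ h5 (by omega) (by omega) (by rw [h6, hj, h4])
      rw [h6, hj] at h8
      refine Ends.assign (by rw [h8]; exact hG _ (by omega) _ (by omega)) ?_
      simp [hj, h8]
    · intro τ s₂ hF₂ h4 hτ
      obtain ⟨h5, h6, h7⟩ := toFF₁ hF₂
      refine Ends.store (by simp [RAMExpr.eval, h6]; omega)
        (by simp only [RAMExpr.eval, h4]; exact hG _ (by omega) _ (by omega)) ⟨by simp [h6], ?_, ?_⟩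
      · simp only [RAMExpr.cost]
        nlinarith
      · intro _ k
        simp only [RAMExpr.eval, RAMState.setReg_mem, RAMState.setMem_mem, if_true,
          Function.update_apply, h6, h4, h7, hI]
        split_ifs <;> first | rfl | omega | skip
        · simp_all
  · intro τ s' hF hI hτ
    refine hQ τ s' (toFF hF) hI (hτ.trans ?_)
    nlinarith [Nat.zero_le (N * M), Nat.zero_le (N * M * b₁.cost), Nat.zero_le (M * b₁.cost),
      Nat.zero_le (M * e.cost), Nat.zero_le (M * e₀.cost), Nat.zero_le (M * b₂.cost)]

/-- `a[i] := ∑ j < b₂, e` for `i < b₁`. -/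
def fillSum (a : ℕ) (b₁ b₂ e : RAMExpr) : RAMProgram :=
  fill a b₁ b₂ (.const 0) (.add (.reg 4) e)

/-- `a[i]` is the maximum of `e₀` and of `e` for `j < b₂`, for `i < b₁`. -/
def fillMax (a : ℕ) (b₁ b₂ e₀ e : RAMExpr) : RAMProgram :=
  fill a b₁ b₂ e₀ (.add (.reg 4) (.sub e (.reg 4)))

theorem Ends.fillSum {W a : ℕ} {b₁ b₂ e : RAMExpr} {s : RAMState} {Q : ℕ → RAMState → Prop}
    (N M : ℕ) (F : ℕ → ℕ → ℕ) (hN : N < W) (hM : M < W)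
    (hb₁ : ∀ s', FillFrame a s s' → b₁.eval s' = N)
    (hb₂ : ∀ s', FillFrame a s s' → b₂.eval s' = M)
    (he : ∀ s', FillFrame a s s' → s'.reg 2 < N → s'.reg 3 < M →
      e.eval s' = F (s'.reg 2) (s'.reg 3))
    (hF : ∀ i < N, ∑ j ∈ Finset.range M, F i j < W)
    (hQ : ∀ τ s', FillFrame a s s' →
      (∀ k < N, s'.mem a k = ∑ j ∈ Finset.range M, F k j) → (∀ k, N ≤ k → s'.mem a k = s.mem a k) →
      τ ≤ (e.cost + b₁.cost + 2 * b₂.cost + 33) * ((N + 1) * (M + 1)) → Q τ s') :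
    (fillSum a b₁ b₂ e).Ends W s Q := by
  refine Ends.fill N M (fun i j => ∑ j ∈ Finset.range j, F i j) hN hM hb₁ hb₂
    (fun s' _ _ => by simp [RAMExpr.eval])
    (fun s' h1 h2 h3 h4 => by simp [RAMExpr.eval, he s' h1 h2 h3, h4, Finset.sum_range_succ])
    (fun i hi j hj => lt_of_le_of_lt (Finset.sum_le_sum_of_subset
      (Finset.range_subset_range.2 hj)) (hF i hi)) ?_
  intro τ s' h1 h2 h3
  refine hQ τ s' h1 (fun k hk => by rw [h2, if_pos hk]) (fun k hk => by
    rw [h2, if_neg (by omega)]) (h3.trans ?_)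
  simp only [RAMExpr.cost]
  exact Nat.mul_le_mul_right _ (by omega)

theorem Ends.fillMax {W a : ℕ} {b₁ b₂ e₀ e : RAMExpr} {s : RAMState} {Q : ℕ → RAMState → Prop}
    (N M : ℕ) (F₀ : ℕ → ℕ) (F : ℕ → ℕ → ℕ) (hN : N < W) (hM : M < W)
    (hb₁ : ∀ s', FillFrame a s s' → b₁.eval s' = N)
    (hb₂ : ∀ s', FillFrame a s s' → b₂.eval s' = M)
    (he₀ : ∀ s', FillFrame a s s' → s'.reg 2 < N → e₀.eval s' = F₀ (s'.reg 2))
    (he : ∀ s', FillFrame a s s' → s'.reg 2 < N → s'.reg 3 < M →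
      e.eval s' = F (s'.reg 2) (s'.reg 3))
    (hF₀ : ∀ i < N, F₀ i < W) (hF : ∀ i < N, ∀ j < M, F i j < W)
    (hQ : ∀ τ s', FillFrame a s s' →
      (∀ k < N, s'.mem a k = F₀ k ⊔ (Finset.range M).sup (F k)) →
      τ ≤ (e.cost + e₀.cost + b₁.cost + 2 * b₂.cost + 34) * ((N + 1) * (M + 1)) → Q τ s') :
    (fillMax a b₁ b₂ e₀ e).Ends W s Q := by
  refine Ends.fill N M (fun i j => F₀ i ⊔ (Finset.range j).sup (F i)) hN hM hb₁ hb₂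
    (fun s' h1 h2 => by simp [he₀ s' h1 h2])
    (fun s' h1 h2 h3 h4 => by
      -- With truncated subtraction, `a + (b - a)` is the maximum of `a` and `b`.
      simp only [RAMExpr.eval, he s' h1 h2 h3, h4, Finset.range_add_one, Finset.sup_insert]
      omega)
    (fun i hi j hj => by
      have h0 := hF₀ i hi
      refine max_lt h0 ((Finset.sup_lt_iff (by simp; omega)).2 fun k hk => ?_)
      exact hF i hi k (by simp at hk; omega)) ?_
  intro τ s' h1 h2 h3
  refine hQ τ s' h1 (fun k hk => by rw [h2, if_pos hk]) (h3.trans ?_)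
  simp only [RAMExpr.cost]
  exact Nat.mul_le_mul_right _ (by omega)

end RAMProgram

/-! ### Breadth first search: invariants -/

/-- Two rows share a column. -/
def RowShare (E : ℕ → ℕ → Prop) (x y : ℕ) : Prop := ∃ c, E x c ∧ E y c

/-- The data of a breadth first search: distances of rows and columns, the queue of rows, the
components of rows, the seeds of components, and the largest distances of columns in
components. -/
structure BFSState where
  rd : ℕ → ℕ
  cd : ℕ → ℕ
  q : ℕ → ℕ
  cmp : ℕ → ℕ
  sd : ℕ → ℕ
  Dm : ℕ → ℕ
  tail : ℕ
  head : ℕ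
  K : ℕ

/-- The invariant of the breadth first search. The component `b.K` is current, the number of
started components is `κ`, and `X` is the relation of incidences not yet taken into account. -/
structure BFSInv (E : ℕ → ℕ → Prop) (n : ℕ) (Best : ℕ → ℕ → Prop) (L : ℕ → Prop) (κ : ℕ)
    (X : ℕ → ℕ → Prop) (b : BFSState) : Prop where
  q_lt : ∀ h < b.tail, b.q h < n ∧ b.rd (b.q h) ≠ 0
  q_surj : ∀ x, b.rd x ≠ 0 → ∃ h < b.tail, b.q h = x
  q_inj : ∀ h < b.tail, ∀ h' < b.tail, b.q h = b.q h' → h = h'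
  head_le : b.head ≤ b.tail
  mono : ∀ h h', b.head ≤ h → h ≤ h' → h' < b.tail → b.rd (b.q h) ≤ b.rd (b.q h')
  mono_head : ∀ h, b.head ≤ h → h < b.tail → b.rd (b.q h) ≤ b.rd (b.q b.head) + 1
  processed : ∀ h < b.head, ∀ c, E (b.q h) c → b.cd c ≠ 0
  col_le : ∀ x c, E x c → b.rd x ≠ 0 → b.cd c ≤ b.rd x
  row_visited : ∀ x c, E x c → b.cd c ≠ 0 → ¬ X x c → b.rd x ≠ 0
  row_le : ∀ x c, E x c → b.rd x ≠ 0 → b.cd c ≠ 0 → b.rd x ≤ b.cd c + 1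
  col_eq : ∀ c, b.cd c ≠ 0 → ∃ x, E x c ∧ b.rd x ≠ 0 ∧ b.cd c = b.rd x
  row_eq : ∀ x, b.rd x ≠ 0 → x = b.sd (b.cmp x) ∨ ∃ c, E x c ∧ b.cd c ≠ 0 ∧ b.rd x = b.cd c + 1
  cmp_lt : ∀ x, b.rd x ≠ 0 → b.cmp x < κ
  cmp_cur : ∀ h, b.head ≤ h → h < b.tail → b.cmp (b.q h) = b.K
  share : ∀ x y c, E x c → E y c → b.rd x ≠ 0 → b.rd y ≠ 0 → b.cmp x = b.cmp y
  seed : ∀ k < κ, b.rd (b.sd k) = 1 ∧ b.cmp (b.sd k) = k ∧ L (b.sd k) ∧ b.sd k < n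
  best : ∀ x, b.rd x ≠ 0 → Best (b.sd (b.cmp x)) x
  best_cur : ∀ x < n, b.rd x = 0 → κ = b.K + 1 → Best (b.sd b.K) x
  reach : ∀ x, b.rd x ≠ 0 → Relation.ReflTransGen (RowShare E) (b.sd (b.cmp x)) x
  le_Dm : ∀ x c, E x c → b.rd x ≠ 0 → b.cd c ≤ b.Dm (b.cmp x)
  Dm_eq : ∀ k, b.Dm k ≠ 0 → ∃ x c, E x c ∧ b.rd x ≠ 0 ∧ b.cmp x = k ∧ b.cd c = b.Dm k
  Dm_cur : ∀ h, b.head ≤ h → h < b.tail → b.Dm b.K ≤ b.rd (b.q h)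
  fresh : ∀ k, κ ≤ k → b.Dm k = 0
  rd_le : ∀ x, b.rd x ≤ b.tail

open Function in
/-- Starting a new component with the seed `x`. -/
def BFSState.start (b : BFSState) (x : ℕ) : BFSState :=
  { b with rd := update b.rd x 1, q := update b.q b.tail x, cmp := update b.cmp x b.K,
           sd := update b.sd b.K x, tail := b.tail + 1 }

open Function in
/-- Visiting the column `c` from the row at the head of the queue. -/
def BFSState.visit (b : BFSState) (c : ℕ) : BFSState :=
  { b with cd := update b.cd c (b.rd (b.q b.head)), Dm := update b.Dm b.K (b.rd (b.q b.head)) }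

open Function in
/-- Adding the row `z` to the queue. -/
def BFSState.push (b : BFSState) (z : ℕ) : BFSState :=
  { b with rd := update b.rd z (b.rd (b.q b.head) + 1), q := update b.q b.tail z,
           cmp := update b.cmp z b.K, tail := b.tail + 1 }

/-- Removing the head of the queue. -/
def BFSState.pop (b : BFSState) : BFSState := { b with head := b.head + 1 }

/-- Closing a component. -/
def BFSState.close (b : BFSState) : BFSState := { b with K := b.K + 1 }

namespace BFSInv

variable {E : ℕ → ℕ → Prop} {n : ℕ} {Best : ℕ → ℕ → Prop} {L : ℕ → Prop} {b : BFSState} {κ : ℕ}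
  {X : ℕ → ℕ → Prop}

/-- With an exhausted queue all visited rows are processed. So the columns of an unvisited row are
unvisited, and all rows sharing them are unvisited: the new component is disjoint from the old ones.
-/
theorem start (hb : BFSInv E n Best L b.K (fun _ _ => False) b) (hht : b.head = b.tail) {x : ℕ}
    (hx : x < n) (hx0 : b.rd x = 0) (hL : L x) (hbest : ∀ y < n, b.rd y = 0 → Best x y) :
    BFSInv E n Best L (b.K + 1) (fun _ _ => False) (b.start x) := by
  have hcd : ∀ c, E x c → b.cd c = 0 := fun c hc => by
    by_contra h; exact hb.row_visited x c hc h id hx0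
  have hcd2 : ∀ c, E x c → ∀ y, E y c → b.rd y = 0 := fun c hc y hy => by
    by_contra h
    obtain ⟨k, hk, rfl⟩ := hb.q_surj y h
    exact hb.processed k (hht ▸ hk) c hy (hcd c hc)
  have hqx : ∀ h < b.tail, b.q h ≠ x := fun h hh e => (hb.q_lt h hh).2 (e ▸ hx0)
  constructor <;> simp only [BFSState.start, Function.update_apply]
  · have := hb.q_lt; grind
  · intro w hw
    by_cases h1 : w = x
    · exact ⟨b.tail, by omega, by simp [h1]⟩
    · obtain ⟨h, h2, h3⟩ := hb.q_surj w (by simpa [h1] using hw)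
      exact ⟨h, by omega, by rw [if_neg (by omega), h3]⟩
  · have := hb.q_inj; grind
  · have := hb.head_le; grind
  · grind
  · grind
  · have := hb.processed; grind
  · have := hb.col_le; grind
  · have := hb.row_visited; grind
  · have := hb.row_le; grind
  · have := hb.col_eq; grind
  · have h1 := hb.row_eq; have := hb.cmp_lt; grind
  · have := hb.cmp_lt; grind
  · grind
  · have := hb.share; grind
  · have := hb.seed; grind
  · have h1 := hb.best; have := hb.cmp_lt; grind
  · grind
  · have h1 := hb.reach; have := hb.cmp_lt; grind
  · have h1 := hb.le_Dm; grind
  · have := hb.Dm_eq; grind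
  · have := hb.fresh b.K le_rfl; grind
  · have := hb.fresh; grind
  · have := hb.rd_le; grind

/-- Processed rows have only visited columns. So a visited row containing `c` is still in the queue,
and its distance is that of the head or one more. The incidences of `c` become pending until its
rows are scanned. -/
theorem visit (hb : BFSInv E n Best L (b.K + 1) (fun _ _ => False) b) (hht : b.head < b.tail)
    {c : ℕ} (hc : E (b.q b.head) c) (hc0 : b.cd c = 0) :
    BFSInv E n Best L (b.K + 1) (fun _ c' => c' = c) (b.visit c) := by
  have hy := hb.q_lt _ hht
  have hcx : ∀ x, E x c → b.rd x ≠ 0 → ∃ h, b.head ≤ h ∧ h < b.tail ∧ b.q h = x := by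
    intro x hx hx0
    obtain ⟨k, hk, rfl⟩ := hb.q_surj x hx0
    refine ⟨k, ?_, hk, rfl⟩
    by_contra h
    exact hb.processed k (by omega) c hx hc0
  have hcur := hb.cmp_cur
  have hm := hb.mono
  have hD := hb.Dm_cur b.head le_rfl hht
  constructor <;> simp only [BFSState.visit, Function.update_apply]
  · exact hb.q_lt
  · exact hb.q_surj
  · exact hb.q_inj
  · exact hb.head_le
  · exact hb.mono
  · exact hb.mono_head
  · have := hb.processed; grind
  · have := hb.col_le; grind
  · have := hb.row_visited; grind
  · have h1 := hb.row_le; have := hb.mono_head; grind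
  · have := hb.col_eq; grind
  · have := hb.row_eq; grind
  · exact hb.cmp_lt
  · exact hb.cmp_cur
  · exact hb.share
  · exact hb.seed
  · exact hb.best
  · exact fun x hx h _ => hb.best_cur x hx h rfl
  · exact hb.reach
  · have h1 := hb.le_Dm; grind
  · have h1 := hb.Dm_eq; have := hcur _ le_rfl hht; grind
  · grind
  · have := hb.fresh; grind
  · exact hb.rd_le

/-- The row `z` was unvisited, so `c` is its only visited column; this gives the distance
inequalities. A visited row sharing another column with `z` is still queued and therefore belongs to
the current component. -/
theorem push (hb : BFSInv E n Best L (b.K + 1) X b) (hht : b.head < b.tail)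
    {c z : ℕ} (hz : z < n) (hX : ∀ c', c' ≠ c → ¬ X z c')
    (hc : E (b.q b.head) c) (hc0 : b.cd c = b.rd (b.q b.head))
    (hzc : E z c) (hz0 : b.rd z = 0) :
    BFSInv E n Best L (b.K + 1) (fun x c' => X x c' ∧ x ≠ z) (b.push z) := by
  have hy := hb.q_lt _ hht
  have hqz : ∀ h < b.tail, b.q h ≠ z := fun h hh e => (hb.q_lt h hh).2 (e ▸ hz0)
  have hcz : ∀ c', E z c' → b.cd c' ≠ 0 → c' = c := fun c' h1 h2 => by
    by_contra h3
    exact hb.row_visited z c' h1 h2 (hX c' h3) hz0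
  have hcur := hb.cmp_cur
  have hyK := hcur _ le_rfl hht
  have hD := hb.Dm_cur b.head le_rfl hht
  have hh := hb.head_le
  have hqh := hqz _ hht
  constructor <;> simp only [BFSState.push, Function.update_apply]
  · have := hb.q_lt; grind
  · intro w hw
    by_cases h1 : w = z
    · exact ⟨b.tail, by omega, by simp [h1]⟩
    · obtain ⟨h, h2, h3⟩ := hb.q_surj w (by simpa [h1] using hw)
      exact ⟨h, by omega, by rw [if_neg (by omega), h3]⟩
  · have := hb.q_inj; grind
  · grind
  · have h1 := hb.mono; have := hb.mono_head; grind
  · have := hb.mono_head; grind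
  · have := hb.processed; grind
  · have h1 := hb.col_le; grind
  · have := hb.row_visited; grind
  · have := hb.row_le; grind
  · have := hb.col_eq; grind
  · have h1 := hb.row_eq; have h2 := hb.cmp_lt; have := hb.seed; grind
  · have := hb.cmp_lt; grind
  · grind
  · have h1 : ∀ x c', E z c' → E x c' → b.rd x ≠ 0 → b.cmp x = b.K := by
      intro x c' h1 h2 h3
      by_cases h4 : b.cd c' = 0
      · obtain ⟨k, hk, rfl⟩ := hb.q_surj x h3
        refine hcur k ?_ hk
        by_contra h
        exact hb.processed k (by omega) c' h2 h4
      · obtain rfl := hcz c' h1 h4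
        rw [hb.share x _ _ h2 hc h3 hy.2, hyK]
    have := hb.share; grind
  · have := hb.seed; grind
  · have h1 := hb.best; have := hb.best_cur; grind
  · have := hb.best_cur; grind
  · have h1 := hb.reach _ hy.2
    rw [hyK] at h1
    have h2 := h1.tail ⟨c, hc, hzc⟩
    have := hb.reach; grind
  · have h1 := hb.le_Dm; have h2 := h1 _ c hc hy.2; grind
  · have h1 := hb.Dm_eq; grind
  · have := hb.Dm_cur; grind
  · exact hb.fresh
  · have := hb.rd_le; grind

theorem init (hb : b = ⟨fun _ => 0, fun _ => 0, fun _ => 0, fun _ => 0, fun _ => 0, fun _ => 0,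
    0, 0, 0⟩) : BFSInv E n Best L b.K (fun _ _ => False) b := by
  subst hb
  constructor <;> simp

/-- Only `row_visited` mentions the pending incidences, so an incidence may be dropped as soon as
its row is visited. -/
theorem weaken (hb : BFSInv E n Best L κ X b) {X' : ℕ → ℕ → Prop}
    (h : ∀ x c, E x c → X x c → ¬ X' x c → b.rd x ≠ 0) : BFSInv E n Best L κ X' b where
  __ := hb
  row_visited x c h1 h2 h3 := by
    by_cases h4 : X x c
    · exact h x c h1 h4 h3
    · exact hb.row_visited x c h1 h2 h4

theorem pop (hb : BFSInv E n Best L κ X b) (hht : b.head < b.tail)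
    (h : ∀ c, E (b.q b.head) c → b.cd c ≠ 0) : BFSInv E n Best L κ X b.pop where
  __ := hb
  head_le := hht
  mono h h' h1 := hb.mono h h' (by simp only [BFSState.pop] at h1; omega)
  mono_head h h1 h2 := by
    simp only [BFSState.pop] at h1 h2 ⊢
    have h3 := hb.mono_head h (by omega) h2
    have := hb.mono b.head (b.head + 1) le_rfl (by omega) (by omega)
    omega
  processed k hk c hc := by
    simp only [BFSState.pop] at hk hc ⊢
    by_cases h1 : k = b.head
    · exact h c (h1 ▸ hc)
    · exact hb.processed k (by omega) c hc
  cmp_cur h h1 := hb.cmp_cur h (by simp only [BFSState.pop] at h1; omega)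
  Dm_cur h h1 := hb.Dm_cur h (by simp only [BFSState.pop] at h1; omega)

theorem close (hb : BFSInv E n Best L (b.K + 1) X b) (hht : b.head = b.tail) :
    BFSInv E n Best L b.close.K X b.close where
  __ := hb
  cmp_cur h h1 h2 := by simp only [BFSState.close] at h1 h2; omega
  Dm_cur h h1 h2 := by simp only [BFSState.close] at h1 h2; omega
  best_cur x _ _ h := by simp only [BFSState.close] at h; omega

theorem tail_le (hb : BFSInv E n Best L κ X b) : b.tail ≤ n := by
  have := Finset.card_le_card_of_injOn (s := Finset.range b.tail) (t := Finset.range n) b.q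
    (fun h hh => by simpa using (hb.q_lt h (by simpa using hh)).1)
    (fun h hh h' hh' e => hb.q_inj h (by simpa using hh) h' (by simpa using hh') e)
  simpa using this

theorem comps_le (hb : BFSInv E n Best L κ X b) : κ ≤ n := by
  have := Finset.card_le_card_of_injOn (s := Finset.range κ) (t := Finset.range n) b.sd
    (fun h hh => by simpa using (hb.seed h (by simpa using hh)).2.2.2)
    (fun h hh h' hh' e => by
      rw [← (hb.seed h (by simpa using hh)).2.1, ← (hb.seed h' (by simpa using hh')).2.1, e])
  simpa using this

theorem cd_le (hb : BFSInv E n Best L κ X b) (c : ℕ) : b.cd c ≤ n := by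
  by_cases h : b.cd c = 0
  · omega
  · obtain ⟨x, -, -, h1⟩ := hb.col_eq c h
    have := hb.rd_le x
    have := hb.tail_le
    omega

end BFSInv

/-! ### Breadth first search: the program -/

namespace RAMProgram

/-- The entry in row `i` and column `j` of the input matrix. -/
def entry (i j : RAMExpr) : RAMExpr := .read 0 (.add (.mul i (.reg 1)) j)

/-- `s` contains the input: an `n × m` matrix for the relation `E`. -/
structure HasInput (n m : ℕ) (E : ℕ → ℕ → Prop) (s : RAMState) : Prop where
  rows : s.reg 0 = n
  cols : s.reg 1 = m
  one : ∀ i < n, ∀ j < m, E i j → s.mem 0 (i * m + j) = 1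
  zero : ∀ i < n, ∀ j < m, ¬ E i j → s.mem 0 (i * m + j) = 0

theorem HasInput.congr {n m : ℕ} {E : ℕ → ℕ → Prop} {s s' : RAMState} (h : HasInput n m E s)
    (h0 : s'.reg 0 = s.reg 0) (h1 : s'.reg 1 = s.reg 1) (h2 : s'.mem 0 = s.mem 0) :
    HasInput n m E s' :=
  ⟨h0 ▸ h.rows, h1 ▸ h.cols, h2 ▸ h.one, h2 ▸ h.zero⟩

open Classical in
theorem HasInput.eval_entry {n m : ℕ} {E : ℕ → ℕ → Prop} {s : RAMState} (h : HasInput n m E s)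
    {i j : RAMExpr} {x c : ℕ} (hi : i.eval s = x) (hj : j.eval s = c) (hx : x < n) (hc : c < m) :
    (entry i j).eval s = if E x c then 1 else 0 := by
  simp only [entry, RAMExpr.eval, h.cols, hi, hj]
  split_ifs with hE
  · exact h.one _ hx _ hc hE
  · exact h.zero _ hx _ hc hE

/-- Put the unvisited rows of the column in register `11` into the queue. -/
def bfsRows (β : ℕ) : RAMProgram :=
  forTo 12 (.reg 0) (.ite (.mul (entry (.reg 12) (.reg 11)) (.eq (.read β (.reg 12)) (.const 0)))
    (.seq (.store β (.reg 12) (.add (.read β (.reg 10)) (.const 1)))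
      (.seq (.store (β + 2) (.reg 5) (.reg 12))
        (.seq (.store (β + 3) (.reg 12) (.reg 7)) (.assign 5 (.add (.reg 5) (.const 1))))))
    .skip)

/-- Visit the unvisited columns of the row in register `10`. -/
def bfsCols (β : ℕ) : RAMProgram :=
  forTo 11 (.reg 1) (.ite (.mul (entry (.reg 10) (.reg 11))
      (.eq (.read (β + 1) (.reg 11)) (.const 0)))
    (.seq (.store (β + 1) (.reg 11) (.read β (.reg 10)))
      (.seq (.store (β + 5) (.reg 7) (.read β (.reg 10))) (bfsRows β)))
    .skip)

/-- Process the queue. -/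
def bfsQueue (β : ℕ) : RAMProgram :=
  .while (.lt (.reg 6) (.reg 5)) (.seq (.assign 10 (.read (β + 2) (.reg 6)))
    (.seq (bfsCols β) (.assign 6 (.add (.reg 6) (.const 1)))))

/-- Start a new component with the row in register `9`. -/
def bfsStart (β : ℕ) : RAMProgram :=
  .seq (.store β (.reg 9) (.const 1)) (.seq (.store (β + 2) (.reg 5) (.reg 9))
    (.seq (.store (β + 3) (.reg 9) (.reg 7)) (.seq (.store (β + 4) (.reg 7) (.reg 9))
      (.assign 5 (.add (.reg 5) (.const 1))))))

/-- Breadth first search from the rows in the array `l`, whose length is in register `13`. -/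
def bfs (β l : ℕ) : RAMProgram :=
  .seq (.assign 5 (.const 0)) (.seq (.assign 6 (.const 0)) (.seq (.assign 7 (.const 0))
    (forTo 8 (.reg 13) (.seq (.assign 9 (.read l (.reg 8)))
      (.ite (.eq (.read β (.reg 9)) (.const 0))
        (.seq (bfsStart β) (.seq (bfsQueue β) (.assign 7 (.add (.reg 7) (.const 1)))))
        .skip)))))

/-- The state `s` represents `b` in the arrays from `β` on. -/
structure BFSRep (β : ℕ) (s : RAMState) (b : BFSState) : Prop where
  rd : s.mem β = b.rd
  cd : s.mem (β + 1) = b.cd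
  q : s.mem (β + 2) = b.q
  cmp : s.mem (β + 3) = b.cmp
  sd : s.mem (β + 4) = b.sd
  Dm : s.mem (β + 5) = b.Dm
  tail : s.reg 5 = b.tail
  head : s.reg 6 = b.head
  K : s.reg 7 = b.K

variable {W n m β : ℕ} {E : ℕ → ℕ → Prop} {s : RAMState} {b : BFSState} {Best : ℕ → ℕ → Prop}
  {L : ℕ → Prop} {Q : ℕ → RAMState → Prop}

/-- After `k` rounds the pending incidences are those of the column with the rows from `k` on. The
head and its distance are unaffected, because rows are appended at the tail. -/
theorem Ends.bfsRows (hW : n + 1 < W) (hβ : 0 < β) (hin : HasInput n m E s)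
    (hrep : BFSRep β s b) (hinv : BFSInv E n Best L (b.K + 1) (fun _ c => c = s.reg 11) b)
    (hE : ∀ i j, E i j → i < n ∧ j < m)
    (hht : b.head < b.tail) (hy : s.reg 10 = b.q b.head) (hc : E (b.q b.head) (s.reg 11))
    (hcd : b.cd (s.reg 11) = b.rd (b.q b.head))
    (hQ : ∀ t s' b', BFSRep β s' b' → BFSInv E n Best L (b'.K + 1) (fun _ _ => False) b' →
      b'.K = b.K → b'.cd = b.cd → b'.head = b.head → b'.q b.head = b.q b.head →
      b'.head < b'.tail → (∀ x, b.rd x ≠ 0 → b'.rd x ≠ 0) → t ≤ 36 * n + 6 → Q t s') :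
    (bfsRows β).Ends W s Q := by
  refine Ends.forTo_bdd n 28 (fun k s' => ∃ b', BFSRep β s' b' ∧
    BFSInv E n Best L (b'.K + 1) (fun z c => c = s.reg 11 ∧ k ≤ z) b' ∧ b'.K = b.K ∧
    b'.cd = b.cd ∧ b'.head = b.head ∧ b'.q b.head = b.q b.head ∧ b'.head < b'.tail ∧
    b'.rd (b.q b.head) = b.rd (b.q b.head) ∧ (∀ x, b.rd x ≠ 0 → b'.rd x ≠ 0)) (by omega) ?_ ?_ ?_ ?_
  · intro s' hF
    simp only [RAMExpr.eval]
    rw [hF.1 0 (by simp [RAMProgram.forTo, regs]), hin.rows]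
  · refine ⟨b, ⟨?_, ?_, ?_, ?_, ?_, ?_, ?_, ?_, ?_⟩, hinv.weaken ?_, rfl, rfl, rfl, rfl, hht, rfl,
      fun x hx => hx⟩
    all_goals simp [hrep.rd, hrep.cd, hrep.q, hrep.cmp, hrep.sd, hrep.Dm, hrep.tail,
      hrep.head, hrep.K]
    intro x c _ h1 h2
    omega
  · rintro k s' hF hk ⟨b', hrep', hinv', hK, hcd', hhead, hq, hht', hrd, hvis⟩ hkn
    have hin' : HasInput n m E s' := hin.congr (hF.1 0 (by simp [RAMProgram.forTo, regs]))
      (hF.1 1 (by simp [RAMProgram.forTo, regs])) (hF.2 0 (by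
        simp [RAMProgram.forTo, arrays]; omega))
    have h10 : s'.reg 10 = b.q b.head := by rw [hF.1 10 (by simp [RAMProgram.forTo, regs]), hy]
    have h11 : s'.reg 11 = s.reg 11 := hF.1 11 (by simp [RAMProgram.forTo, regs])
    have hent := hin'.eval_entry (i := .reg 12) (j := .reg 11) hk h11 hkn (hE _ _ hc).2
    have htl := hinv'.tail_le
    have hrdle := hinv'.rd_le (b.q b.head)
    have hKn := hinv'.comps_le
    refine Ends.ite (fun h => ?_) (fun h => ?_)
    · simp only [RAMExpr.eval, hent, hrep'.rd, hk] at h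
      have hkc : E k (s.reg 11) := by by_contra h1; simp [h1] at h
      have hk0 : b'.rd k = 0 := by by_contra h1; simp [h1] at h
      have hpush := hinv'.push hht' (z := k) (c := s.reg 11) hkn (fun c' h1 h2 => h1 h2.1)
        (hhead ▸ hq ▸ hc) (by rw [hhead, hq, hcd', hcd, hrd]) hkc hk0
      have hne : b'.tail ≠ b'.head := by omega
      have hne2 : b.q b.head ≠ k := fun h1 => by
        have := (hinv.q_lt _ hht).2
        rw [← hrd, h1] at this
        exact this hk0
      have eq1 : RAMExpr.eval s' (.add (.read β (.reg 10)) (.const 1)) =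
          b'.rd (b'.q b'.head) + 1 := by simp [RAMExpr.eval, h10, hrep'.rd, hhead, hq]
      refine Ends.seq (Ends.store (by simp [RAMExpr.eval, hk]; omega) ?_ ?_)
      · rw [eq1, hhead, hq]
        omega
      rw [eq1]
      refine Ends.seq (Ends.store (by simp [RAMExpr.eval, hrep'.tail]; omega)
        (by simp [RAMExpr.eval, hk]; omega) ?_)
      refine Ends.seq (Ends.store (by simp [RAMExpr.eval, hk]; omega)
        (by simp [RAMExpr.eval, hrep'.K]; omega) ?_)
      refine Ends.assign (by simp [RAMExpr.eval, hrep'.tail]; omega) ?_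
      refine ⟨by simp [hk], by simp [RAMExpr.cost, entry], fun _ => ?_⟩
      refine ⟨b'.push k, ⟨?_, ?_, ?_, ?_, ?_, ?_, ?_, ?_, ?_⟩, hpush.weaken ?_, hK, hcd', hhead,
        ?_, ?_, ?_, ?_⟩
      all_goals simp [RAMExpr.eval, BFSState.push, hrep'.rd, hrep'.cd, hrep'.q, hrep'.cmp,
        hrep'.sd, hrep'.Dm, hrep'.tail, hrep'.head, hrep'.K, hk]
      · rintro x c _ h1 h2
        omega
      · rw [Function.update_of_ne (by omega), hq]
      · omega
      · rw [Function.update_of_ne hne2, hrd]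
      · intro x hx
        rw [Function.update_apply]
        split_ifs
        · simp
        · exact hvis x hx
    · refine Ends.skip ⟨hk, by simp [RAMExpr.cost, entry], fun _ => ?_⟩
      have hw : BFSInv E n Best L (b'.K + 1) (fun z c => c = s.reg 11 ∧ k + 1 ≤ z) b' := by
        refine hinv'.weaken ?_
        rintro x c hxc ⟨h1, h2⟩ h3
        have : x = k := by omega
        subst this
        subst h1
        simp only [RAMExpr.eval, hent, hrep'.rd, hk, if_pos hxc] at h
        intro h4
        simp [h4] at h
      refine ⟨b', ⟨?_, ?_, ?_, ?_, ?_, ?_, ?_, ?_, ?_⟩, hw, hK, hcd', hhead, hq, hht', hrd, hvis⟩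
      all_goals simp [hrep'.rd, hrep'.cd, hrep'.q, hrep'.cmp, hrep'.sd, hrep'.Dm,
        hrep'.tail, hrep'.head, hrep'.K]
  · rintro τ s' hF ⟨b', hrep', hinv', hK, hcd', hhead, hq, hht', hrd, hvis⟩ hτ
    refine hQ τ s' b' hrep' (hinv'.weaken ?_) hK hcd' hhead hq hht' hvis ?_
    · rintro x c hxc ⟨h1, h2⟩ h3
      have := (hE _ _ hxc).1
      omega
    · simp only [RAMExpr.cost] at hτ
      omega

end RAMProgram

/-- Number of visited columns. -/
def BFSState.visited (m : ℕ) (b : BFSState) : ℕ :=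
  ((Finset.range m).filter fun c => b.cd c ≠ 0).card

theorem BFSState.visited_le (m : ℕ) (b : BFSState) : b.visited m ≤ m :=
  (Finset.card_filter_le _ _).trans (by simp)

theorem BFSState.visited_congr {m : ℕ} {b b' : BFSState} (h : b'.cd = b.cd) :
    b'.visited m = b.visited m := by
  simp [BFSState.visited, h]

theorem BFSState.visited_visit {m c : ℕ} {b : BFSState} (hc : c < m) (h0 : b.cd c = 0)
    (hy : b.rd (b.q b.head) ≠ 0) : (b.visit c).visited m = b.visited m + 1 := by
  have h1 : ((Finset.range m).filter fun i => (b.visit c).cd i ≠ 0) =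
      insert c ((Finset.range m).filter fun i => b.cd i ≠ 0) := by
    ext i
    simp only [Finset.mem_filter, Finset.mem_range, Finset.mem_insert, BFSState.visit,
      Function.update_apply]
    split_ifs with h
    · subst h
      simp [hc, hy]
    · simp [h]
  rw [BFSState.visited, h1, Finset.card_insert_of_notMem (by simp [h0])]
  rfl

namespace RAMProgram

variable {W n m β : ℕ} {E : ℕ → ℕ → Prop} {s : RAMState} {b : BFSState} {Best : ℕ → ℕ → Prop}
  {L : ℕ → Prop} {Q : ℕ → RAMState → Prop}

/-- Amortized analysis: scanning the rows of a newly visited column costs time linear in `n` and is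
charged to the growth of `visited`, while the remaining work is constant per column. -/
theorem Ends.bfsCols (hW : n + 1 < W) (hmW : m < W) (hβ : 0 < β) (hin : HasInput n m E s)
    (hrep : BFSRep β s b) (hinv : BFSInv E n Best L (b.K + 1) (fun _ _ => False) b)
    (hE : ∀ i j, E i j → i < n ∧ j < m)
    (hht : b.head < b.tail) (hy : s.reg 10 = b.q b.head)
    (hQ : ∀ t s' b', BFSRep β s' b' → BFSInv E n Best L (b'.K + 1) (fun _ _ => False) b' →
      b'.K = b.K → b'.head = b.head → b'.head < b'.tail →
      (∀ c, E (b'.q b'.head) c → b'.cd c ≠ 0) → (∀ x, b.rd x ≠ 0 → b'.rd x ≠ 0) →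
      t + 50 * (n + 1) * b.visited m ≤ 6 + 21 * m + 50 * (n + 1) * b'.visited m → Q t s') :
    (bfsCols β).Ends W s Q := by
  refine Ends.forTo m (fun k τ s' => ∃ b', BFSRep β s' b' ∧
    BFSInv E n Best L (b'.K + 1) (fun _ _ => False) b' ∧ b'.K = b.K ∧ b'.head = b.head ∧
    b'.head < b'.tail ∧ b'.q b.head = b.q b.head ∧ (∀ c < k, E (b.q b.head) c → b'.cd c ≠ 0) ∧
    (∀ x, b.rd x ≠ 0 → b'.rd x ≠ 0) ∧
    τ + 50 * (n + 1) * b.visited m ≤ 2 + 21 * k + 50 * (n + 1) * b'.visited m) hmW ?_ ?_ ?_ ?_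
  · intro s' hF
    simp only [RAMExpr.eval]
    rw [hF.1 1 (by simp [RAMProgram.forTo, regs, RAMProgram.bfsRows]), hin.cols]
  · refine ⟨b, ⟨?_, ?_, ?_, ?_, ?_, ?_, ?_, ?_, ?_⟩, hinv, rfl, rfl, hht, rfl, ?_,
      fun x hx => hx, ?_⟩
    all_goals simp [hrep.rd, hrep.cd, hrep.q, hrep.cmp, hrep.sd, hrep.Dm, hrep.tail,
      hrep.head, hrep.K]
  · rintro k τ s' hF hk ⟨b', hrep', hinv', hK, hhead, hht', hq, hvis, hrdv, hτ⟩ hkm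
    have hin' : HasInput n m E s' :=
      hin.congr (hF.1 0 (by simp [RAMProgram.forTo, regs, RAMProgram.bfsRows]))
      (hF.1 1 (by simp [RAMProgram.forTo, regs, RAMProgram.bfsRows])) (hF.2 0 (by
        simp [RAMProgram.forTo, arrays, RAMProgram.bfsRows]; omega))
    have h10 : s'.reg 10 = b.q b.head := by
      rw [hF.1 10 (by simp [RAMProgram.forTo, regs, RAMProgram.bfsRows]), hy]
    have hyn := hinv'.q_lt _ hht'
    have hent := hin'.eval_entry (i := .reg 10) (j := .reg 11) h10 hk
      (by rw [← hq, ← hhead]; exact hyn.1) hkm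
    rw [← hq, ← hhead] at hent h10
    have hrdle := hinv'.rd_le (b'.q b'.head)
    have htl := hinv'.tail_le
    have hKn := hinv'.comps_le
    refine Ends.ite (fun h => ?_) (fun h => ?_)
    · simp only [RAMExpr.eval, hent, hrep'.cd, hk] at h
      have hkc : E (b'.q b'.head) k := by by_contra h1; simp [h1] at h
      have hk0 : b'.cd k = 0 := by by_contra h1; simp [h1] at h
      have eq1 : RAMExpr.eval s' (.read β (.reg 10)) = b'.rd (b'.q b'.head) := by
        simp [RAMExpr.eval, h10, hrep'.rd]
      refine Ends.seq (Ends.store (by simp [RAMExpr.eval, hk]; omega) (by omega) ?_)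
      rw [eq1]
      have eq2 : ∀ a v, a ≠ β → RAMExpr.eval (s'.setMem a k v) (.read β (.reg 10)) =
          b'.rd (b'.q b'.head) := by
        intro a v ha
        simp [RAMExpr.eval, h10, hrep'.rd, ha.symm]
      refine Ends.seq (Ends.store (by simp [RAMExpr.eval, hrep'.K]; omega) ?_ ?_)
      · simp only [RAMExpr.eval, hk] at eq2 ⊢
        rw [eq2 _ _ (by omega)]
        omega
      have hvisit := hinv'.visit hht' hkc hk0
      set s₂ := (s'.setMem (β + 1) (RAMExpr.eval s' (.reg 11)) (b'.rd (b'.q b'.head))).setMem (β + 5)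
        (RAMExpr.eval (s'.setMem (β + 1) (RAMExpr.eval s' (.reg 11)) (b'.rd (b'.q b'.head))) (.reg 7))
        (RAMExpr.eval (s'.setMem (β + 1) (RAMExpr.eval s' (.reg 11)) (b'.rd (b'.q b'.head)))
          (.read β (.reg 10))) with hs₂
      have hreg : s₂.reg = s'.reg := rfl
      have hrep₂ : BFSRep β s₂ (b'.visit k) := by
        rw [hs₂]
        constructor <;> simp [hrep'.rd, hrep'.cd, hrep'.q, hrep'.cmp, hrep'.sd, hrep'.Dm,
          hrep'.tail, hrep'.head, hrep'.K, BFSState.visit, RAMExpr.eval, hk, h10]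
      have hin₂ : HasInput n m E s₂ := hin'.congr rfl rfl (by simp [hs₂])
      have h11 : s₂.reg 11 = k := by rw [hreg, hk]
      refine (Ends.bfsRows (b := b'.visit k) (Best := Best) (L := L) hW hβ hin₂ hrep₂
        (by rw [h11]; exact hvisit) hE hht' (by rw [hreg, h10]; rfl)
        (by rw [h11]; exact hkc) (by rw [h11]; simp [BFSState.visit])
        (Q := fun t s'' => ∃ b'', BFSRep β s'' b'' ∧
          BFSInv E n Best L (b''.K + 1) (fun _ _ => False) b'' ∧ b''.K = b'.K ∧
          b''.cd = (b'.visit k).cd ∧ b''.head = b'.head ∧ b''.q b'.head = b'.q b'.head ∧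
          b''.head < b''.tail ∧ (∀ x, b'.rd x ≠ 0 → b''.rd x ≠ 0) ∧ t ≤ 36 * n + 6)
        (fun t s'' b'' h1 h2 h3 h4 h5 h6 h7 h8 h9 => ⟨b'', h1, h2, h3, h4, h5, h6, h7, h8, h9⟩)).frame ?_
      rintro t s'' hr - ⟨b'', hrep'', hinv'', hK'', hcd'', hhead'', hq'', hht'', hrd'', ht⟩
      have h11' : s''.reg 11 = k := by
        rw [hr 11 (by simp [RAMProgram.bfsRows, RAMProgram.forTo, regs]), h11]
      have hvc : b''.visited m = b'.visited m + 1 := by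
        rw [BFSState.visited_congr hcd'', BFSState.visited_visit hkm hk0 hyn.2]
      refine ⟨h11', fun _ => ⟨b'', ⟨?_, ?_, ?_, ?_, ?_, ?_, ?_, ?_, ?_⟩, hinv'', by omega, by omega,
        hht'', by rw [← hhead, hq'', hhead, hq], ?_, fun x hx => hrd'' x (hrdv x hx), ?_⟩⟩
      any_goals simp [hrep''.rd, hrep''.cd, hrep''.q, hrep''.cmp, hrep''.sd, hrep''.Dm, hrep''.tail,
        hrep''.head, hrep''.K]
      · intro c hc hEc
        rw [hcd'']
        simp only [BFSState.visit, Function.update_apply]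
        split_ifs with h1
        · exact hyn.2
        · exact hvis c (by omega) hEc
      · rw [hvc]
        simp only [RAMExpr.cost, RAMProgram.entry]
        rw [mul_add (50 * (n + 1)) (b'.visited m) 1]
        omega
    · refine Ends.skip ⟨hk, fun _ => ⟨b', ⟨?_, ?_, ?_, ?_, ?_, ?_, ?_, ?_, ?_⟩, hinv', hK, hhead,
        hht', hq, ?_, hrdv, ?_⟩⟩
      any_goals simp [hrep'.rd, hrep'.cd, hrep'.q, hrep'.cmp, hrep'.sd, hrep'.Dm, hrep'.tail,
        hrep'.head, hrep'.K]
      · intro c hc hEc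
        by_cases hck : c = k
        · subst hck
          rw [← hq, ← hhead] at hEc
          simp only [RAMExpr.eval, hent, hrep'.cd, hk, if_pos hEc] at h
          intro h4
          simp [h4] at h
        · exact hvis c (by omega) hEc
      · simp only [RAMExpr.cost, RAMProgram.entry]
        omega
  · rintro τ s' hF ⟨b', hrep', hinv', hK, hhead, hht', hq, hvis, hrdv, hτ⟩
    refine hQ _ s' b' hrep' hinv' hK hhead hht' (fun c hc => ?_) hrdv ?_
    · rw [hhead, hq] at hc
      exact hvis c (hE _ _ hc).2 hc
    · simp only [RAMExpr.cost]
      omega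

end RAMProgram

namespace RAMProgram

variable {W n m β : ℕ} {E : ℕ → ℕ → Prop} {s : RAMState} {b : BFSState} {Best : ℕ → ℕ → Prop}
  {L : ℕ → Prop} {Q : ℕ → RAMState → Prop}

theorem regs_bfsCols (β : ℕ) : (bfsCols β).regs = [11, 12, 5, 12, 11] := rfl

theorem arrays_bfsCols (β : ℕ) : (bfsCols β).arrays = [β + 1, β + 5, β, β + 2, β + 3] := rfl

theorem regs_bfsQueue (β : ℕ) : (bfsQueue β).regs = [10, 11, 12, 5, 12, 11, 6] := rfl

theorem arrays_bfsQueue (β : ℕ) : (bfsQueue β).arrays = [β + 1, β + 5, β, β + 2, β + 3] := rfl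

/-- Time is charged to two quantities that never decrease, the number of visited columns and the
head of the queue. They are bounded by `m` and `n` over all components together, which keeps the
whole search at order `n * m`. -/
theorem Ends.bfsQueue (hW : n + 1 < W) (hmW : m < W) (hβ : 0 < β) (hin : HasInput n m E s)
    (hrep : BFSRep β s b) (hinv : BFSInv E n Best L (b.K + 1) (fun _ _ => False) b)
    (hE : ∀ i j, E i j → i < n ∧ j < m)
    (hQ : ∀ t s' b', BFSRep β s' b' → BFSInv E n Best L (b'.K + 1) (fun _ _ => False) b' →
      b'.K = b.K → b'.head = b'.tail → (∀ x, b.rd x ≠ 0 → b'.rd x ≠ 0) →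
      t + 50 * (n + 1) * b.visited m + 40 * (m + 1) * b.head ≤
        4 + 50 * (n + 1) * b'.visited m + 40 * (m + 1) * b'.head → Q t s') :
    (bfsQueue β).Ends W s Q := by
  refine Ends.while (fun τ s' => HasInput n m E s' ∧ ∃ b', BFSRep β s' b' ∧
    BFSInv E n Best L (b'.K + 1) (fun _ _ => False) b' ∧ b'.K = b.K ∧
    (∀ x, b.rd x ≠ 0 → b'.rd x ≠ 0) ∧
    τ + 50 * (n + 1) * b.visited m + 40 * (m + 1) * b.head ≤
        50 * (n + 1) * b'.visited m + 40 * (m + 1) * b'.head)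
    (fun s' => n - s'.reg 6) ⟨hin, b, hrep, hinv, rfl, fun x hx => hx, by omega⟩ ?_ ?_
  · rintro τ s' ⟨hin', b', hrep', hinv', hK, hrd, hτ⟩ h
    have hht : b'.head < b'.tail := by
      by_contra h1
      simp [RAMExpr.eval, hrep'.head, hrep'.tail, h1] at h
    have htl := hinv'.tail_le
    have hyn := hinv'.q_lt _ hht
    have heval : RAMExpr.eval s' (.read (β + 2) (.reg 6)) = b'.q b'.head := by
      simp [RAMExpr.eval, hrep'.q, hrep'.head]
    refine Ends.seq (Ends.assign (by omega) ?_)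
    rw [heval]
    refine Ends.seq ((Ends.bfsCols hW hmW hβ (hin'.congr (by simp) (by simp) rfl)
      (s := s'.setReg 10 (b'.q b'.head)) (b := b')
      ⟨hrep'.rd, hrep'.cd, hrep'.q, hrep'.cmp, hrep'.sd, hrep'.Dm, by simp [hrep'.tail],
        by simp [hrep'.head], by simp [hrep'.K]⟩ hinv' hE hht (by simp)
      (Q := fun t s'' => ∃ b'', BFSRep β s'' b'' ∧
        BFSInv E n Best L (b''.K + 1) (fun _ _ => False) b'' ∧ b''.K = b'.K ∧ b''.head = b'.head ∧
        b''.head < b''.tail ∧ (∀ c, E (b''.q b''.head) c → b''.cd c ≠ 0) ∧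
        (∀ x, b'.rd x ≠ 0 → b''.rd x ≠ 0) ∧
        t + 50 * (n + 1) * b'.visited m ≤ 6 + 21 * m + 50 * (n + 1) * b''.visited m)
      fun t s'' b'' h1 h2 h3 h4 h5 h6 h7 h8 => ⟨b'', h1, h2, h3, h4, h5, h6, h7, h8⟩).frame ?_)
    rintro t s'' hr ha ⟨b'', hrep'', hinv'', hK'', hhead'', hht'', hc'', hrd'', ht⟩
    have htl'' := hinv''.tail_le
    refine Ends.assign (by simp [RAMExpr.eval, hrep''.head]; omega) ⟨?_, hin'.congr ?_ ?_ ?_,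
      b''.pop, ⟨?_, ?_, ?_, ?_, ?_, ?_, ?_, ?_, ?_⟩, hinv''.pop hht'' hc'', ?_, ?_, ?_⟩
    · simp [RAMExpr.eval, hrep''.head, hrep'.head]
      omega
    · simp [hr 0 (by simp [regs_bfsCols])]
    · simp [hr 1 (by simp [regs_bfsCols])]
    · rw [RAMState.setReg_mem, ha 0 (by simp [arrays_bfsCols]; omega)]
      rfl
    any_goals simp [hrep''.rd, hrep''.cd, hrep''.q, hrep''.cmp, hrep''.sd, hrep''.Dm,
      hrep''.tail, hrep''.head, hrep''.K, BFSState.pop, RAMExpr.eval]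
    · rw [hK'', hK]
    · exact fun x hx => hrd'' x (hrd x hx)
    · have hv : ∀ h, BFSState.visited m { b'' with head := h } = b''.visited m :=
        fun h => BFSState.visited_congr rfl
      simp only [RAMExpr.cost, hv, hhead'']
      rw [mul_add (40 * (m + 1)) b'.head 1]
      omega
  · rintro τ s' ⟨hin', b', hrep', hinv', hK, hrd, hτ⟩ h
    have hht : ¬ b'.head < b'.tail := by
      intro h1
      simp [RAMExpr.eval, hrep'.head, hrep'.tail, h1] at h
    have := hinv'.head_le
    refine hQ _ s' b' hrep' hinv' hK (by omega) hrd ?_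
    simp only [RAMExpr.cost]
    omega

/-- The state before a breadth first search. -/
def bfsZero : BFSState := ⟨fun _ => 0, fun _ => 0, fun _ => 0, fun _ => 0, fun _ => 0, fun _ => 0,
    0, 0, 0⟩

/-- Rows listed before a new seed are already visited. Thus every unvisited row is absent from the
earlier part of the list, and `hbest` makes the seed best in its component. -/
theorem Ends.bfs {l len : ℕ} (hW : n + 1 < W) (hmW : m < W) (hβ : 0 < β) (hin : HasInput n m E s)
    (hE : ∀ i j, E i j → i < n ∧ j < m) (hzero : ∀ a < 6, s.mem (β + a) = fun _ => 0)
    (hl : ∀ a < 6, l ≠ β + a) (hlen : s.reg 13 = len) (hlenW : len < W)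
    (hln : ∀ p < len, s.mem l p < n)
    (hbest : ∀ p < len, ∀ y < n, (∀ p' < p, s.mem l p' ≠ y) → Best (s.mem l p) y)
    (hQ : ∀ t s' b', BFSRep β s' b' →
      BFSInv E n Best (fun x => ∃ p < len, s.mem l p = x) b'.K (fun _ _ => False) b' →
      b'.head = b'.tail → (∀ p < len, b'.rd (s.mem l p) ≠ 0) →
      t ≤ 20 + 60 * len + 50 * (n + 1) * m + 40 * (m + 1) * n → Q t s') :
    (bfs β l).Ends W s Q := by
  refine Ends.seq (Ends.assign (by simp [RAMExpr.eval]; omega) ?_)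
  refine Ends.seq (Ends.assign (by simp [RAMExpr.eval]; omega) ?_)
  refine Ends.seq (Ends.assign (by simp [RAMExpr.eval]; omega) ?_)
  simp only [RAMExpr.eval]
  set s₁ := ((s.setReg 5 0).setReg 6 0).setReg 7 0 with hs₁
  have hl1 : s₁.mem = s.mem := rfl
  refine Ends.forTo len (fun k τ s' => ∃ b', BFSRep β s' b' ∧
    BFSInv E n Best (fun x => ∃ p < len, s.mem l p = x) b'.K (fun _ _ => False) b' ∧
    b'.head = b'.tail ∧ (∀ p < k, b'.rd (s.mem l p) ≠ 0) ∧
    τ ≤ 2 + 60 * k + 50 * (n + 1) * b'.visited m + 40 * (m + 1) * b'.head) hlenW ?_ ?_ ?_ ?_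
  · intro s' hF
    simp only [RAMExpr.eval]
    rw [hF.1 13 (by simp [RAMProgram.forTo, regs, regs_bfsQueue, RAMProgram.bfsStart])]
    simp [hs₁, hlen]
  · refine ⟨bfsZero, ⟨?_, ?_, ?_, ?_, ?_, ?_, ?_, ?_, ?_⟩, BFSInv.init rfl, rfl, by simp,
      by omega⟩
    · simpa [hs₁, bfsZero] using hzero 0 (by simp)
    · simpa [hs₁, bfsZero] using hzero 1 (by simp)
    · simpa [hs₁, bfsZero] using hzero 2 (by simp)
    · simpa [hs₁, bfsZero] using hzero 3 (by simp)
    · simpa [hs₁, bfsZero] using hzero 4 (by simp)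
    · simpa [hs₁, bfsZero] using hzero 5 (by simp)
    all_goals simp [hs₁, bfsZero]
  · rintro k τ s' hF hk ⟨b', hrep', hinv', hht, hvis, hτ⟩ hkl
    have hin' : HasInput n m E s' := by
      refine hin.congr ?_ ?_ ?_
      · rw [hF.1 0 (by simp [RAMProgram.forTo, regs, regs_bfsQueue, RAMProgram.bfsStart])]
        simp [hs₁]
      · rw [hF.1 1 (by simp [RAMProgram.forTo, regs, regs_bfsQueue, RAMProgram.bfsStart])]
        simp [hs₁]
      · rw [hF.2 0 (by
          simp [RAMProgram.forTo, arrays, arrays_bfsQueue, RAMProgram.bfsStart]; omega), hl1]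
    have hmem : s'.mem l = s.mem l := by
      have h0 := hl 0; have h1 := hl 1; have h2 := hl 2; have h3 := hl 3; have h4 := hl 4
      have h5 := hl 5
      rw [hF.2 l (by
        simp [RAMProgram.forTo, arrays, arrays_bfsQueue, RAMProgram.bfsStart]; omega), hl1]
    have hx := hln k hkl
    have heval : RAMExpr.eval s' (.read l (.reg 8)) = s.mem l k := by
      simp [RAMExpr.eval, hmem, hk]
    refine Ends.seq (Ends.assign (by omega) ?_)
    rw [heval]
    have heval2 : RAMExpr.eval (s'.setReg 9 (s.mem l k)) (.eq (.read β (.reg 9)) (.const 0)) =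
        if b'.rd (s.mem l k) = 0 then 1 else 0 := by
      simp [RAMExpr.eval, hrep'.rd]
    refine Ends.ite (fun h => ?_) (fun h => ?_)
    · have hx0 : b'.rd (s.mem l k) = 0 := by by_contra h1; simp [heval2, h1] at h
      have hstart := hinv'.start hht hx hx0 ⟨k, hkl, rfl⟩ fun y hy hy0 => hbest k hkl y hy
        fun p' hp' h1 => hvis p' hp' (h1 ▸ hy0)
      have htl := hstart.tail_le
      have hKn := hstart.comps_le
      simp only [BFSState.start] at htl
      refine Ends.seq (Ends.seq (Ends.store ?_ ?_ (Ends.seq (Ends.store ?_ ?_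
        (Ends.seq (Ends.store ?_ ?_ (Ends.seq (Ends.store ?_ ?_ (Ends.assign ?_ ?_)))))))))
      any_goals simp [RAMExpr.eval, hrep'.tail, hrep'.K]; omega
      set s₂ := (((((s'.setReg 9 (s.mem l k)).setMem β (RAMExpr.eval (s'.setReg 9 (s.mem l k))
        (.reg 9)) _).setMem _ _ _).setMem _ _ _).setMem _ _ _).setReg _ _ with hs₂
      have hrep₂ : BFSRep β s₂ (b'.start (s.mem l k)) := by
        constructor <;> simp [hs₂, hrep'.rd, hrep'.cd, hrep'.q, hrep'.cmp, hrep'.sd, hrep'.Dm,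
          hrep'.tail, hrep'.head, hrep'.K, BFSState.start, RAMExpr.eval]
      have h8 : s₂.reg 8 = k := by simp [hs₂, hk]
      refine Ends.seq ((Ends.bfsQueue hW hmW hβ (hin'.congr (by simp [hs₂]) (by simp [hs₂])
        (by simp [hs₂]; omega)) hrep₂ hstart hE (Q := fun t s'' => ∃ b'', BFSRep β s'' b'' ∧
        BFSInv E n Best (fun x => ∃ p < len, s.mem l p = x) (b''.K + 1) (fun _ _ => False) b'' ∧
        b''.K = b'.K ∧ b''.head = b''.tail ∧
        (∀ x, (b'.start (s.mem l k)).rd x ≠ 0 → b''.rd x ≠ 0) ∧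
        t + 50 * (n + 1) * (b'.start (s.mem l k)).visited m +
            40 * (m + 1) * (b'.start (s.mem l k)).head ≤
          4 + 50 * (n + 1) * b''.visited m + 40 * (m + 1) * b''.head)
        fun t s'' b'' h1 h2 h3 h4 h5 h6 => ⟨b'', h1, h2, h3, h4, h5, h6⟩).frame ?_)
      rintro t s'' hr - ⟨b'', hrep'', hinv'', hK'', hht'', hrd'', ht⟩
      refine Ends.assign (by simp [RAMExpr.eval, hrep''.K]; omega) ?_
      refine ⟨?_, fun _ => ⟨b''.close, ⟨?_, ?_, ?_, ?_, ?_, ?_, ?_, ?_, ?_⟩, hinv''.close hht'',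
        hht'', ?_, ?_⟩⟩
      · simp [hr 8 (by simp [regs_bfsQueue]), h8]
      any_goals simp [hrep''.rd, hrep''.cd, hrep''.q, hrep''.cmp, hrep''.sd, hrep''.Dm,
        hrep''.tail, hrep''.head, hrep''.K, BFSState.close, RAMExpr.eval]
      · intro p hp
        refine hrd'' _ ?_
        simp only [BFSState.start, Function.update_apply]
        split_ifs with h1
        · simp
        · refine hvis p ?_
          by_contra h2
          exact h1 (by rw [show p = k by omega])
      · have hv : (b'.start (s.mem l k)).visited m = b'.visited m := BFSState.visited_congr rfl
        have hh : (b'.start (s.mem l k)).head = b'.head := rfl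
        rw [hv, hh] at ht
        have hv2 : BFSState.visited m { b'' with K := b''.K + 1 } = b''.visited m :=
          BFSState.visited_congr rfl
        simp only [RAMExpr.cost, hv2]
        omega
    · have hx0 : b'.rd (s.mem l k) ≠ 0 := fun h1 => by simp [heval2, h1] at h
      refine Ends.skip ⟨by simp [hk], fun _ => ⟨b', ⟨?_, ?_, ?_, ?_, ?_, ?_, ?_, ?_, ?_⟩, hinv',
        hht, ?_, ?_⟩⟩
      any_goals simp [hrep'.rd, hrep'.cd, hrep'.q, hrep'.cmp, hrep'.sd, hrep'.Dm, hrep'.tail,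
        hrep'.head, hrep'.K]
      · intro p hp
        by_cases h2 : p = k
        · exact h2 ▸ hx0
        · exact hvis p (by omega)
      · simp only [RAMExpr.cost]
        omega
  · rintro τ s' hF ⟨b', hrep', hinv', hht, hvis, hτ⟩
    refine hQ _ s' b' hrep' hinv' hht hvis ?_
    have h1 : 50 * (n + 1) * b'.visited m ≤ 50 * (n + 1) * m :=
      Nat.mul_le_mul_left _ (b'.visited_le m)
    have h2 : 40 * (m + 1) * b'.head ≤ 40 * (m + 1) * n :=
      Nat.mul_le_mul_left _ (by have := hinv'.tail_le; omega)
    simp only [RAMExpr.cost]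
    omega

end RAMProgram

/-! ### Components and their ends -/

/-- The relation `E` between `n` rows and `m` columns is convex for the orders `f` of the rows and
`g` of the columns. -/
structure IsBiconvex (n m : ℕ) (E : ℕ → ℕ → Prop) (f g : ℕ → ℤ) : Prop where
  lt : ∀ x c, E x c → x < n ∧ c < m
  row : ∀ x a c b, E x a → E x b → g a ≤ g c → g c ≤ g b → E x c
  col : ∀ c x y z, E x c → E z c → f x ≤ f y → f y ≤ f z → E y c

/-- Number of columns in a row. -/
noncomputable abbrev rowDeg (m : ℕ) (E : ℕ → ℕ → Prop) (x : ℕ) : ℕ := rowCount m E (fun _ => True) x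

/-- The rows of component `k`. -/
def compRows (n : ℕ) (cmp : ℕ → ℕ) (k : ℕ) : Set ℕ := {x | x < n ∧ cmp x = k}

/-- The result of a breadth first search of all `K` components: distances of rows and columns,
components of rows, seeds, largest distances, and in each component a row with the most columns
of the last layer that is longest among these. -/
structure PassOut (n m : ℕ) (E : ℕ → ℕ → Prop) (Best : ℕ → ℕ → Prop) (L : ℕ → Prop)
    (rd cd cmp sd Dm out : ℕ → ℕ) (K : ℕ) : Prop where
  cmp_lt : ∀ x < n, cmp x < K
  comps_le : K ≤ n
  rd_le : ∀ x, rd x ≤ n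
  cd_le : ∀ x, cd x ≤ n
  bfs : ∀ k < K, IsBFS E (compRows n cmp k) (sd k) rd cd
  reach : ∀ x < n, Relation.ReflTransGen (RowShare E) (sd (cmp x)) x
  share : ∀ x y c, E x c → E y c → cmp x = cmp y
  best : ∀ x < n, Best (sd (cmp x)) x
  list : ∀ k < K, L (sd k)
  le_Dm : ∀ x c, E x c → cd c ≤ Dm (cmp x)
  Dm_eq : ∀ x c, E x c → ∃ y d, E y d ∧ cmp y = cmp x ∧ cd d = Dm (cmp x)
  out_mem : ∀ k < K, out k ∈ compRows n cmp k
  out_max : ∀ x < n,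
    rowCount m E (fun c => cd c = Dm (cmp x)) x <
      rowCount m E (fun c => cd c = Dm (cmp x)) (out (cmp x)) ∨
    rowCount m E (fun c => cd c = Dm (cmp x)) x =
      rowCount m E (fun c => cd c = Dm (cmp x)) (out (cmp x)) ∧
    rowDeg m E x ≤ rowDeg m E (out (cmp x))

theorem BFSInv.visited_of_reach {E : ℕ → ℕ → Prop} {n : ℕ} {Best : ℕ → ℕ → Prop} {L : ℕ → Prop}
    {κ : ℕ} {b : BFSState} (hb : BFSInv E n Best L κ (fun _ _ => False) b) (hht : b.head = b.tail)
    {x y : ℕ} (hxy : Relation.ReflTransGen (RowShare E) x y) (hx : b.rd x ≠ 0) : b.rd y ≠ 0 := by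
  induction hxy with
  | refl => exact hx
  | tail _ h ih =>
    obtain ⟨c, h1, h2⟩ := h
    obtain ⟨k, hk, hkx⟩ := hb.q_surj _ ih
    exact hb.row_visited _ c h2 (hb.processed k (hht ▸ hk) c (hkx ▸ h1)) id

theorem BFSInv.passOut {E : ℕ → ℕ → Prop} {n m : ℕ} {Best : ℕ → ℕ → Prop} {L : ℕ → Prop}
    {b : BFSState} (hb : BFSInv E n Best L b.K (fun _ _ => False) b) (hht : b.head = b.tail)
    (hE : ∀ x c, E x c → x < n ∧ c < m) (hall : ∀ x < n, b.rd x ≠ 0) {out : ℕ → ℕ}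
    (hout : ∀ k < b.K, out k ∈ compRows n b.cmp k)
    (hmax : ∀ x < n,
      rowCount m E (fun c => b.cd c = b.Dm (b.cmp x)) x <
        rowCount m E (fun c => b.cd c = b.Dm (b.cmp x)) (out (b.cmp x)) ∨
      rowCount m E (fun c => b.cd c = b.Dm (b.cmp x)) x =
        rowCount m E (fun c => b.cd c = b.Dm (b.cmp x)) (out (b.cmp x)) ∧
      rowDeg m E x ≤ rowDeg m E (out (b.cmp x))) :
    PassOut n m E Best L b.rd b.cd b.cmp b.sd b.Dm out b.K := by
  have hcd : ∀ x c, E x c → b.cd c ≠ 0 := fun x c hc => by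
    obtain ⟨k, hk, rfl⟩ := hb.q_surj x (hall x (hE x c hc).1)
    exact hb.processed k (hht ▸ hk) c hc
  refine ⟨fun x hx => hb.cmp_lt x (hall x hx), hb.comps_le,
    fun x => (hb.rd_le x).trans hb.tail_le, hb.cd_le, fun k hk => ?_,
    fun x hx => hb.reach x (hall x hx),
    fun x y c hx hy => hb.share x y c hx hy (hall x (hE x c hx).1) (hall y (hE y c hy).1),
    fun x hx => hb.best x (hall x hx), fun k hk => (hb.seed k hk).2.2.1,
    fun x c hx => hb.le_Dm x c hx (hall x (hE x c hx).1), fun x c hx => ?_, hout, hmax⟩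
  · obtain ⟨h1, h2, -, h3⟩ := hb.seed k hk
    refine ⟨fun x hx c hc => hb.col_le x c hc (hall x hx.1),
      fun x hx c hc => hb.row_le x c hc (hall x hx.1) (hcd x c hc), fun x hx c hc => ?_,
      fun x hx hxs => ?_, ⟨h3, h2⟩, h1, fun x hx => Nat.pos_of_ne_zero (hall x hx.1)⟩
    · obtain ⟨y, h4, -, h5⟩ := hb.col_eq c (hcd x c hc)
      exact ⟨y, h4, h5⟩
    · rcases hb.row_eq x (hall x hx.1) with h4 | ⟨c, h4, -, h5⟩
      · rw [hx.2] at h4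
        exact absurd h4 hxs
      · exact ⟨c, h4, h5⟩
  · have h1 : b.Dm (b.cmp x) ≠ 0 := by
      have := hb.le_Dm x c hx (hall x (hE x c hx).1)
      have := hcd x c hx
      omega
    obtain ⟨y, d, h2, -, h3, h4⟩ := hb.Dm_eq _ h1
    exact ⟨y, d, h2, h3, h4⟩

namespace PassOut

variable {n m : ℕ} {E : ℕ → ℕ → Prop} {Best : ℕ → ℕ → Prop} {L : ℕ → Prop}
    {rd cd cmp sd Dm out : ℕ → ℕ} {K : ℕ} {f g : ℕ → ℤ}

theorem cmp_of_reach (h : PassOut n m E Best L rd cd cmp sd Dm out K) {x y : ℕ}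
    (hxy : Relation.ReflTransGen (RowShare E) x y) : cmp x = cmp y := by
  induction hxy with
  | refl => rfl
  | tail _ h1 ih =>
    obtain ⟨c, h2, h3⟩ := h1
    rw [ih, h.share _ _ c h2 h3]

/-- Empty rows share no column, so each of them is a component of its own. -/
theorem nonempty (h : PassOut n m E Best L rd cd cmp sd Dm out K) {x y : ℕ} {c : ℕ} (hx : x < n)
    (hy : y < n) (hxy : cmp x = cmp y) (hc : E y c) : ∃ c, E x c := by
  have h1 := h.reach x hx
  have h2 := h.reach y hy
  rcases Relation.ReflTransGen.cases_tail h1 with h3 | ⟨w, -, d, -, h4⟩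
  · rw [← hxy, ← h3] at h2
    rcases Relation.ReflTransGen.cases_head h2 with h5 | ⟨w, ⟨d, h4, -⟩, -⟩
    · exact ⟨c, h5 ▸ hc⟩
    · exact ⟨d, h4⟩
  · exact ⟨d, h4⟩

theorem conn (h : PassOut n m E Best L rd cd cmp sd Dm out K) (hE : ∀ x c, E x c → x < n ∧ c < m)
    {k : ℕ} (S : Set ℕ) (x : ℕ) (hx : x ∈ compRows n cmp k) (y : ℕ) (hy : y ∈ compRows n cmp k)
    (hxS : x ∈ S) (hyS : y ∉ S) :
    ∃ x ∈ compRows n cmp k, ∃ y ∈ compRows n cmp k, x ∈ S ∧ y ∉ S ∧ ∃ c, E x c ∧ E y c := by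
  -- A path from the seed to `y` has to leave `S`. If the seed is not in `S`, the same is applied to
  -- the complement of `S`.
  have key : ∀ S : Set ℕ, ∀ y, y ∈ compRows n cmp k → y ∉ S → sd k ∈ S →
      ∃ x ∈ compRows n cmp k, ∃ y ∈ compRows n cmp k, x ∈ S ∧ y ∉ S ∧ ∃ c, E x c ∧ E y c := by
    intro S y hy hyS hs
    have h1 := h.reach y hy.1
    rw [hy.2] at h1
    have h2 : ∀ z, Relation.ReflTransGen (RowShare E) (sd k) z → z ∉ S →
        ∃ x y, Relation.ReflTransGen (RowShare E) (sd k) x ∧ x ∈ S ∧ y ∉ S ∧ RowShare E x y := by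
      intro z hz
      induction hz with
      | refl => exact fun h => absurd hs h
      | @tail b c h3 h4 ih =>
        intro hc
        by_cases hb : b ∈ S
        · exact ⟨b, c, h3, hb, hc, h4⟩
        · exact ih hb
    obtain ⟨x, z, h3, h4, h5, c, h6, h7⟩ := h2 y h1 hyS
    have h8 : cmp x = k := by
      rw [← h.cmp_of_reach h3, h.cmp_of_reach h1, hy.2]
    refine ⟨x, ⟨(hE x c h6).1, h8⟩, z, ⟨(hE z c h7).1, ?_⟩, h4, h5, c, h6, h7⟩
    rw [← h8, h.share _ _ c h6 h7]
  by_cases hs : sd k ∈ S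
  · exact key S y hy hyS hs
  · obtain ⟨x', h1, y', h2, h3, h4, c, h5, h6⟩ := key Sᶜ x hx (by simpa using hxS) hs
    exact ⟨y', h2, x', h1, by simpa using h4, h3, c, h6, h5⟩

end PassOut

/-- First and last columns of rows. -/
theorem IsBiconvex.exists_lo_hi {n m : ℕ} {E : ℕ → ℕ → Prop} {f g : ℕ → ℤ}
    (h : IsBiconvex n m E f g) : ∃ lo hi : ℕ → ℤ, ∀ x, (∃ c, E x c) →
      (∃ c, E x c ∧ g c = lo x) ∧ (∃ c, E x c ∧ g c = hi x) ∧
      ∀ c, E x c ↔ lo x ≤ g c ∧ g c ≤ hi x := by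
  classical
  have H : ∀ x, ∃ a b : ℤ, (∃ c, E x c) → (∃ c, E x c ∧ g c = a) ∧ (∃ c, E x c ∧ g c = b) ∧
      ∀ c, E x c ↔ a ≤ g c ∧ g c ≤ b := by
    intro x
    by_cases hx : ∃ c, E x c
    · obtain ⟨c, hc⟩ := hx
      have hne : ((Finset.range m).filter fun c => E x c).Nonempty :=
        ⟨c, by simp [hc, (h.lt x c hc).2]⟩
      obtain ⟨a, h1, h2⟩ := Finset.exists_min_image _ g hne
      obtain ⟨b, h3, h4⟩ := Finset.exists_max_image _ g hne
      simp only [Finset.mem_filter, Finset.mem_range, and_imp] at h1 h2 h3 h4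
      exact ⟨g a, g b, fun _ => ⟨⟨a, h1.2, rfl⟩, ⟨b, h3.2, rfl⟩, fun c =>
        ⟨fun hc => ⟨h2 c (h.lt x c hc).2 hc, h4 c (h.lt x c hc).2 hc⟩,
          fun hc => h.row x a c b h1.2 h3.2 hc.1 hc.2⟩⟩⟩
    · exact ⟨0, 0, fun h => absurd h hx⟩
  choose lo hi H using H
  exact ⟨lo, hi, H⟩

theorem PassOut.isBiconvexOn {n m : ℕ} {E : ℕ → ℕ → Prop} {Best : ℕ → ℕ → Prop} {L : ℕ → Prop}
    {rd cd cmp sd Dm out : ℕ → ℕ} {K : ℕ} {f g lo hi : ℕ → ℤ}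
    (h : PassOut n m E Best L rd cd cmp sd Dm out K) (hbi : IsBiconvex n m E f g)
    (hlh : ∀ x, (∃ c, E x c) → (∃ c, E x c ∧ g c = lo x) ∧ (∃ c, E x c ∧ g c = hi x) ∧
      ∀ c, E x c ↔ lo x ≤ g c ∧ g c ≤ hi x) {x₀ c₀ : ℕ} (h₀ : E x₀ c₀) :
    IsBiconvexOn E f g lo hi (compRows n cmp (cmp x₀)) := by
  have hne : ∀ x ∈ compRows n cmp (cmp x₀), ∃ c, E x c := fun x hx =>
    h.nonempty hx.1 (hbi.lt _ _ h₀).1 hx.2 h₀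
  exact ⟨fun x hx => (hlh x (hne x hx)).2.2, fun x hx => (hlh x (hne x hx)).1,
    fun x hx => (hlh x (hne x hx)).2.1, hbi.col, h.conn hbi.lt,
    fun x hx c y hxc hyc => ⟨(hbi.lt y c hyc).1, by rw [← hx.2, h.share x y c hxc hyc]⟩⟩

theorem compRows_finite (n : ℕ) (cmp : ℕ → ℕ) (k : ℕ) : (compRows n cmp k).Finite :=
  (Set.finite_lt_nat n).subset fun _ hx => hx.1

theorem PassOut.exists_end {n m : ℕ} {E : ℕ → ℕ → Prop} {Best : ℕ → ℕ → Prop} {L : ℕ → Prop}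
    {rd cd cmp sd Dm out : ℕ → ℕ} {K : ℕ} {f g lo hi : ℕ → ℤ}
    (h : PassOut n m E Best L rd cd cmp sd Dm out K) (hbi : IsBiconvex n m E f g)
    {x₀ c₀ : ℕ} (h₀ : E x₀ c₀)
    (hB : IsBiconvexOn E f g lo hi (compRows n cmp (cmp x₀)))
    (hboth : ∀ v ∈ compRows n cmp (cmp x₀),
      ¬ (lo v < lo (sd (cmp x₀)) ∧ hi (sd (cmp x₀)) < hi v)) :
    (IsLeftEnd lo hi (compRows n cmp (cmp x₀)) (out (cmp x₀)) ∧
      ∃ v ∈ compRows n cmp (cmp x₀), lo v < lo (sd (cmp x₀))) ∨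
    (IsRightEnd lo hi (compRows n cmp (cmp x₀)) (out (cmp x₀)) ∧
      ∃ v ∈ compRows n cmp (cmp x₀), hi (sd (cmp x₀)) < hi v) ∨
    (IsLeftEnd lo hi (compRows n cmp (cmp x₀)) (out (cmp x₀)) ∧
      IsRightEnd lo hi (compRows n cmp (cmp x₀)) (out (cmp x₀))) := by
  have hk := h.cmp_lt x₀ (hbi.lt _ _ h₀).1
  refine (h.bfs _ hk).exists_end hB (m := m) (fun x c hc => (hbi.lt x c hc).2)
    (compRows_finite _ _ _) hboth (D := Dm (cmp x₀)) (h.out_mem _ hk) ?_ ?_ ?_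
  · intro v hv
    have := h.out_max v hv.1
    rw [hv.2] at this
    exact this
  · obtain ⟨y, d, h1, h2, h3⟩ := h.Dm_eq x₀ c₀ h₀
    exact ⟨y, ⟨(hbi.lt y d h1).1, h2⟩, d, h1, h3⟩
  · intro x hx c hc
    rw [← hx.2]
    exact h.le_Dm x c hc

/-- From seeds that are longest in their components the first search finds ends, and from these
the second search finds the opposite ends. -/
theorem PassOut.ends {n m : ℕ} {E : ℕ → ℕ → Prop} {Best' : ℕ → ℕ → Prop} {L' : ℕ → Prop}
    {rd cd cmp sd Dm out rd' cd' cmp' sd' Dm' out' : ℕ → ℕ} {K K' : ℕ} {f g lo hi : ℕ → ℤ}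
    (h : PassOut n m E (fun x y => rowDeg m E y ≤ rowDeg m E x) L' rd cd cmp sd Dm out K)
    (h' : PassOut n m E Best' (fun x => ∃ p < K, out p = x) rd' cd' cmp' sd' Dm' out' K')
    (hbi : IsBiconvex n m E f g)
    (hlh : ∀ x, (∃ c, E x c) → (∃ c, E x c ∧ g c = lo x) ∧ (∃ c, E x c ∧ g c = hi x) ∧
      ∀ c, E x c ↔ lo x ≤ g c ∧ g c ≤ hi x)
    {x₀ c₀ : ℕ} (h₀ : E x₀ c₀) :
    (IsLeftEnd lo hi (compRows n cmp' (cmp' x₀)) (sd' (cmp' x₀)) ∧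
      IsRightEnd lo hi (compRows n cmp' (cmp' x₀)) (out' (cmp' x₀))) ∨
    (IsRightEnd lo hi (compRows n cmp' (cmp' x₀)) (sd' (cmp' x₀)) ∧
      IsLeftEnd lo hi (compRows n cmp' (cmp' x₀)) (out' (cmp' x₀))) := by
  have hx₀ := (hbi.lt _ _ h₀).1
  have hk := h.cmp_lt x₀ hx₀
  have hk' := h'.cmp_lt x₀ hx₀
  have hB := h.isBiconvexOn hbi hlh h₀
  have hB' := h'.isBiconvexOn hbi hlh h₀
  -- In both searches the components are the reachability classes; only their numbering may differ.
  have hsets : compRows n cmp' (cmp' x₀) = compRows n cmp (cmp x₀) := by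
    ext x
    constructor
    · rintro ⟨h1, h2⟩
      refine ⟨h1, ?_⟩
      have h3 := h'.reach x h1
      rw [h2] at h3
      rw [← h.cmp_of_reach h3, h.cmp_of_reach (h'.reach x₀ hx₀)]
    · rintro ⟨h1, h2⟩
      refine ⟨h1, ?_⟩
      have h3 := h.reach x h1
      rw [h2] at h3
      rw [← h'.cmp_of_reach h3, h'.cmp_of_reach (h.reach x₀ hx₀)]
  have hsd : sd' (cmp' x₀) = out (cmp x₀) := by
    obtain ⟨p, hp, h1⟩ := h'.list _ hk'
    have h2 := (h'.bfs _ hk').mem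
    rw [hsets, ← h1] at h2
    rw [← h1, ← h2.2, (h.out_mem p hp).2]
  -- A row extending the seed on both sides would contain it, hence equal it because the seed has
  -- the most columns.
  have hA : IsLeftEnd lo hi (compRows n cmp (cmp x₀)) (out (cmp x₀)) ∨
      IsRightEnd lo hi (compRows n cmp (cmp x₀)) (out (cmp x₀)) := by
    have := h.exists_end hbi h₀ hB ?_
    · tauto
    · rintro v hv ⟨h1, h2⟩
      have hs := (h.bfs _ hk).mem
      have h3 : RowSub E (sd (cmp x₀)) v := (hB.sub_iff hs hv).2 ⟨h1.le, h2.le⟩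
      have h4 := h.best v hv.1
      rw [hv.2] at h4
      have := (hB.sub_iff hv hs).1 (h3.antisymm (m := m) (fun x c hc => (hbi.lt x c hc).2) h4)
      omega
  rw [← hsets, ← hsd] at hA
  rcases hA with hA | hA
  · left
    refine ⟨hA, ?_⟩
    -- The second seed is a left end, so no row extends to its left; this rules out the first
    -- alternative.
    rcases h'.exists_end hbi h₀ hB' (fun v hv h1 => by have := (hA.2 v hv).1; omega) with
      ⟨-, v, hv, h1⟩ | h1 | h1
    · have := (hA.2 v hv).1
      omega
    · exact h1.1
    · exact h1.2
  · right
    refine ⟨hA, ?_⟩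
    rcases h'.exists_end hbi h₀ hB' (fun v hv h1 => by have := (hA.2 v hv).1; omega) with
      h1 | ⟨-, v, hv, h1⟩ | h1
    · exact h1.1
    · have := (hA.2 v hv).1
      omega
    · exact h1.1

/-- The rows of component `k` that are not core rows for the ends `s k` and `e k`. -/
def sideRows (n : ℕ) (E : ℕ → ℕ → Prop) (cmp s e : ℕ → ℕ) (k : ℕ) : Set ℕ :=
  {x | x ∈ compRows n cmp k ∧ ¬ (IsCore E (s k) (e k) x ∧ IsCore E (e k) (s k) x)}

theorem PassOut.exists_coloring {n m : ℕ} {E : ℕ → ℕ → Prop} {Best' : ℕ → ℕ → Prop}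
    {L' : ℕ → Prop} {rd cd cmp sd Dm out rd' cd' cmp' sd' Dm' out' : ℕ → ℕ} {K K' : ℕ}
    {f g : ℕ → ℤ}
    (h : PassOut n m E (fun x y => rowDeg m E y ≤ rowDeg m E x) L' rd cd cmp sd Dm out K)
    (h' : PassOut n m E Best' (fun x => ∃ p < K, out p = x) rd' cd' cmp' sd' Dm' out' K')
    (hbi : IsBiconvex n m E f g) (k : ℕ) : ∃ χ : ℕ → Prop,
      (∀ x ∈ sideRows n E cmp' sd' out' k, χ x → RowSub E x (sd' k)) ∧
      (∀ x ∈ sideRows n E cmp' sd' out' k, ¬ χ x → RowSub E x (out' k)) ∧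
      (∀ x ∈ sideRows n E cmp' sd' out' k, ∀ y ∈ sideRows n E cmp' sd' out' k, (χ x ↔ χ y) →
        RowSub E x y ∨ RowSub E y x) := by
  by_cases hk : ∃ x c, E x c ∧ cmp' x = k
  · obtain ⟨x, c, hxc, rfl⟩ := hk
    obtain ⟨lo, hi, hlh⟩ := hbi.exists_lo_hi
    have hB := h'.isBiconvexOn hbi hlh hxc
    -- The conclusion does not mention `g`, so the columns may be mirrored to make the second seed
    -- the left end.
    obtain ⟨g', lo', hi', hB', hs, he⟩ : ∃ g lo hi : ℕ → ℤ,
        IsBiconvexOn E f g lo hi (compRows n cmp' (cmp' x)) ∧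
        IsLeftEnd lo hi (compRows n cmp' (cmp' x)) (sd' (cmp' x)) ∧
        IsRightEnd lo hi (compRows n cmp' (cmp' x)) (out' (cmp' x)) := by
      rcases h.ends h' hbi hlh hxc with ⟨h1, h2⟩ | ⟨h1, h2⟩
      · exact ⟨_, _, _, hB, h1, h2⟩
      · exact ⟨_, _, _, hB.mirror, h1.mirror, h2.mirror⟩
    obtain ⟨χ, h1, h2, h3⟩ := hB'.exists_coloring hs he
    exact ⟨χ, fun x hx => h1 x hx.1 hx.2, fun x hx => h2 x hx.1 hx.2,
      fun x hx y hy => h3 x hx.1 y hy.1 hx.2 hy.2⟩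
  · have h1 : ∀ x ∈ sideRows n E cmp' sd' out' k, ∀ y, RowSub E x y := fun x hx y c hc =>
      absurd ⟨x, c, hc, hx.1.2⟩ hk
    exact ⟨fun _ => True, fun x hx _ => h1 x hx _, fun x hx _ => h1 x hx _,
      fun x hx y _ _ => Or.inl (h1 x hx y)⟩

/-- The final order of the rows makes all columns convex. -/
theorem PassOut.convex {n m : ℕ} {E : ℕ → ℕ → Prop} {Best' : ℕ → ℕ → Prop} {L' : ℕ → Prop}
    {rd cd cmp sd Dm out rd' cd' cmp' sd' Dm' out' : ℕ → ℕ} {K K' : ℕ} {f g : ℕ → ℤ}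
    (h : PassOut n m E (fun x y => rowDeg m E y ≤ rowDeg m E x) L' rd cd cmp sd Dm out K)
    (h' : PassOut n m E Best' (fun x => ∃ p < K, out p = x) rd' cd' cmp' sd' Dm' out' K')
    (hbi : IsBiconvex n m E f g) {cls : ℕ → ℕ} (hcls : ∀ x < n, cls x ≤ 2)
    (hcore : ∀ x < n, cls x = 1 ↔
      IsCore E (sd' (cmp' x)) (out' (cmp' x)) x ∧ IsCore E (out' (cmp' x)) (sd' (cmp' x)) x)
    (hside : ∀ k < K',
      (∀ x ∈ compRows n cmp' k, cls x = 0 → RowSub E x (sd' k)) ∧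
      (∀ x ∈ compRows n cmp' k, cls x = 2 → RowSub E x (out' k)) ∧
      (∀ x ∈ compRows n cmp' k, ∀ y ∈ compRows n cmp' k, cls x ≠ 1 → cls x = cls y →
        RowSub E x y ∨ RowSub E y x))
    {x y z c : ℕ} (hy : y < n) (hxc : E x c) (hzc : E z c) (hcmp : cmp' y = cmp' x)
    (hxy : RowLe m E rd' cd' cls x y) (hyz : RowLe m E rd' cd' cls y z) : E y c := by
  obtain ⟨lo, hi, hlh⟩ := hbi.exists_lo_hi
  have hx := (hbi.lt _ _ hxc).1
  have hk := h'.cmp_lt x hx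
  have hB := h'.isBiconvexOn hbi hlh hxc
  have hm := fun x c hc => (hbi.lt x c hc).2
  have hz := h'.share z x c hzc hxc
  have hbfs := h'.bfs _ hk
  have main : ∀ (g lo hi : ℕ → ℤ), IsBiconvexOn E f g lo hi (compRows n cmp' (cmp' x)) →
      IsLeftEnd lo hi (compRows n cmp' (cmp' x)) (sd' (cmp' x)) →
      IsRightEnd lo hi (compRows n cmp' (cmp' x)) (out' (cmp' x)) → E y c := by
    intro g lo hi hB hs he
    have hc : ∀ v ∈ compRows n cmp' (cmp' x), cls v = 1 ↔
        IsCore E (sd' (cmp' x)) (out' (cmp' x)) v ∧ IsCore E (out' (cmp' x)) (sd' (cmp' x)) v := by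
      intro v hv
      rw [hcore v hv.1, hv.2]
    obtain ⟨h4, h5, h6⟩ := hside _ hk
    exact hB.convex_rowLe hm hs he hbfs (fun v hv => hcls v hv.1) hc h4 h5 h6
      ⟨hx, rfl⟩ ⟨hy, hcmp⟩ ⟨(hbi.lt _ _ hzc).1, hz⟩ hxc hzc hxy hyz
  rcases h.ends h' hbi hlh hxc with ⟨h1, h2⟩ | ⟨h1, h2⟩
  · exact main g lo hi hB h1 h2
  · exact main _ _ _ hB.mirror h1.mirror h2.mirror

/-! ### Splitting rows into two chains -/

/-- The rows are split into a chain `T` above `t₁`, a chain `B` above `t₂`, a chain `P` of rows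
below both `t₁` and `t₂`, and a rest `U`, and `P` and `U` can be split into two chains one of
which is below `t₁` and the other is below `t₂`. -/
structure ChainSplit (E : ℕ → ℕ → Prop) (M₁ M₂ : ℕ) (T B P U : Set ℕ) (t₁ t₂ : ℕ) : Prop where
  sub₁ : RowSub E t₁ M₁
  sub₂ : RowSub E t₂ M₂
  T_sub : ∀ x ∈ T, RowSub E t₁ x ∧ RowSub E x M₁
  B_sub : ∀ x ∈ B, RowSub E t₂ x ∧ RowSub E x M₂
  T_chain : ∀ x ∈ T, ∀ y ∈ T, RowSub E x y ∨ RowSub E y x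
  B_chain : ∀ x ∈ B, ∀ y ∈ B, RowSub E x y ∨ RowSub E y x
  P_chain : ∀ x ∈ P, ∀ y ∈ P, RowSub E x y ∨ RowSub E y x
  P_sub : ∀ x ∈ P, RowSub E x t₁ ∧ RowSub E x t₂
  split : ∃ χ : ℕ → Prop, (∀ z ∈ P ∪ U, (χ z → RowSub E z t₁) ∧ (¬ χ z → RowSub E z t₂)) ∧
    ∀ z ∈ P ∪ U, ∀ w ∈ P ∪ U, (χ z ↔ χ w) → RowSub E z w ∨ RowSub E w z

theorem RowSub.refl (E : ℕ → ℕ → Prop) (x : ℕ) : RowSub E x x := fun _ h => h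

theorem RowSub.trans {E : ℕ → ℕ → Prop} {x y z : ℕ} (h : RowSub E x y) (h' : RowSub E y z) :
    RowSub E x z := fun c hc => h' c (h c hc)

namespace ChainSplit

variable {E : ℕ → ℕ → Prop} {M₁ M₂ m : ℕ} {T B P U : Set ℕ} {t₁ t₂ y p : ℕ}

theorem swap (h : ChainSplit E M₁ M₂ T B P U t₁ t₂) : ChainSplit E M₂ M₁ B T P U t₂ t₁ := by
  obtain ⟨χ, h1, h2⟩ := h.split
  refine ⟨h.sub₂, h.sub₁, h.B_sub, h.T_sub, h.B_chain, h.T_chain, h.P_chain,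
    fun x hx => (h.P_sub x hx).symm, fun x => ¬ χ x, fun z hz => ⟨(h1 z hz).2, fun h => ?_⟩,
    fun z hz w hw h3 => h2 z hz w hw (by tauto)⟩
  exact (h1 z hz).1 (not_not.1 h)

theorem init {χ : ℕ → Prop} (h1 : ∀ x ∈ U, χ x → RowSub E x M₁)
    (h2 : ∀ x ∈ U, ¬ χ x → RowSub E x M₂)
    (h3 : ∀ x ∈ U, ∀ y ∈ U, (χ x ↔ χ y) → RowSub E x y ∨ RowSub E y x) :
    ChainSplit E M₁ M₂ ∅ ∅ ∅ U M₁ M₂ := by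
  refine ⟨.refl _ _, .refl _ _, ?_, ?_, ?_, ?_, ?_, ?_, χ, ?_, ?_⟩
  any_goals simp
  · exact fun z hz => ⟨h1 z hz, h2 z hz⟩
  · exact h3

/-- A row below the last row of `P` is added to `P`. -/
theorem extend (h : ChainSplit E M₁ M₂ T B P U t₁ t₂) (hp : p ∈ P) (hmin : ∀ x ∈ P, RowSub E p x)
    (hy : y ∈ U) (hyp : RowSub E y p) : ChainSplit E M₁ M₂ T B (insert y P) (U \ {y}) t₁ t₂ := by
  have hset : insert y P ∪ U \ {y} = P ∪ U := by
    ext x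
    by_cases hx : x = y <;> simp [hx, hy]
  refine ⟨h.sub₁, h.sub₂, h.T_sub, h.B_sub, h.T_chain, h.B_chain, ?_, ?_, hset ▸ h.split⟩
  · rintro x (rfl | hx) z (rfl | hz)
    · exact Or.inl (.refl _ _)
    · exact Or.inl (hyp.trans (hmin z hz))
    · exact Or.inr (hyp.trans (hmin x hx))
    · exact h.P_chain x hx z hz
  · rintro x (rfl | hx)
    · exact ⟨hyp.trans (h.P_sub p hp).1, hyp.trans (h.P_sub p hp).2⟩
    · exact h.P_sub x hx

/-- A row that is not below `P` forces `P` into one chain and the row into the other. -/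
theorem resolve (h : ChainSplit E M₁ M₂ T B P U t₁ t₂) (hm : ∀ x c, E x c → c < m)
    (hp : p ∈ P) (hmin : ∀ x ∈ P, RowSub E p x) (hy : y ∈ U) (hyp : ¬ RowSub E y p)
    (hy₂ : RowSub E y t₂) (hdeg : rowDeg m E y ≤ rowDeg m E p)
    (hU : ∀ z ∈ U, rowDeg m E z ≤ rowDeg m E y) :
    ChainSplit E M₁ M₂ (T ∪ P) (insert y B) ∅ (U \ {y}) p y := by
  obtain ⟨χ, h1, h2⟩ := h.split
  have key : ∀ z w, rowDeg m E z ≤ rowDeg m E w → RowSub E z w ∨ RowSub E w z → RowSub E z w := by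
    intro z w hzw h3
    rcases h3 with h3 | h3
    · exact h3
    · exact h3.antisymm hm hzw
  -- Equal colours would make `y` and `p` comparable, and then `y`, having no more columns, would
  -- lie below `p`.
  have hne : ¬ (χ y ↔ χ p) := fun h3 =>
    hyp (key y p hdeg (h2 y (Or.inr hy) p (Or.inl hp) h3))
  -- All of `P` lies below both old chains, so it may join the first chain whatever its colours are.
  -- The remaining rows are recoloured relative to `p`: those coloured like `p` lie below `p`, the
  -- others below `y`.
  refine ⟨((h.P_sub p hp).1).trans h.sub₁, hy₂.trans h.sub₂, ?_, ?_, ?_, ?_, ?_, ?_,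
    fun z => χ z ↔ χ p, ?_, ?_⟩
  · rintro x (hx | hx)
    · exact ⟨(h.P_sub p hp).1.trans (h.T_sub x hx).1, (h.T_sub x hx).2⟩
    · exact ⟨hmin x hx, (h.P_sub x hx).1.trans h.sub₁⟩
  · rintro x (rfl | hx)
    · exact ⟨.refl _ _, hy₂.trans h.sub₂⟩
    · exact ⟨hy₂.trans (h.B_sub x hx).1, (h.B_sub x hx).2⟩
  · rintro x (hx | hx) z (hz | hz)
    · exact h.T_chain x hx z hz
    · exact Or.inr ((h.P_sub z hz).1.trans (h.T_sub x hx).1)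
    · exact Or.inl ((h.P_sub x hx).1.trans (h.T_sub z hz).1)
    · exact h.P_chain x hx z hz
  · rintro x (rfl | hx) z (rfl | hz)
    · exact Or.inl (.refl _ _)
    · exact Or.inl (hy₂.trans (h.B_sub z hz).1)
    · exact Or.inr (hy₂.trans (h.B_sub x hx).1)
    · exact h.B_chain x hx z hz
  · simp
  · simp
  · rintro z (hz | hz)
    · exact hz.elim
    · refine ⟨fun h3 => ?_, fun h3 => ?_⟩
      · exact key z p ((hU z hz.1).trans hdeg) (h2 z (Or.inr hz.1) p (Or.inl hp) h3)
      · exact key z y (hU z hz.1) (h2 z (Or.inr hz.1) y (Or.inr hy) (by tauto))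
  · rintro z (hz | hz) w (hw | hw) h3
    · exact hz.elim
    · exact hz.elim
    · exact hw.elim
    · exact h2 z (Or.inr hz.1) w (Or.inr hw.1) (by tauto)

/-- A row that is not below `t₂` has to be below `t₁`. -/
theorem sub_of_not_sub (h : ChainSplit E M₁ M₂ T B P U t₁ t₂) (hy : y ∈ U)
    (hy₂ : ¬ RowSub E y t₂) : RowSub E y t₁ := by
  obtain ⟨χ, h1, -⟩ := h.split
  by_contra h3
  by_cases h4 : χ y
  · exact h3 ((h1 y (Or.inr hy)).1 h4)
  · exact hy₂ ((h1 y (Or.inr hy)).2 h4)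

/-- If `P` is empty, a row below both chains starts `P`. -/
theorem begin (h : ChainSplit E M₁ M₂ T B ∅ U t₁ t₂) (hy : y ∈ U) (hy₁ : RowSub E y t₁)
    (hy₂ : RowSub E y t₂) : ChainSplit E M₁ M₂ T B {y} (U \ {y}) t₁ t₂ := by
  have hset : {y} ∪ U \ {y} = ∅ ∪ U := by
    ext x
    by_cases hx : x = y <;> simp [hx, hy]
  refine ⟨h.sub₁, h.sub₂, h.T_sub, h.B_sub, h.T_chain, h.B_chain, ?_, ?_, hset ▸ h.split⟩
  · rintro x rfl z rfl
    exact Or.inl (.refl _ _)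
  · rintro x rfl
    exact ⟨hy₁, hy₂⟩

/-- If `P` is empty, a row that is not below `t₂` is added to the chain above `t₁`. -/
theorem append (h : ChainSplit E M₁ M₂ T B ∅ U t₁ t₂) (hm : ∀ x c, E x c → c < m) (hy : y ∈ U)
    (hy₂ : ¬ RowSub E y t₂) (hU : ∀ z ∈ U, rowDeg m E z ≤ rowDeg m E y) :
    ChainSplit E M₁ M₂ (insert y T) B ∅ (U \ {y}) y t₂ := by
  have hy₁ := h.sub_of_not_sub hy hy₂
  obtain ⟨χ, h1, h2⟩ := h.split
  have hχ : χ y := by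
    by_contra h3
    exact hy₂ ((h1 y (Or.inr hy)).2 h3)
  refine ⟨hy₁.trans h.sub₁, h.sub₂, ?_, h.B_sub, ?_, h.B_chain, h.P_chain, ?_, χ, ?_, ?_⟩
  · rintro x (rfl | hx)
    · exact ⟨.refl _ _, hy₁.trans h.sub₁⟩
    · exact ⟨hy₁.trans (h.T_sub x hx).1, (h.T_sub x hx).2⟩
  · rintro x (rfl | hx) z (rfl | hz)
    · exact Or.inl (.refl _ _)
    · exact Or.inl (hy₁.trans (h.T_sub z hz).1)
    · exact Or.inr (hy₁.trans (h.T_sub x hx).1)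
    · exact h.T_chain x hx z hz
  · simp
  · rintro z (hz | hz)
    · exact hz.elim
    · refine ⟨fun h3 => ?_, fun h3 => (h1 z (Or.inr hz.1)).2 h3⟩
      rcases h2 z (Or.inr hz.1) y (Or.inr hy) (by tauto) with h4 | h4
      · exact h4
      · exact h4.antisymm hm (hU z hz.1)
  · rintro z (hz | hz) w (hw | hw) h3
    · exact hz.elim
    · exact hz.elim
    · exact hw.elim
    · exact h2 z (Or.inr hz.1) w (Or.inr hw.1) h3

end ChainSplit

/-- The state of the splitting: for each component the last rows `t₁` and `t₂` of the two chains
and the last of the rows (plus `1`) that are not yet assigned to a chain, for each row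
a representative, and the classes of representatives. -/
structure SplitState where
  t₁ : ℕ → ℕ
  t₂ : ℕ → ℕ
  pd : ℕ → ℕ
  gr : ℕ → ℕ
  gcol : ℕ → ℕ

open Classical in
/-- Assign the row `y` of component `k`. -/
noncomputable def SplitState.step (E : ℕ → ℕ → Prop) (k y : ℕ) (st : SplitState) : SplitState :=
  if st.pd k ≠ 0 then
    if RowSub E y (st.pd k - 1) then
      { st with
        pd := Function.update st.pd k (y + 1)
        gr := Function.update st.gr y (st.gr (st.pd k - 1)) }
    else if RowSub E y (st.t₂ k) then
      { st with
        t₁ := Function.update st.t₁ k (st.pd k - 1)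
        t₂ := Function.update st.t₂ k y
        pd := Function.update st.pd k 0
        gcol := Function.update st.gcol y 2 }
    else
      { st with
        t₁ := Function.update st.t₁ k y
        t₂ := Function.update st.t₂ k (st.pd k - 1)
        pd := Function.update st.pd k 0
        gcol := Function.update st.gcol (st.gr (st.pd k - 1)) 2 }
  else if RowSub E y (st.t₁ k) then
    if RowSub E y (st.t₂ k) then
      { st with pd := Function.update st.pd k (y + 1) }
    else
      { st with t₁ := Function.update st.t₁ k y }
  else
    { st with
      t₂ := Function.update st.t₂ k y
      gcol := Function.update st.gcol y 2 }

/-- The rows `x` in `K` with `D x` have been assigned. -/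
structure SplitInv (E : ℕ → ℕ → Prop) (M₁ M₂ : ℕ) (K : Set ℕ) (k : ℕ) (D : ℕ → Prop)
    (st : SplitState) : Prop where
  pd_mem : st.pd k ≠ 0 → st.pd k - 1 ∈ K ∧ D (st.pd k - 1)
  gr_mem : ∀ x ∈ K, st.gr x ∈ K
  gr_done : ∀ x ∈ K, D x → D (st.gr x)
  gr_undone : ∀ x ∈ K, ¬ D x → st.gr x = x ∧ st.gcol x = 0
  col : ∀ x ∈ K, st.gcol x = 0 ∨ st.gcol x = 2
  pd_col : st.pd k ≠ 0 → st.gcol (st.gr (st.pd k - 1)) = 0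
  pd_min : st.pd k ≠ 0 → ∀ x ∈ K, D x → st.gr x = st.gr (st.pd k - 1) → RowSub E (st.pd k - 1) x
  split : ChainSplit E M₁ M₂
    {x | x ∈ K ∧ D x ∧ ¬ (st.pd k ≠ 0 ∧ st.gr x = st.gr (st.pd k - 1)) ∧ st.gcol (st.gr x) = 0}
    {x | x ∈ K ∧ D x ∧ ¬ (st.pd k ≠ 0 ∧ st.gr x = st.gr (st.pd k - 1)) ∧ st.gcol (st.gr x) = 2}
    {x | x ∈ K ∧ D x ∧ (st.pd k ≠ 0 ∧ st.gr x = st.gr (st.pd k - 1))}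
    {x | x ∈ K ∧ ¬ D x} (st.t₁ k) (st.t₂ k)

namespace SplitInv

variable {E : ℕ → ℕ → Prop} {M₁ M₂ m k : ℕ} {K : Set ℕ} {D : ℕ → Prop} {st : SplitState} {y : ℕ}

-- Each branch of `SplitState.step` is one move of `ChainSplit`: `extend`, `resolve`, `begin` or
-- `append`, possibly with the two chains exchanged by `swap`. The pending group is encoded by its
-- common representative of class `0`, so settling it means recolouring at most that one cell.
set_option maxHeartbeats 1000000 in
theorem step (h : SplitInv E M₁ M₂ K k D st) (hm : ∀ x c, E x c → c < m) (hy : y ∈ K) (hyD : ¬ D y)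
    (hD : ∀ x ∈ K, D x → rowDeg m E y ≤ rowDeg m E x)
    (hU : ∀ x ∈ K, ¬ D x → rowDeg m E x ≤ rowDeg m E y) :
    SplitInv E M₁ M₂ K k (fun x => D x ∨ x = y) (st.step E k y) := by
  obtain ⟨t₁, t₂, pd, gr, gcol⟩ := st
  obtain ⟨hpd_mem, hgr_mem, hgr_done, hgr_undone, hcol, hpd_col, hpd_min, hsplit⟩ := h
  simp only at *
  have hgy := hgr_undone y hy hyD
  have hgx : ∀ x ∈ K, D x → gr x ≠ y := fun x hx hxD h => hyD (h ▸ hgr_done x hx hxD)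
  have hU' : ∀ z ∈ {x | x ∈ K ∧ ¬ D x}, rowDeg m E z ≤ rowDeg m E y := fun z hz => hU z hz.1 hz.2
  by_cases hpd : pd k ≠ 0
  · obtain ⟨hpK, hpD⟩ := hpd_mem hpd
    have hcolp := hpd_col hpd
    have hmin := hpd_min hpd
    have hpP : pd k - 1 ∈ {x | x ∈ K ∧ D x ∧ (pd k ≠ 0 ∧ gr x = gr (pd k - 1))} :=
      ⟨hpK, hpD, hpd, rfl⟩
    have hminP : ∀ x ∈ {x | x ∈ K ∧ D x ∧ (pd k ≠ 0 ∧ gr x = gr (pd k - 1))},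
        RowSub E (pd k - 1) x := fun x hx => hmin x hx.1 hx.2.1 hx.2.2.2
    have hgp := hgr_mem _ hpK
    have hgpD := hgr_done _ hpK hpD
    by_cases h1 : RowSub E y (pd k - 1)
    · simp only [SplitState.step, if_pos hpd, if_pos h1]
      have H := hsplit.extend hpP hminP ⟨hy, hyD⟩ h1
      constructor
      all_goals simp only [Function.update_apply, if_true, Nat.add_sub_cancel]
      · grind
      · grind
      · grind
      · grind
      · exact hcol
      · grind
      · intro _ x hx hxD hgx'
        split_ifs at hgx' with h3
        · exact h3 ▸ .refl _ _
        · exact h1.trans (hmin x hx (by tauto) hgx')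
      · convert H using 1 <;>
          (clear H hsplit hU' hU hD
           ext x
           simp only [Set.mem_ofPred_eq, Set.mem_insert_iff, Set.mem_sdiff,
             Set.mem_singleton_iff]
           clear hminP hpP hmin hpd_min hm
           grind)
    · by_cases h2 : RowSub E y (t₂ k)
      · simp only [SplitState.step, if_pos hpd, if_neg h1, if_pos h2]
        have H := hsplit.resolve hm hpP hminP ⟨hy, hyD⟩ h1 h2 (hD _ hpK hpD) hU'
        constructor
        all_goals simp only [Function.update_apply, if_true]
        · grind
        · exact hgr_mem
        · grind
        · grind
        · grind
        · grind
        · grind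
        · convert H using 1 <;>
            (clear H hsplit hU' hU hD
             ext x
             simp only [Set.mem_ofPred_eq, Set.mem_insert_iff, Set.mem_sdiff,
               Set.mem_singleton_iff, Set.mem_union, Set.mem_empty_iff_false]
             clear hminP hpP hmin hpd_min hm
             grind)
      · simp only [SplitState.step, if_pos hpd, if_neg h1, if_neg h2]
        have h3 := hsplit.sub_of_not_sub ⟨hy, hyD⟩ h2
        have H := (hsplit.swap.resolve hm hpP hminP ⟨hy, hyD⟩ h1 h3 (hD _ hpK hpD) hU').swap
        constructor
        all_goals simp only [Function.update_apply, if_true]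
        · grind
        · exact hgr_mem
        · grind
        · grind
        · grind
        · grind
        · grind
        · convert H using 1 <;>
            (clear H hsplit hU' hU hD
             ext x
             simp only [Set.mem_ofPred_eq, Set.mem_insert_iff, Set.mem_sdiff,
               Set.mem_singleton_iff, Set.mem_union, Set.mem_empty_iff_false]
             clear hminP hpP hmin hpd_min hm
             grind)
  · have hpd0 : pd k = 0 := by simpa using hpd
    have hP : {x | x ∈ K ∧ D x ∧ (pd k ≠ 0 ∧ gr x = gr (pd k - 1))} = ∅ := by
      ext x
      simp [hpd0]
    rw [hP] at hsplit
    by_cases h1 : RowSub E y (t₁ k)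
    · by_cases h2 : RowSub E y (t₂ k)
      · simp only [SplitState.step, if_neg hpd, if_pos h1, if_pos h2]
        have H := hsplit.begin ⟨hy, hyD⟩ h1 h2
        constructor
        all_goals simp only [Function.update_apply, if_true, Nat.add_sub_cancel]
        · grind
        · exact hgr_mem
        · grind
        · grind
        · grind
        · grind
        · intro _ x hx hxD hgx'
          have : x = y := by grind
          exact this ▸ .refl _ _
        · convert H using 1 <;>
            (clear H hsplit hU' hU hD
             ext x
             simp only [Set.mem_ofPred_eq, Set.mem_sdiff,
               Set.mem_singleton_iff]
             clear hpd_min hm hP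
             grind)
      · simp only [SplitState.step, if_neg hpd, if_pos h1, if_neg h2]
        have H := hsplit.append hm ⟨hy, hyD⟩ h2 hU'
        constructor
        all_goals simp only [Function.update_apply, if_true]
        · grind
        · exact hgr_mem
        · grind
        · grind
        · grind
        · grind
        · grind
        · convert H using 1 <;>
            (clear H hsplit hU' hU hD
             ext x
             simp only [Set.mem_ofPred_eq, Set.mem_insert_iff, Set.mem_sdiff,
               Set.mem_singleton_iff, Set.mem_empty_iff_false]
             clear hpd_min hm hP
             grind)
    · simp only [SplitState.step, if_neg hpd, if_neg h1]
      have H := (hsplit.swap.append hm ⟨hy, hyD⟩ h1 hU').swap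
      constructor
      all_goals simp only [Function.update_apply, if_true]
      · grind
      · exact hgr_mem
      · grind
      · grind
      · grind
      · grind
      · grind
      · convert H using 1 <;>
          (clear H hsplit hU' hU hD
           ext x
           simp only [Set.mem_ofPred_eq, Set.mem_insert_iff, Set.mem_sdiff,
             Set.mem_singleton_iff, Set.mem_empty_iff_false]
           clear hpd_min hm hP
           grind)

/-- The invariant of component `k` does not depend on other components. -/
theorem congr (h : SplitInv E M₁ M₂ K k D st) {D' : ℕ → Prop} {st' : SplitState}
    (hD : ∀ x ∈ K, D' x ↔ D x) (ht₁ : st'.t₁ k = st.t₁ k) (ht₂ : st'.t₂ k = st.t₂ k)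
    (hpd : st'.pd k = st.pd k) (hgr : ∀ x ∈ K, st'.gr x = st.gr x)
    (hgcol : ∀ x ∈ K, st'.gcol x = st.gcol x) : SplitInv E M₁ M₂ K k D' st' := by
  obtain ⟨t₁, t₂, pd, gr, gcol⟩ := st
  obtain ⟨t₁', t₂', pd', gr', gcol'⟩ := st'
  obtain ⟨hpd_mem, hgr_mem, hgr_done, hgr_undone, hcol, hpd_col, hpd_min, hsplit⟩ := h
  simp only at *
  constructor
  all_goals simp only [ht₁, ht₂, hpd]
  · grind
  · grind
  · grind
  · grind
  · grind
  · grind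
  · grind
  · convert hsplit using 1 <;> (ext x; simp only [Set.mem_ofPred_eq]; grind)

/-- Lets one pass over all rows, sorted globally by length, handle all components at once. -/
theorem step_of_ne (h : SplitInv E M₁ M₂ K k D st) {k' : ℕ} (hk : k' ≠ k) (hy : y ∉ K)
    (hgr : st.pd k' ≠ 0 → st.gr (st.pd k' - 1) ∉ K) :
    SplitInv E M₁ M₂ K k (fun x => D x ∨ x = y) (st.step E k' y) := by
  have h1 : ∀ x ∈ K, (D x ∨ x = y) ↔ D x := fun x hx =>
    ⟨fun h => h.resolve_right fun h => hy (h ▸ hx), Or.inl⟩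
  refine h.congr h1 ?_ ?_ ?_ ?_ ?_
  all_goals
    simp only [SplitState.step]
    split_ifs <;> simp only [Function.update_apply] <;> grind

theorem start {χ : ℕ → Prop} (h1 : ∀ x ∈ K, χ x → RowSub E x M₁)
    (h2 : ∀ x ∈ K, ¬ χ x → RowSub E x M₂)
    (h3 : ∀ x ∈ K, ∀ y ∈ K, (χ x ↔ χ y) → RowSub E x y ∨ RowSub E y x)
    (ht₁ : st.t₁ k = M₁) (ht₂ : st.t₂ k = M₂) (hpd : st.pd k = 0) (hgr : ∀ x ∈ K, st.gr x = x)
    (hgcol : ∀ x ∈ K, st.gcol x = 0) (hD : ∀ x ∈ K, ¬ D x) : SplitInv E M₁ M₂ K k D st := by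
  have H := ChainSplit.init h1 h2 h3
  constructor
  all_goals try simp only [ht₁, ht₂, hpd]
  · grind
  · grind
  · grind
  · grind
  · grind
  · grind
  · grind
  · convert H using 1 <;>
      (clear H; ext x; simp only [Set.mem_ofPred_eq, Set.mem_empty_iff_false]; grind)

/-- A group still pending at the end keeps class `0` and so joins the first chain, below whose last
row it lies. -/
theorem finish (h : SplitInv E M₁ M₂ K k D st) (hD : ∀ x ∈ K, D x) :
    (∀ x ∈ K, st.gcol (st.gr x) = 0 → RowSub E x M₁) ∧
    (∀ x ∈ K, st.gcol (st.gr x) = 2 → RowSub E x M₂) ∧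
    (∀ x ∈ K, ∀ y ∈ K, st.gcol (st.gr x) = st.gcol (st.gr y) → RowSub E x y ∨ RowSub E y x) := by
  obtain ⟨hpd_mem, hgr_mem, hgr_done, hgr_undone, hcol, hpd_col, hpd_min, hsplit⟩ := h
  have hT : ∀ x ∈ K, st.gcol (st.gr x) = 0 →
      ((x ∈ {x | x ∈ K ∧ D x ∧ ¬ (st.pd k ≠ 0 ∧ st.gr x = st.gr (st.pd k - 1)) ∧
        st.gcol (st.gr x) = 0}) ∨
      (x ∈ {x | x ∈ K ∧ D x ∧ (st.pd k ≠ 0 ∧ st.gr x = st.gr (st.pd k - 1))})) := by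
    intro x hx h0
    simp only [Set.mem_ofPred_eq]
    have := hD x hx
    tauto
  have hB : ∀ x ∈ K, st.gcol (st.gr x) = 2 →
      x ∈ {x | x ∈ K ∧ D x ∧ ¬ (st.pd k ≠ 0 ∧ st.gr x = st.gr (st.pd k - 1)) ∧
        st.gcol (st.gr x) = 2} := by
    intro x hx h0
    refine ⟨hx, hD x hx, fun h => ?_, h0⟩
    rw [h.2, hpd_col h.1] at h0
    omega
  refine ⟨fun x hx h0 => ?_, fun x hx h0 => (hsplit.B_sub x (hB x hx h0)).2,
    fun x hx y hy hxy => ?_⟩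
  · rcases hT x hx h0 with h1 | h1
    · exact (hsplit.T_sub x h1).2
    · exact (hsplit.P_sub x h1).1.trans hsplit.sub₁
  · rcases hcol _ (hgr_mem x hx) with h0 | h0
    · rcases hT x hx h0 with h1 | h1 <;> rcases hT y hy (hxy ▸ h0) with h2 | h2
      · exact hsplit.T_chain x h1 y h2
      · exact Or.inr ((hsplit.P_sub y h2).1.trans (hsplit.T_sub x h1).1)
      · exact Or.inl ((hsplit.P_sub x h1).1.trans (hsplit.T_sub y h2).1)
      · exact hsplit.P_chain x h1 y h2
    · exact hsplit.B_chain x (hB x hx h0) y (hB y hy (hxy ▸ h0))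

end SplitInv

namespace RAMProgram

variable {W n m : ℕ} {E : ℕ → ℕ → Prop} {s : RAMState} {Q : ℕ → RAMState → Prop}

theorem sum_eq_rowCount (p : ℕ → Prop) (x : ℕ) [∀ c, Decidable (E x c)] [DecidablePred p] :
    ∑ c ∈ Finset.range m, (if E x c then 1 else 0) * (if p c then 1 else 0) = rowCount m E p x := by
  rw [rowCount, Finset.card_filter]
  refine Finset.sum_congr rfl fun c _ => ?_
  by_cases h1 : E x c <;> by_cases h2 : p c <;> simp [h1, h2]

/-! ### Sorting the rows -/

/-- The first `n` values of `o` are the rows, sorted by decreasing number of columns. -/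
structure IsRowOrder (n m : ℕ) (E : ℕ → ℕ → Prop) (o : ℕ → ℕ) : Prop where
  lt : ∀ p < n, o p < n
  surj : ∀ x < n, ∃ p < n, o p = x
  inj : ∀ p < n, ∀ q < n, o p = o q → p = q
  anti : ∀ p q, p ≤ q → q < n → rowDeg m E (o q) ≤ rowDeg m E (o p)

/-- `d[i]` is the number of columns of row `i`. -/
def rowDegs (d : ℕ) : RAMProgram := fillSum d (.reg 0) (.reg 1) (entry (.reg 2) (.reg 3))

theorem Ends.rowDegs {d : ℕ} (hd : 0 < d) (hn : n < W) (hm : m < W) (hin : HasInput n m E s)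
    (hQ : ∀ t s', FillFrame d s s' → (∀ x < n, s'.mem d x = rowDeg m E x) →
      t ≤ 50 * ((n + 1) * (m + 1)) → Q t s') : (rowDegs d).Ends W s Q := by
  classical
  have hin' : ∀ s', FillFrame d s s' → HasInput n m E s' := fun s' h =>
    hin.congr (h.1 0 (by simp) (by simp) (by simp)) (h.1 1 (by simp) (by simp) (by simp))
      (h.2 0 (by omega))
  have hsum : ∀ x, ∑ c ∈ Finset.range m, (if E x c then 1 else 0) = rowDeg m E x := by
    intro x
    rw [rowDeg, ← sum_eq_rowCount]
    simp
  refine Ends.fillSum n m (fun x c => if E x c then 1 else 0) hn hm (fun s' h => (hin' s' h).rows)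
    (fun s' h => (hin' s' h).cols)
    (fun s' h h2 h3 => (hin' s' h).eval_entry rfl rfl h2 h3)
    (fun x _ => by rw [hsum]; exact (rowCount_le _ _ _).trans_lt hm) ?_
  intro t s' h1 h2 _ h4
  exact hQ t s' h1 (fun x hx => by rw [h2 x hx, hsum])
    (h4.trans (Nat.mul_le_mul_right _ (by simp [RAMExpr.cost, entry])))

/-- Sort the rows by decreasing values in the array `d`. -/
def sortRows (d o : ℕ) : RAMProgram :=
  .seq (.assign 13 (.const 0)) (forTo 8 (.add (.reg 1) (.const 1)) (forTo 9 (.reg 0)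
    (.ite (.eq (.add (.read d (.reg 9)) (.reg 8)) (.reg 1))
      (.seq (.store o (.reg 13) (.reg 9)) (.assign 13 (.add (.reg 13) (.const 1)))) .skip)))

/-- The first `l` values of `o` are the rows `x` with `(m - δ x, x) < (k, i)`, in this order. -/
structure SortInv (n m : ℕ) (δ : ℕ → ℕ) (k i l : ℕ) (o : ℕ → ℕ) : Prop where
  lt : ∀ p < l, o p < n ∧ (m < δ (o p) + k ∨ δ (o p) + k = m ∧ o p < i)
  surj : ∀ x < n, (m < δ x + k ∨ δ x + k = m ∧ x < i) → ∃ p < l, o p = x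
  mono : ∀ p q, p < q → q < l → δ (o q) < δ (o p) ∨ δ (o q) = δ (o p) ∧ o p < o q

theorem SortInv.inj {δ o : ℕ → ℕ} {k i l : ℕ} (h : SortInv n m δ k i l o) {p q : ℕ} (hp : p < l)
    (hq : q < l) (hpq : o p = o q) : p = q := by
  rcases lt_trichotomy p q with h1 | h1 | h1
  · have := h.mono p q h1 hq
    rw [hpq] at this
    omega
  · exact h1
  · have := h.mono q p h1 hp
    rw [hpq] at this
    omega

theorem SortInv.le {δ o : ℕ → ℕ} {k i l : ℕ} (h : SortInv n m δ k i l o) : l ≤ n := by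
  have := Finset.card_le_card_of_injOn (s := Finset.range l) (t := Finset.range n) o
    (fun p hp => by simpa using (h.lt p (by simpa using hp)).1)
    (fun p hp q hq => h.inj (by simpa using hp) (by simpa using hq))
  simpa using this

theorem SortInv.append {δ o : ℕ → ℕ} {k i l : ℕ} (h : SortInv n m δ k i l o) (hi : i < n)
    (hik : δ i + k = m) : SortInv n m δ k (i + 1) (l + 1) (Function.update o l i) := by
  have h0 : ∀ p < l, Function.update o l i p = o p := fun p hp =>
    Function.update_of_ne (by omega) _ _
  refine ⟨fun p hp => ?_, fun x hx h1 => ?_, fun p q hpq hq => ?_⟩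
  · by_cases hpl : p = l
    · subst hpl
      simp [hi, hik]
    · rw [h0 p (by omega)]
      have := h.lt p (by omega)
      omega
  · by_cases hxi : x = i
    · exact ⟨l, by omega, by simp [hxi]⟩
    · obtain ⟨p, hp, rfl⟩ := h.surj x hx (by omega)
      exact ⟨p, by omega, h0 p hp⟩
  · rw [h0 p (by omega)]
    by_cases hql : q = l
    · subst hql
      have := h.lt p hpq
      simp only [Function.update_self]
      omega
    · rw [h0 q (by omega)]
      exact h.mono p q hpq (by omega)

theorem SortInv.skip {δ o : ℕ → ℕ} {k i l : ℕ} (h : SortInv n m δ k i l o)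
    (hik : δ i + k ≠ m) : SortInv n m δ k (i + 1) l o := by
  refine ⟨fun p hp => ?_, fun x hx h1 => h.surj x hx ?_, h.mono⟩
  · have := h.lt p hp
    omega
  · rcases h1 with h1 | ⟨h1, h2⟩
    · exact Or.inl h1
    · refine Or.inr ⟨h1, ?_⟩
      rcases Nat.lt_succ_iff_lt_or_eq.1 h2 with h3 | rfl
      · exact h3
      · exact absurd h1 hik

theorem SortInv.next {δ o : ℕ → ℕ} {k l : ℕ} (h : SortInv n m δ k n l o) :
    SortInv n m δ (k + 1) 0 l o :=
  ⟨fun p hp => by have := h.lt p hp; omega, fun x hx h1 => h.surj x hx (by omega), h.mono⟩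

theorem SortInv.isRowOrder {δ o : ℕ → ℕ} {l : ℕ} (h : SortInv n m δ (m + 1) 0 l o)
    (hδ : ∀ x < n, δ x = rowDeg m E x) : l = n ∧ IsRowOrder n m E o := by
  have hsurj : ∀ x < n, ∃ p < l, o p = x := fun x hx => h.surj x hx (by omega)
  have hl : n ≤ l := by
    have := Finset.card_le_card_of_surjOn (s := Finset.range l) (t := Finset.range n) o
      (fun x hx => by
        obtain ⟨p, hp, rfl⟩ := hsurj x (by simpa using hx)
        exact ⟨p, by simpa using hp, rfl⟩)
    simpa using this
  obtain rfl : l = n := le_antisymm h.le hl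
  refine ⟨rfl, fun p hp => (h.lt p hp).1, hsurj, fun p hp q hq => h.inj hp hq, fun p q hpq hq => ?_⟩
  rcases hpq.lt_or_eq with h1 | rfl
  · rw [← hδ _ (h.lt p (by omega)).1, ← hδ _ (h.lt q hq).1]
    have := h.mono p q h1 hq
    omega
  · exact le_rfl

/-- Round `k` appends the rows with `m - k` columns. There are `m + 1` rounds, each scanning `n`
rows, which is affordable. -/
theorem Ends.sortRows {d o : ℕ} (hod : o ≠ d) (hn : n < W) (hm : m + 1 < W)
    (hin : HasInput n m E s) (hd : ∀ x < n, s.mem d x = rowDeg m E x)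
    (hQ : ∀ t s', s'.reg 13 = n → IsRowOrder n m E (s'.mem o) →
      t ≤ 40 * ((n + 1) * (m + 1)) → Q t s') : (sortRows d o).Ends W s Q := by
  refine Ends.seq (Ends.assign (by simp [RAMExpr.eval]; omega) ?_)
  simp only [RAMExpr.eval]
  refine Ends.forTo_bdd (m + 1) (n * 23 + 6)
    (fun k s' => SortInv n m (s.mem d) k 0 (s'.reg 13) (s'.mem o)) hm ?_ ?_ ?_ ?_
  · intro s' hF
    simp [RAMExpr.eval, hF.1 1 (by simp [RAMProgram.forTo, regs]), hin.cols]
  · refine ⟨by simp, fun x hx h => ?_, by simp⟩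
    have := hd x hx
    have := rowCount_le (m := m) E (fun _ => True) x
    simp only [rowDeg] at *
    omega
  · intro k s' hF hk hI hkm
    have h0 : s'.reg 0 = n := by
      rw [hF.1 0 (by simp [RAMProgram.forTo, regs])]
      simpa using hin.rows
    have h1 : s'.reg 1 = m := by
      rw [hF.1 1 (by simp [RAMProgram.forTo, regs])]
      simpa using hin.cols
    have hdd : s'.mem d = s.mem d := by
      rw [hF.2 d (by simp [RAMProgram.forTo, arrays, hod.symm])]
      simp
    refine Ends.forTo_bdd n 15
      (fun i s'' => s''.reg 8 = k ∧ SortInv n m (s.mem d) k i (s''.reg 13) (s''.mem o)) hn ?_ ?_ ?_ ?_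
    · intro s'' hF'
      simp [RAMExpr.eval, hF'.1 0 (by simp [RAMProgram.forTo, regs]), h0]
    · exact ⟨by simp [hk], by simpa using hI⟩
    · rintro i s'' hF' hi ⟨h8, hI'⟩ hin
      have h1' : s''.reg 1 = m := by rw [hF'.1 1 (by simp [RAMProgram.forTo, regs]), h1]
      have hd' : s''.mem d = s.mem d := by
        rw [hF'.2 d (by simp [RAMProgram.forTo, arrays, hod.symm]), hdd]
      have hev : RAMExpr.eval s'' (.eq (.add (.read d (.reg 9)) (.reg 8)) (.reg 1)) =
          if s.mem d i + k = m then 1 else 0 := by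
        simp [RAMExpr.eval, h1', hd', h8, hi]
      refine Ends.ite (fun h => ?_) (fun h => ?_)
      · have hik : s.mem d i + k = m := by by_contra h2; simp [hev, h2] at h
        have hA := hI'.append hin hik
        have hle := hA.le
        refine Ends.seq (Ends.store (by simp only [RAMExpr.eval]; omega)
          (by simp only [RAMExpr.eval]; omega) (Ends.assign
            (by simp only [RAMExpr.eval, RAMState.setMem_reg]; omega) ⟨?_, ?_, fun _ => ⟨?_, ?_⟩⟩))
        · simp [hi]
        · simp [RAMExpr.cost]
        · simp [h8]
        · simpa [RAMExpr.eval, hi] using hA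
      · have hik : s.mem d i + k ≠ m := by intro h2; simp [hev, h2] at h
        exact Ends.skip ⟨hi, by simp [RAMExpr.cost], fun _ => ⟨by simp [h8],
          by simpa using hI'.skip hik⟩⟩
    · rintro τ s'' hF' ⟨h8, hI'⟩ hτ
      refine ⟨h8, ?_, fun _ => by simpa using hI'.next⟩
      simp only [RAMExpr.cost] at hτ
      omega
  · intro τ s' hF hI hτ
    obtain ⟨h1, h2⟩ := hI.isRowOrder hd
    refine hQ _ s' h1 h2 ?_
    simp only [RAMExpr.cost] at hτ ⊢
    nlinarith

/-! ### Longest rows in components -/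

/-- For each value of `cmp` find a row with the largest value of `key`. -/
def argMax (cmp key best out : ℕ) : RAMProgram :=
  forTo 8 (.reg 0) (.ite (.lt (.read best (.read cmp (.reg 8)))
      (.add (.read key (.reg 8)) (.const 1)))
    (.seq (.store best (.read cmp (.reg 8)) (.add (.read key (.reg 8)) (.const 1)))
      (.store out (.read cmp (.reg 8)) (.reg 8))) .skip)

/-- The array `best` holds the maximum plus one, so that its initial value `0` means that no row of
the component has been seen. -/
theorem Ends.argMax {cmp key best out : ℕ} (hbo : best ≠ out) (hc : cmp ≠ best ∧ cmp ≠ out)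
    (hk : key ≠ best ∧ key ≠ out) (hn : n < W) (hreg : s.reg 0 = n)
    (hzero : s.mem best = fun _ => 0)
    (hcmp : ∀ x < n, s.mem cmp x < W) (hkey : ∀ x < n, s.mem key x + 1 < W)
    (hQ : ∀ t s', (∀ x < n, s'.mem out (s.mem cmp x) < n ∧
      s.mem cmp (s'.mem out (s.mem cmp x)) = s.mem cmp x ∧
      s.mem key x ≤ s.mem key (s'.mem out (s.mem cmp x))) → t ≤ 40 * (n + 1) → Q t s') :
    (argMax cmp key best out).Ends W s Q := by
  refine Ends.forTo_bdd n 25 (fun i s' =>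
    (∀ k, s'.mem best k ≠ 0 → s'.mem out k < n ∧ s.mem cmp (s'.mem out k) = k ∧
      s'.mem best k = s.mem key (s'.mem out k) + 1) ∧
    ∀ x < i, s.mem key x + 1 ≤ s'.mem best (s.mem cmp x)) hn ?_ ?_ ?_ ?_
  · intro s' hF
    simp [RAMExpr.eval, hF.1 0 (by simp [RAMProgram.forTo, regs]), hreg]
  · simp [hzero]
  · rintro i s' hF hi ⟨hI, hJ⟩ hin
    have hc' : s'.mem cmp = s.mem cmp := hF.2 cmp (by simp [RAMProgram.forTo, arrays, hc])
    have hk' : s'.mem key = s.mem key := hF.2 key (by simp [RAMProgram.forTo, arrays, hk])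
    have h1 := hcmp i hin
    have h2 := hkey i hin
    have hev : RAMExpr.eval s' (.lt (.read best (.read cmp (.reg 8)))
        (.add (.read key (.reg 8)) (.const 1))) =
        if s'.mem best (s.mem cmp i) < s.mem key i + 1 then 1 else 0 := by
      simp [RAMExpr.eval, hc', hk', hi]
    refine Ends.ite (fun h => ?_) (fun h => ?_)
    · have h3 : s'.mem best (s.mem cmp i) < s.mem key i + 1 := by
        by_contra h4; simp [hev, h4] at h
      refine Ends.seq (Ends.store ?_ ?_ (Ends.store ?_ ?_ ⟨?_, ?_, fun _ => ?_⟩))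
      · simpa [RAMExpr.eval, hc', hi] using h1
      · simpa [RAMExpr.eval, hk', hi] using h2
      · simpa [RAMExpr.eval, hc', hi, hc.1] using h1
      · simp [RAMExpr.eval, hi]; omega
      · simp [hi]
      · simp [RAMExpr.cost]
      · simp only [RAMExpr.eval, RAMState.setReg_mem, RAMState.setMem_mem, RAMState.setMem_reg,
          if_neg hbo, if_neg hbo.symm, if_neg hc.1, if_true, hc', hk', hi]
        refine ⟨fun k hk0 => ?_, fun x hx => ?_⟩
        · by_cases hki : k = s.mem cmp i
          · subst hki
            simp [hin]
          · simp only [Function.update_of_ne hki] at hk0 ⊢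
            exact hI k hk0
        · by_cases hxi : s.mem cmp x = s.mem cmp i
          · simp only [hxi, Function.update_self]
            rcases Nat.lt_succ_iff_lt_or_eq.1 hx with h4 | rfl
            · have := hJ x h4
              rw [hxi] at this
              omega
            · exact le_rfl
          · rw [Function.update_of_ne hxi]
            refine hJ x ?_
            rcases Nat.lt_succ_iff_lt_or_eq.1 hx with h4 | rfl
            · exact h4
            · exact absurd rfl hxi
    · have h3 : ¬ s'.mem best (s.mem cmp i) < s.mem key i + 1 := by
        intro h4; simp [hev, h4] at h
      refine Ends.skip ⟨hi, by simp [RAMExpr.cost], fun _ => ⟨by simpa using hI, fun x hx => ?_⟩⟩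
      rcases Nat.lt_succ_iff_lt_or_eq.1 hx with h4 | rfl
      · simpa using hJ x h4
      · simp only [RAMState.setReg_mem]
        omega
  · rintro τ s' hF ⟨hI, hJ⟩ hτ
    refine hQ τ s' (fun x hx => ?_) (by simp only [RAMExpr.cost] at hτ; omega)
    have h1 := hJ x hx
    obtain ⟨h2, h3, h4⟩ := hI (s.mem cmp x) (by omega)
    exact ⟨h2, h3, by omega⟩

end RAMProgram

/-! ### A complete search pass: distances, components and a row deepest in the last layer. -/

namespace RAMProgram

variable {W n m β : ℕ} {E : ℕ → ℕ → Prop} {s : RAMState} {Best : ℕ → ℕ → Prop}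
  {Q : ℕ → RAMState → Prop}

/-- Search all components from the rows in `l` and find in each component a row with the most
columns of the last layer. -/
def pass (β l : ℕ) : RAMProgram :=
  .seq (bfs β l) (.seq (fillSum (β + 6) (.reg 0) (.reg 1) (.mul (entry (.reg 2) (.reg 3))
    (.add (.mul (.eq (.read (β + 1) (.reg 3)) (.read (β + 5) (.read (β + 3) (.reg 2))))
      (.add (.reg 1) (.const 1))) (.const 1)))) (argMax (β + 3) (β + 6) (β + 7) (β + 8)))

theorem regs_pass (β l : ℕ) : (pass β l).regs =
    [5, 6, 7, 8, 9, 5, 10, 11, 12, 5, 12, 11, 6, 7, 8, 2, 4, 3, 4, 3, 2, 8, 8] := by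
  simp [pass, bfs, forTo, regs, bfsStart, regs_bfsQueue, fillSum, regs_fill, argMax]

theorem arrays_pass (β l : ℕ) : ∀ a ∈ (pass β l).arrays, β ≤ a ∧ a < β + 9 := by
  simp [pass, bfs, forTo, arrays, bfsStart, arrays_bfsQueue, fillSum, arrays_fill, argMax]

/-- Packs two counts into one number in base `m + 1`. As `rowDeg` is at most `m`, comparing these
numbers is the lexicographic comparison that `PassOut.out_max` asks for. -/
theorem sum_key (p : ℕ → Prop) (x : ℕ) [∀ c, Decidable (E x c)] [DecidablePred p] :
    ∑ c ∈ Finset.range m, (if E x c then 1 else 0) * ((if p c then 1 else 0) * (m + 1) + 1) =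
      rowCount m E p x * (m + 1) + rowDeg m E x := by
  rw [rowDeg, ← sum_eq_rowCount, ← sum_eq_rowCount, Finset.sum_mul, ← Finset.sum_add_distrib]
  refine Finset.sum_congr rfl fun c _ => ?_
  simp only [if_true]
  ring

theorem RowShare.symm {E : ℕ → ℕ → Prop} {x y : ℕ} (h : RowShare E x y) : RowShare E y x := by
  obtain ⟨c, h1, h2⟩ := h
  exact ⟨c, h2, h1⟩

theorem Ends.pass {l len : ℕ} (hW : n + 1 < W) (hmW : (m + 1) * (m + 1) < W) (hβ : 0 < β)
    (hin : HasInput n m E s) (hE : ∀ i j, E i j → i < n ∧ j < m)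
    (hzero : ∀ a, β ≤ a → s.mem a = fun _ => 0)
    (hl : l < β) (hlen : s.reg 13 = len) (hlenn : len ≤ n)
    (hln : ∀ p < len, s.mem l p < n)
    (hbest : ∀ p < len, ∀ y < n, (∀ p' < p, s.mem l p' ≠ y) → Best (s.mem l p) y)
    (hreach : ∀ x < n, ∃ p < len, Relation.ReflTransGen (RowShare E) (s.mem l p) x)
    (hQ : ∀ t s' K, s'.reg 7 = K →
      PassOut n m E Best (fun x => ∃ p < len, s.mem l p = x) (s'.mem β) (s'.mem (β + 1))
        (s'.mem (β + 3)) (s'.mem (β + 4)) (s'.mem (β + 5)) (s'.mem (β + 8)) K →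
      t ≤ 300 * ((n + 1) * (m + 1)) → Q t s') :
    (RAMProgram.pass β l).Ends W s Q := by
  classical
  have hm1 : m + 1 < W := by nlinarith
  refine Ends.seq ((Ends.bfs hW (by omega) hβ hin hE (fun a _ => hzero _ (by omega))
    (fun a _ => by omega) hlen (by omega) hln hbest (Q := fun t s' => ∃ b', BFSRep β s' b' ∧
      BFSInv E n Best (fun x => ∃ p < len, s.mem l p = x) b'.K (fun _ _ => False) b' ∧
      b'.head = b'.tail ∧ (∀ p < len, b'.rd (s.mem l p) ≠ 0) ∧
      t ≤ 20 + 60 * len + 50 * (n + 1) * m + 40 * (m + 1) * n)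
    fun t s' b' h1 h2 h3 h4 h5 => ⟨b', h1, h2, h3, h4, h5⟩).frame ?_)
  rintro t s' hr ha ⟨b, hrep, hinv, hht, hvis, ht⟩
  have hin' : HasInput n m E s' := by
    refine hin.congr (hr 0 ?_) (hr 1 ?_) (ha 0 ?_)
    · simp [RAMProgram.bfs, RAMProgram.forTo, regs, bfsStart, regs_bfsQueue]
    · simp [RAMProgram.bfs, RAMProgram.forTo, regs, bfsStart, regs_bfsQueue]
    · simp [RAMProgram.bfs, RAMProgram.forTo, arrays, bfsStart, arrays_bfsQueue]
      omega
  have hbest' : s'.mem (β + 7) = fun _ => 0 := by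
    rw [ha _ (by simp [RAMProgram.bfs, RAMProgram.forTo, arrays, bfsStart, arrays_bfsQueue])]
    exact hzero _ (by omega)
  have hall : ∀ x < n, b.rd x ≠ 0 := by
    intro x hx
    obtain ⟨p, hp, h1⟩ := hreach x hx
    exact hinv.visited_of_reach hht h1 (hvis p hp)
  have hbound : ∀ x, rowCount m E (fun c => b.cd c = b.Dm (b.cmp x)) x * (m + 1) + rowDeg m E x <
      (m + 1) * (m + 1) := by
    intro x
    have h1 := rowCount_le (m := m) E (fun c => b.cd c = b.Dm (b.cmp x)) x
    have h2 := rowCount_le (m := m) E (fun _ => True) x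
    simp only [rowDeg]
    nlinarith
  refine Ends.seq (Ends.fillSum n m (fun x c => (if E x c then 1 else 0) *
    ((if b.cd c = b.Dm (b.cmp x) then 1 else 0) * (m + 1) + 1)) (by omega) (by omega) ?_ ?_ ?_ ?_ ?_)
  · intro s₁ h1
    simp [RAMExpr.eval, h1.1, hin'.rows]
  · intro s₁ h1
    simp [RAMExpr.eval, h1.1, hin'.cols]
  · intro s₁ h1 h2 h3
    have hin₁ : HasInput n m E s₁ := hin'.congr (h1.1 0 (by simp) (by simp) (by simp))
      (h1.1 1 (by simp) (by simp) (by simp)) (h1.2 0 (by omega))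
    have e1 := hin₁.eval_entry (i := .reg 2) (j := .reg 3) rfl rfl h2 h3
    have e2 : s₁.mem (β + 1) = b.cd := by rw [h1.2 _ (by omega), hrep.cd]
    have e3 : s₁.mem (β + 3) = b.cmp := by rw [h1.2 _ (by omega), hrep.cmp]
    have e5 : s₁.mem (β + 5) = b.Dm := by rw [h1.2 _ (by omega), hrep.Dm]
    simp only [RAMExpr.eval, e1, e2, e3, e5, hin₁.cols]
    congr!
  · intro x _
    rw [sum_key]
    exact (hbound x).trans hmW
  · intro t₁ s₁ h1 h2 _ ht₁
    have e1 : s₁.mem (β + 3) = b.cmp := by rw [h1.2 _ (by omega), hrep.cmp]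
    have e2 : ∀ x < n, s₁.mem (β + 6) x =
        rowCount m E (fun c => b.cd c = b.Dm (b.cmp x)) x * (m + 1) + rowDeg m E x := by
      intro x hx
      rw [h2 x hx, sum_key]
    have e3 : ∀ x < n, b.cmp x < n := fun x hx => (hinv.cmp_lt x (hall x hx)).trans_le hinv.comps_le
    refine (Ends.argMax (n := n) (s := s₁) (cmp := β + 3) (key := β + 6) (best := β + 7)
      (out := β + 8) (by omega) ⟨by omega, by omega⟩ ⟨by omega, by omega⟩ (by omega)
      ?_ ?_ ?_ ?_ (Q := fun t s' => (∀ x < n, s'.mem (β + 8) (s₁.mem (β + 3) x) < n ∧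
        s₁.mem (β + 3) (s'.mem (β + 8) (s₁.mem (β + 3) x)) = s₁.mem (β + 3) x ∧
        s₁.mem (β + 6) x ≤ s₁.mem (β + 6) (s'.mem (β + 8) (s₁.mem (β + 3) x))) ∧ t ≤ 40 * (n + 1))
      fun t s' h1 h2 => ⟨h1, h2⟩).frame ?_
    · rw [h1.1 0 (by simp) (by simp) (by simp), hin'.rows]
    · rw [h1.2 _ (by omega), hbest']
    · intro x hx
      rw [e1]
      have := e3 x hx
      omega
    · intro x hx
      have := hbound x
      rw [e2 x hx]
      omega
    · rintro t₂ s₂ hr₂ ha₂ ⟨h3, ht₂⟩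
      have f : ∀ a, a ≠ 7 → a ≠ 8 → a ≠ 6 → s₂.mem (β + a) = s'.mem (β + a) := by
        intro a h7 h8 h6
        rw [ha₂ _ (by simp [RAMProgram.argMax, RAMProgram.forTo, arrays]; omega), h1.2 _ (by omega)]
      refine hQ _ s₂ b.K ?_ ?_ ?_
      · rw [hr₂ 7 (by simp [RAMProgram.argMax, RAMProgram.forTo, regs]),
          h1.1 7 (by simp) (by simp) (by simp), hrep.K]
      · have f0 := f 0
        simp only [add_zero] at f0
        rw [f0, f 1, f 3, f 4, f 5, hrep.rd, hrep.cd, hrep.cmp, hrep.sd, hrep.Dm]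
        any_goals omega
        simp only [e1] at h3
        refine hinv.passOut hht hE hall ?_ ?_
        · intro k hk
          have h4 := hinv.seed k hk
          have h5 := h3 (b.sd k) h4.2.2.2
          rw [h4.2.1] at h5
          exact ⟨h5.1, h5.2.1⟩
        · intro x hx
          obtain ⟨h4, h5, h6⟩ := h3 x hx
          rw [e2 x hx, e2 _ h4, h5] at h6
          have h7 := rowCount_le (m := m) E (fun _ => True) x
          have h8 := rowCount_le (m := m) E (fun _ => True) (s₂.mem (β + 8) (b.cmp x))
          simp only [rowDeg] at *
          rcases lt_trichotomy (rowCount m E (fun c => b.cd c = b.Dm (b.cmp x)) x)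
            (rowCount m E (fun c => b.cd c = b.Dm (b.cmp x)) (s₂.mem (β + 8) (b.cmp x)))
            with h9 | h9 | h9
          · exact Or.inl h9
          · rw [h9] at h6
            exact Or.inr ⟨h9, by omega⟩
          · nlinarith
      · have : t₁ ≤ 60 * ((n + 1) * (m + 1)) :=
          ht₁.trans (Nat.mul_le_mul_right _ (by simp [RAMExpr.cost, entry]))
        nlinarith

end RAMProgram

namespace RAMProgram

variable {W n m b : ℕ} {E : ℕ → ℕ → Prop} {s : RAMState} {Q : ℕ → RAMState → Prop}

/-! ### Finding the core rows -/

theorem HasInput.fillFrame {s' : RAMState} {a : ℕ} (h : HasInput n m E s) (ha : 0 < a)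
    (hF : FillFrame a s s') : HasInput n m E s' :=
  h.congr (hF.1 0 (by simp) (by simp) (by simp)) (hF.1 1 (by simp) (by simp) (by simp))
    (hF.2 0 (by omega))

/-- The row `σ k` for the component `k` of the row in register `2`. -/
def rowOf (σ cmp : ℕ) : RAMExpr := .read σ (.read cmp (.reg 2))

/-- In array `b` the number of columns of a row `x` outside `s`, in array `b + 1` a value that
is positive for the columns of rows that are not below `s` and of `e`, and in array `b + 2` the
number of such columns of `s` that are not in `x`, where `s` and `e` are the entries of `σ` and `τ`
for the component of `x`. -/
def markCore (cmp σ τ b : ℕ) : RAMProgram :=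
  .seq (fillSum b (.reg 0) (.reg 1) (.mul (entry (.reg 2) (.reg 3))
      (.sub (.const 1) (entry (rowOf σ cmp) (.reg 3)))))
    (.seq (fillSum (b + 1) (.reg 1) (.reg 0) (.mul (entry (.reg 3) (.reg 2))
      (.add (.read b (.reg 3)) (.eq (.reg 3) (.read τ (.read cmp (.reg 3)))))))
    (fillSum (b + 2) (.reg 0) (.reg 1) (.mul (.mul (entry (rowOf σ cmp) (.reg 3))
      (.lt (.const 0) (.read (b + 1) (.reg 3)))) (.sub (.const 1) (entry (.reg 2) (.reg 3))))))

/-- Quantifiers become sums: containment in `s` means that the number of columns outside is zero,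
and an existential condition means that a sum is positive. Three double sums decide `IsCore` for all
rows. -/
theorem Ends.markCore {cmp σ τ : ℕ} (hW : (n + 1) * (m + 1) < W) (hin : HasInput n m E s)
    (hE : ∀ i j, E i j → i < n ∧ j < m) (hb : 0 < b)
    (hcb : cmp < b) (hσb : σ < b) (hτb : τ < b)
    (hσ : ∀ x < n, s.mem σ (s.mem cmp x) < n ∧ s.mem cmp (s.mem σ (s.mem cmp x)) = s.mem cmp x)
    (hshare : ∀ x y c, E x c → E y c → s.mem cmp x = s.mem cmp y)
    (hQ : ∀ t s', (∀ x < n, (s'.mem b x = 0 ∧ s'.mem (b + 2) x ≠ 0) ↔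
      ¬ IsCore E (s.mem σ (s.mem cmp x)) (s.mem τ (s.mem cmp x)) x) →
      t ≤ 200 * ((n + 1) * (m + 1)) → Q t s') : (markCore cmp σ τ b).Ends W s Q := by
  classical
  have hnW : n < W := by nlinarith
  have hmW : m < W := by nlinarith
  have hle2 : ∀ x c y, (if E x c then 1 else 0) * (1 - if E y c then 1 else 0) ≤ 1 := by
    intro x c y
    split_ifs <;> simp
  have hS_le : ∀ x, ∑ c ∈ Finset.range m, (if E x c then 1 else 0) *
      (1 - if E (s.mem σ (s.mem cmp x)) c then 1 else 0) ≤ m := by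
    intro x
    refine (Finset.sum_le_card_nsmul _ _ 1 fun c _ => hle2 _ _ _).trans ?_
    simp
  refine Ends.seq (Ends.fillSum n m (fun x c => (if E x c then 1 else 0) *
    (1 - if E (s.mem σ (s.mem cmp x)) c then 1 else 0)) hnW hmW
    (fun s' h => (hin.fillFrame hb h).rows) (fun s' h => (hin.fillFrame hb h).cols) ?_
    (fun x _ => (hS_le x).trans_lt hmW) ?_)
  · intro s' h h2 h3
    have hin' := hin.fillFrame hb h
    have e1 := hin'.eval_entry (i := .reg 2) (j := .reg 3) rfl rfl h2 h3
    have e2 : (rowOf σ cmp).eval s' = s.mem σ (s.mem cmp (s'.reg 2)) := by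
      simp only [rowOf, RAMExpr.eval]
      rw [h.2 σ (by omega), h.2 cmp (by omega)]
    have e3 := hin'.eval_entry (j := .reg 3) e2 rfl (hσ _ h2).1 h3
    simp only [RAMExpr.eval, e1, e3]
    congr!
  intro t₁ s₁ hF₁ hS _ ht₁
  have hin₁ := hin.fillFrame hb hF₁
  have hc₁ : s₁.mem cmp = s.mem cmp := hF₁.2 _ (by omega)
  have hσ₁ : s₁.mem σ = s.mem σ := hF₁.2 _ (by omega)
  have hτ₁ : s₁.mem τ = s.mem τ := hF₁.2 _ (by omega)
  have hS_le' : ∀ x < n, s₁.mem b x ≤ m := fun x hx => by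
    rw [hS x hx]
    exact hS_le x
  refine Ends.seq (Ends.fillSum m n (fun c z => (if E z c then 1 else 0) *
    (s₁.mem b z + if z = s.mem τ (s.mem cmp z) then 1 else 0)) hmW hnW
    (fun s' h => (hin₁.fillFrame (by omega) h).cols)
    (fun s' h => (hin₁.fillFrame (by omega) h).rows) ?_ ?_ ?_)
  · intro s' h h2 h3
    have hin' := hin₁.fillFrame (by omega) h
    have e1 := hin'.eval_entry (i := .reg 3) (j := .reg 2) rfl rfl h3 h2
    have e2 : s'.mem b = s₁.mem b := h.2 _ (by omega)
    have e3 : s'.mem τ = s.mem τ := by rw [h.2 _ (by omega), hτ₁]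
    have e4 : s'.mem cmp = s.mem cmp := by rw [h.2 _ (by omega), hc₁]
    simp only [RAMExpr.eval, e1, e2, e3, e4]
    congr!
  · intro c _
    refine (Finset.sum_le_card_nsmul _ _ (m + 1) fun z hz => ?_).trans_lt ?_
    · have h1 := hS_le' z (by simpa using hz)
      split_ifs <;> omega
    · simp only [Finset.card_range, smul_eq_mul]
      nlinarith
  intro t₂ s₂ hF₂ hI _ ht₂
  have hin₂ := hin₁.fillFrame (by omega) hF₂
  have hc₂ : s₂.mem cmp = s.mem cmp := by rw [hF₂.2 _ (by omega), hc₁]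
  have hσ₂ : s₂.mem σ = s.mem σ := by rw [hF₂.2 _ (by omega), hσ₁]
  refine Ends.fillSum n m (fun x c => ((if E (s.mem σ (s.mem cmp x)) c then 1 else 0) *
    (if 0 < s₂.mem (b + 1) c then 1 else 0)) * (1 - if E x c then 1 else 0)) hnW hmW
    (fun s' h => (hin₂.fillFrame (by omega) h).rows)
    (fun s' h => (hin₂.fillFrame (by omega) h).cols) ?_ ?_ ?_
  · intro s' h h2 h3
    have hin' := hin₂.fillFrame (by omega) h
    have e1 := hin'.eval_entry (i := .reg 2) (j := .reg 3) rfl rfl h2 h3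
    have e2 : (rowOf σ cmp).eval s' = s.mem σ (s.mem cmp (s'.reg 2)) := by
      simp only [rowOf, RAMExpr.eval]
      rw [h.2 σ (by omega), h.2 cmp (by omega), hσ₂, hc₂]
    have e3 := hin'.eval_entry (j := .reg 3) e2 rfl (hσ _ h2).1 h3
    have e4 : s'.mem (b + 1) = s₂.mem (b + 1) := h.2 _ (by omega)
    simp only [RAMExpr.eval, e1, e3, e4]
    congr!
  · intro x _
    refine (Finset.sum_le_card_nsmul _ _ 1 fun c _ => ?_).trans_lt ?_
    · split_ifs <;> simp
    · simpa using hmW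
  intro t₃ s₃ hF₃ hV _ ht₃
  refine hQ _ s₃ (fun x hx => ?_) ?_
  · have hS0 : ∀ z < n, s₁.mem b z = 0 ↔ RowSub E z (s.mem σ (s.mem cmp z)) := by
      intro z hz
      rw [hS z hz, Finset.sum_eq_zero_iff]
      constructor
      · intro h c hc
        have := h c (by simpa using (hE z c hc).2)
        by_contra h1
        simp [hc, h1] at this
      · intro h c _
        by_cases h1 : E z c
        · simp [h c h1]
        · simp [h1]
    have hI0 : ∀ c < m, 0 < s₂.mem (b + 1) c ↔ ∃ z, E z c ∧
        (¬ RowSub E z (s.mem σ (s.mem cmp z)) ∨ z = s.mem τ (s.mem cmp z)) := by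
      intro c hc
      rw [hI c hc, Finset.sum_pos_iff]
      constructor
      · rintro ⟨z, hz, h⟩
        simp only [Finset.mem_range] at hz
        have h1 : E z c := by by_contra h1; simp [h1] at h
        refine ⟨z, h1, ?_⟩
        by_contra h2
        simp only [not_or, not_not] at h2
        rw [(hS0 z hz).2 h2.1, if_neg h2.2] at h
        simp at h
      · rintro ⟨z, h1, h2⟩
        have hz := (hE z c h1).1
        refine ⟨z, by simpa using hz, ?_⟩
        rw [if_pos h1, one_mul]
        rcases h2 with h2 | h2
        · rw [← hS0 z hz] at h2
          omega
        · rw [if_pos h2]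
          omega
    have hV0 : s₃.mem (b + 2) x ≠ 0 ↔ ∃ c, E (s.mem σ (s.mem cmp x)) c ∧
        0 < s₂.mem (b + 1) c ∧ ¬ E x c := by
      rw [hV x hx, ← Nat.pos_iff_ne_zero, Finset.sum_pos_iff]
      constructor
      · rintro ⟨c, -, h⟩
        refine ⟨c, ?_, ?_, ?_⟩ <;> by_contra h1 <;> simp [h1] at h
      · rintro ⟨c, h1, h2, h3⟩
        exact ⟨c, by simpa using (hE _ _ h1).2, by simp [h1, h2, h3]⟩
    rw [hV0, hF₃.2 b (by omega), hF₂.2 b (by omega), hS0 x hx, IsCore]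
    simp only [not_or, not_not, not_forall]
    refine and_congr_right fun _ => exists_congr fun c => ?_
    constructor
    · rintro ⟨h1, h2, h3⟩
      obtain ⟨z, h4, h5⟩ := (hI0 c (hE _ _ h1).2).1 h2
      -- The array `b + 1` was computed with the ends of the component of `z`; as `z` shares a
      -- column with `s`, these are the ends belonging to `x`.
      have h6 : s.mem cmp z = s.mem cmp x := by rw [hshare _ _ c h4 h1, (hσ x hx).2]
      rw [h6] at h5
      exact ⟨h1, ⟨z, h4, h5⟩, h3⟩
    · rintro ⟨h1, ⟨z, h4, h5⟩, h3⟩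
      have h6 : s.mem cmp z = s.mem cmp x := by rw [hshare _ _ c h4 h1, (hσ x hx).2]
      rw [← h6] at h5
      exact ⟨h1, (hI0 c (hE _ _ h1).2).2 ⟨z, h4, h5⟩, h3⟩
  · have h1 : t₁ ≤ 60 * ((n + 1) * (m + 1)) :=
      ht₁.trans (Nat.mul_le_mul_right _ (by simp [RAMExpr.cost, entry, rowOf]))
    have h2 : t₂ ≤ 60 * ((m + 1) * (n + 1)) :=
      ht₂.trans (Nat.mul_le_mul_right _ (by simp [RAMExpr.cost, entry]))
    have h3 : t₃ ≤ 60 * ((n + 1) * (m + 1)) :=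
      ht₃.trans (Nat.mul_le_mul_right _ (by simp [RAMExpr.cost, entry, rowOf]))
    rw [mul_comm (m + 1)] at h2
    omega

/-- Mark the core rows by `1` in array `b + 6`, and let array `b + 7` be the identity. -/
def initClasses (b : ℕ) : RAMProgram :=
  .seq (fillSum (b + 6) (.reg 0) (.const 1) (.mul
    (.sub (.const 1) (.mul (.eq (.read b (.reg 2)) (.const 0))
      (.lt (.const 0) (.read (b + 2) (.reg 2)))))
    (.sub (.const 1) (.mul (.eq (.read (b + 3) (.reg 2)) (.const 0))
      (.lt (.const 0) (.read (b + 5) (.reg 2)))))))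
    (fillSum (b + 7) (.reg 0) (.const 1) (.reg 2))

open Classical in
theorem Ends.initClasses (hb : 0 < b) (hn : n + 1 < W) (hin : HasInput n m E s)
    (C₁ C₂ : ℕ → Prop) (h₁ : ∀ x < n, (s.mem b x = 0 ∧ s.mem (b + 2) x ≠ 0) ↔ ¬ C₁ x)
    (h₂ : ∀ x < n, (s.mem (b + 3) x = 0 ∧ s.mem (b + 5) x ≠ 0) ↔ ¬ C₂ x)
    (hQ : ∀ t s', (∀ x < n, s'.mem (b + 6) x = if C₁ x ∧ C₂ x then 1 else 0) →
      (∀ x < n, s'.mem (b + 7) x = x) → t ≤ 200 * ((n + 1) * (m + 1)) → Q t s') :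
    (initClasses b).Ends W s Q := by
  refine Ends.seq (Ends.fillSum n 1 (fun x _ => if C₁ x ∧ C₂ x then 1 else 0) (by omega)
    (by omega) (fun s' h => (hin.fillFrame (by omega) h).rows) (fun s' h => rfl) ?_ ?_ ?_)
  · intro s' h h2 h3
    have e0 : s'.mem b = s.mem b := h.2 _ (by omega)
    have e2 : s'.mem (b + 2) = s.mem (b + 2) := h.2 _ (by omega)
    have e3 : s'.mem (b + 3) = s.mem (b + 3) := h.2 _ (by omega)
    have e5 : s'.mem (b + 5) = s.mem (b + 5) := h.2 _ (by omega)
    have h4 := h₁ _ h2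
    have h5 := h₂ _ h2
    simp only [RAMExpr.eval, e0, e2, e3, e5]
    by_cases c1 : C₁ (s'.reg 2) <;> by_cases c2 : C₂ (s'.reg 2) <;>
      simp [c1, c2] at h4 h5 ⊢ <;> grind
  · intro x _
    simp only [Finset.range_one, Finset.sum_singleton]
    split_ifs <;> omega
  · intro t₁ s₁ hF₁ h6 _ ht₁
    refine Ends.fillSum n 1 (fun x _ => x) (by omega) (by omega)
      (fun s' h => ((hin.fillFrame (by omega) hF₁).fillFrame (by omega) h).rows) (fun s' h => rfl)
      (fun s' h h2 h3 => rfl) (fun x hx => by simp; omega) ?_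
    intro t₂ s₂ hF₂ h7 _ ht₂
    refine hQ _ s₂ (fun x hx => ?_) (fun x hx => by simp [h7 x hx]) ?_
    · rw [hF₂.2 _ (by omega), h6 x hx]
      simp
    · simp [RAMExpr.cost] at ht₁ ht₂
      nlinarith

end RAMProgram

namespace RAMProgram

variable {W n m : ℕ} {E : ℕ → ℕ → Prop} {s : RAMState} {Q : ℕ → RAMState → Prop}

/-! ### Splitting the other rows -/

/-- The state `s` represents `st`. -/
structure SplitRep (s : RAMState) (st : SplitState) : Prop where
  t₁ : s.mem 24 = st.t₁
  t₂ : s.mem 28 = st.t₂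
  pd : s.mem 38 = st.pd
  gr : s.mem 37 = st.gr
  gcol : s.mem 36 = st.gcol

/-- Assign the row in register `9` of the component in register `10`. -/
def splitRow : RAMProgram :=
  .ite (.read 38 (.reg 10))
    (.ite (.read 40 (.const 0))
      (.ite (.read 40 (.const 2))
        (.seq (.store 24 (.reg 10) (.reg 9)) (.seq (.store 28 (.reg 10) (.reg 11))
          (.seq (.store 38 (.reg 10) (.const 0)) (.store 36 (.read 37 (.reg 11)) (.const 2)))))
        (.seq (.store 24 (.reg 10) (.reg 11)) (.seq (.store 28 (.reg 10) (.reg 9))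
          (.seq (.store 38 (.reg 10) (.const 0)) (.store 36 (.reg 9) (.const 2))))))
      (.seq (.store 38 (.reg 10) (.add (.reg 9) (.const 1)))
        (.store 37 (.reg 9) (.read 37 (.reg 11)))))
    (.ite (.read 40 (.const 1))
      (.seq (.store 28 (.reg 10) (.reg 9)) (.store 36 (.reg 9) (.const 2)))
      (.ite (.read 40 (.const 2)) (.store 24 (.reg 10) (.reg 9))
        (.store 38 (.reg 10) (.add (.reg 9) (.const 1)))))

theorem Ends.splitRow {st : SplitState} {k y : ℕ} (hrep : SplitRep s st) (hk : s.reg 10 = k)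
    (hy : s.reg 9 = y) (hp : s.reg 11 = st.pd k - 1) (h2 : 2 < W) (hkW : k < W) (hyW : y + 1 < W)
    (hpW : st.pd k - 1 < W) (hgW : st.pd k ≠ 0 → st.gr (st.pd k - 1) < W)
    (t0 : s.mem 40 0 = 0 ↔ RowSub E y (st.pd k - 1)) (t1 : s.mem 40 1 = 0 ↔ RowSub E y (st.t₁ k))
    (t2 : s.mem 40 2 = 0 ↔ RowSub E y (st.t₂ k))
    (hQ : ∀ t s', SplitRep s' (st.step E k y) → t ≤ 50 → Q t s') : splitRow.Ends W s Q := by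
  obtain ⟨e1, e2, e3, e4, e5⟩ := hrep
  refine Ends.ite (fun h => Ends.ite (fun h' => Ends.ite (fun h'' => ?_) (fun h'' => ?_))
    (fun h' => ?_)) (fun h => Ends.ite (fun h' => ?_) (fun h' => Ends.ite (fun h'' => ?_)
    (fun h'' => ?_)))
  all_goals simp only [RAMExpr.eval, e3, hk] at h h'
  all_goals try simp only [RAMExpr.eval] at h''
  all_goals try rw [t0] at h'
  all_goals try rw [Ne, t0] at h'
  all_goals try rw [t1] at h'
  all_goals try rw [Ne, t1] at h'
  all_goals try rw [t2] at h''
  all_goals try rw [Ne, t2] at h''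
  · have hg := hgW h
    refine Ends.seq (Ends.store ?_ ?_ (Ends.seq (Ends.store ?_ ?_ (Ends.seq (Ends.store ?_ ?_
      (Ends.store ?_ ?_ (hQ _ _ ⟨?_, ?_, ?_, ?_, ?_⟩ ?_)))))))
    all_goals simp [RAMExpr.eval, RAMExpr.cost, SplitState.step, h, h', h'', e1, e2, e3, e4, e5, hk,
      hy, hp]
    all_goals omega
  · have hg := hgW h
    refine Ends.seq (Ends.store ?_ ?_ (Ends.seq (Ends.store ?_ ?_ (Ends.seq (Ends.store ?_ ?_
      (Ends.store ?_ ?_ (hQ _ _ ⟨?_, ?_, ?_, ?_, ?_⟩ ?_)))))))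
    all_goals simp [RAMExpr.eval, RAMExpr.cost, SplitState.step, h, h', h'', e1, e2, e3, e4, e5, hk,
      hy, hp]
    all_goals omega
  · have hg := hgW h
    refine Ends.seq (Ends.store ?_ ?_ (Ends.store ?_ ?_ (hQ _ _ ⟨?_, ?_, ?_, ?_, ?_⟩ ?_)))
    all_goals simp [RAMExpr.eval, RAMExpr.cost, SplitState.step, h, h', e1, e2, e3, e4, e5, hk,
      hy, hp]
    all_goals omega
  · refine Ends.seq (Ends.store ?_ ?_ (Ends.store ?_ ?_ (hQ _ _ ⟨?_, ?_, ?_, ?_, ?_⟩ ?_)))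
    all_goals simp [RAMExpr.eval, RAMExpr.cost, SplitState.step, h, h', e1, e2, e3, e4, e5, hk, hy]
    all_goals omega
  · refine Ends.store ?_ ?_ (hQ _ _ ⟨?_, ?_, ?_, ?_, ?_⟩ ?_)
    all_goals simp [RAMExpr.eval, RAMExpr.cost, SplitState.step, h, h', h'', e1, e2, e3, e4, e5, hk,
      hy]
    all_goals omega
  · refine Ends.store ?_ ?_ (hQ _ _ ⟨?_, ?_, ?_, ?_, ?_⟩ ?_)
    all_goals simp [RAMExpr.eval, RAMExpr.cost, SplitState.step, h, h', h'', e1, e2, e3, e4, e5, hk,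
      hy]
    all_goals omega

/-- Compare the row in register `9` with the last rows of the chains of its component. -/
def compareRow : RAMProgram :=
  .seq (.store 39 (.const 0) (.reg 11)) (.seq (.store 39 (.const 1) (.read 24 (.reg 10)))
    (.seq (.store 39 (.const 2) (.read 28 (.reg 10))) (fillSum 40 (.const 3) (.reg 1)
      (.mul (entry (.reg 9) (.reg 3)) (.sub (.const 1) (entry (.read 39 (.reg 2)) (.reg 3)))))))

/-- Cells `0`, `1`, `2` of array `40` count the columns of `y` missing from the pending row and from
the two chain ends, so each containment test costs time linear in `m`. -/
theorem Ends.compareRow {k y p q r : ℕ} (hin : HasInput n m E s) (hE : ∀ i j, E i j → i < n ∧ j < m)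
    (hk : s.reg 10 = k) (hy : s.reg 9 = y) (hyn : y < n) (hp : s.reg 11 = p) (hpn : p < n)
    (hq : s.mem 24 k = q) (hqn : q < n) (hr : s.mem 28 k = r) (hrn : r < n) (hn : n < W)
    (hm : m < W) (hW : 3 < W)
    (hQ : ∀ t s', (s'.mem 40 0 = 0 ↔ RowSub E y p) → (s'.mem 40 1 = 0 ↔ RowSub E y q) →
      (s'.mem 40 2 = 0 ↔ RowSub E y r) → t ≤ 250 * (m + 1) → Q t s') : compareRow.Ends W s Q := by
  classical
  refine Ends.seq (Ends.store ?_ ?_ (Ends.seq (Ends.store ?_ ?_ (Ends.seq (Ends.store ?_ ?_ ?_)))))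
  any_goals simp [RAMExpr.eval, hp, hk, hq, hr]; omega
  set s₁ := ((s.setMem 39 _ _).setMem 39 _ _).setMem 39 _ _ with hs₁
  have hin₁ : HasInput n m E s₁ := hin.congr (by simp [hs₁]) (by simp [hs₁]) (by simp [hs₁])
  have h0 : s₁.mem 39 0 = p := by simp [hs₁, RAMExpr.eval, hp]
  have h1 : s₁.mem 39 1 = q := by simp [hs₁, RAMExpr.eval, hk, hq]
  have h2 : s₁.mem 39 2 = r := by simp [hs₁, RAMExpr.eval, hk, hr]
  have h9 : s₁.reg 9 = y := by simp [hs₁, hy]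
  have hlt : ∀ i < 3, s₁.mem 39 i < n := by
    intro i hi
    interval_cases i
    · rwa [h0]
    · rwa [h1]
    · rwa [h2]
  refine Ends.fillSum 3 m (fun i c => (if E y c then 1 else 0) *
    (1 - if E (s₁.mem 39 i) c then 1 else 0)) hW hm (fun _ _ => rfl)
    (fun s' h => (hin₁.fillFrame (by omega) h).cols) ?_ ?_ ?_
  · intro s' h h3 h4
    have hin' := hin₁.fillFrame (by omega) h
    have e39 : s'.mem 39 = s₁.mem 39 := h.2 _ (by omega)
    have e1 := hin'.eval_entry (i := .reg 9) (j := .reg 3) (x := y)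
      (by simp only [RAMExpr.eval]; rw [h.1 9 (by simp) (by simp) (by simp), h9]) rfl hyn h4
    have e2 := hin'.eval_entry (i := .read 39 (.reg 2)) (j := .reg 3) (x := s₁.mem 39 (s'.reg 2))
      (by simp only [RAMExpr.eval, e39]) rfl (hlt _ h3) h4
    simp only [RAMExpr.eval, e1, e2]
    congr!
  · intro i _
    refine (Finset.sum_le_card_nsmul _ _ 1 fun c _ => ?_).trans_lt ?_
    · split_ifs <;> simp
    · simpa using hm
  · intro t s' hF hS _ ht
    have key : ∀ i < 3, s'.mem 40 i = 0 ↔ RowSub E y (s₁.mem 39 i) := by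
      intro i hi
      rw [hS i hi, Finset.sum_eq_zero_iff]
      constructor
      · intro h c hc
        have := h c (by simpa using (hE y c hc).2)
        by_contra h1
        simp [hc, h1] at this
      · intro h c _
        by_cases h1 : E y c
        · simp [h c h1]
        · simp [h1]
    refine hQ _ s' ?_ ?_ ?_ ?_
    · rw [key 0 (by omega), h0]
    · rw [key 1 (by omega), h1]
    · rw [key 2 (by omega), h2]
    · simp only [RAMExpr.cost, entry] at ht ⊢
      omega

/-- Assign all rows that are not marked by `1`. -/
def splitRows : RAMProgram :=
  forTo 8 (.reg 0) (.seq (.assign 9 (.read 8 (.reg 8)))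
    (.ite (.eq (.read 36 (.reg 9)) (.const 1)) .skip
      (.seq (.assign 10 (.read 23 (.reg 9))) (.seq (.assign 11 (.sub (.read 38 (.reg 10)) (.const 1)))
        (.seq compareRow splitRow)))))

end RAMProgram

theorem SplitState.step_of_core {E : ℕ → ℕ → Prop} {k x y : ℕ} {st : SplitState} (hxy : x ≠ y)
    (hg : st.pd k ≠ 0 → st.gr (st.pd k - 1) ≠ x) :
    (st.step E k y).gcol x = st.gcol x ∧ (st.step E k y).gr x = st.gr x := by
  simp only [SplitState.step]
  split_ifs <;> simp only [Function.update_apply] <;> grind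

theorem SplitState.step_lt {E : ℕ → ℕ → Prop} {k k' y n : ℕ} {st : SplitState} (hy : y < n)
    (hp : st.pd k ≠ 0 → st.pd k - 1 < n) (h : st.t₁ k' < n ∧ st.t₂ k' < n) :
    (st.step E k y).t₁ k' < n ∧ (st.step E k y).t₂ k' < n := by
  simp only [SplitState.step]
  split_ifs <;> simp only [Function.update_apply] <;> grind

/-- The invariant when the first `p` rows have been assigned. -/
structure SplitAll (n m : ℕ) (E : ℕ → ℕ → Prop) (o cmp sd out : ℕ → ℕ) (K p : ℕ)
    (st : SplitState) : Prop where
  inv : ∀ k < K, SplitInv E (sd k) (out k) (sideRows n E cmp sd out k) k (fun x => ∃ q < p, o q = x)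
    st
  core : ∀ x < n, x ∉ sideRows n E cmp sd out (cmp x) → st.gcol x = 1 ∧ st.gr x = x
  lt : ∀ k < K, st.t₁ k < n ∧ st.t₂ k < n

namespace SplitAll

variable {n m K p : ℕ} {E : ℕ → ℕ → Prop} {o cmp sd out : ℕ → ℕ} {st : SplitState}

theorem mem_iff (h : SplitAll n m E o cmp sd out K p st) (hK : ∀ x < n, cmp x < K) {x : ℕ}
    (hx : x < n) : x ∈ sideRows n E cmp sd out (cmp x) ↔ st.gcol x ≠ 1 := by
  constructor
  · intro h1
    have := (h.inv _ (hK x hx)).col x h1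
    omega
  · intro h1
    by_contra h2
    exact h1 (h.core x hx h2).1

theorem skip (h : SplitAll n m E o cmp sd out K p st) (hK : ∀ x < n, cmp x < K) (hp : o p < n)
    (h1 : st.gcol (o p) = 1) : SplitAll n m E o cmp sd out K (p + 1) st := by
  refine ⟨fun k hk => (h.inv k hk).congr (fun x hx => ?_) rfl rfl rfl (fun _ _ => rfl)
    (fun _ _ => rfl), h.core, h.lt⟩
  constructor
  · rintro ⟨q, hq, rfl⟩
    rcases Nat.lt_succ_iff_lt_or_eq.1 hq with hq | rfl
    · exact ⟨q, hq, rfl⟩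
    · rw [← hx.1.2] at hx
      exact absurd h1 ((h.mem_iff hK hp).1 hx)
  · rintro ⟨q, hq, rfl⟩
    exact ⟨q, by omega, rfl⟩

theorem step (h : SplitAll n m E o cmp sd out K p st) (hm : ∀ x c, E x c → c < m)
    (ho : RAMProgram.IsRowOrder n m E o) (hK : ∀ x < n, cmp x < K) (hp : p < n)
    (h1 : st.gcol (o p) ≠ 1) :
    SplitAll n m E o cmp sd out K (p + 1) (st.step E (cmp (o p)) (o p)) := by
  have hy := ho.lt p hp
  have hyN := (h.mem_iff hK hy).2 h1
  have hD : ∀ x, (∃ q < p + 1, o q = x) ↔ (∃ q < p, o q = x) ∨ x = o p := by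
    intro x
    constructor
    · rintro ⟨q, hq, rfl⟩
      rcases Nat.lt_succ_iff_lt_or_eq.1 hq with hq | rfl
      · exact Or.inl ⟨q, hq, rfl⟩
      · exact Or.inr rfl
    · rintro (⟨q, hq, rfl⟩ | rfl)
      · exact ⟨q, by omega, rfl⟩
      · exact ⟨p, by omega, rfl⟩
  have hI := h.inv _ (hK _ hy)
  have hg : st.pd (cmp (o p)) ≠ 0 → st.gr (st.pd (cmp (o p)) - 1) ∈
      sideRows n E cmp sd out (cmp (o p)) := fun h2 => hI.gr_mem _ (hI.pd_mem h2).1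
  refine ⟨fun k hk => ?_, fun x hx hxN => ?_, fun k hk => ?_⟩
  · simp only [hD]
    by_cases hkp : cmp (o p) = k
    · subst hkp
      refine (h.inv _ hk).step hm hyN ?_ ?_ ?_
      · rintro ⟨q, hq, h2⟩
        have := ho.inj q (by omega) p hp h2
        omega
      · rintro x - ⟨q, hq, rfl⟩
        exact ho.anti q p (by omega) hp
      · rintro x hx h2
        obtain ⟨q, hq, rfl⟩ := ho.surj x hx.1.1
        exact ho.anti p q (by by_contra h3; exact h2 ⟨q, by omega, rfl⟩) hq
    · exact (h.inv k hk).step_of_ne hkp (fun h2 => hkp h2.1.2) fun h2 h3 =>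
        hkp ((hg h2).1.2.symm.trans h3.1.2)
  · have h2 := SplitState.step_of_core (E := E) (k := cmp (o p)) (x := x) (y := o p) (st := st)
      (by rintro rfl; exact hxN hyN) (by
        intro h2 h3
        have h4 := hg h2
        rw [h3] at h4
        have h5 := h4.1.2
        rw [h5] at hxN
        exact hxN h4)
    rw [h2.1, h2.2]
    exact h.core x hx hxN
  · exact SplitState.step_lt hy (fun h2 => (hI.pd_mem h2).1.1.1) (h.lt k hk)

theorem finish (h : SplitAll n m E o cmp sd out K n st) (ho : RAMProgram.IsRowOrder n m E o)
    (hK : ∀ x < n, cmp x < K) {cls : ℕ → ℕ} (hcls : ∀ x < n, cls x = st.gcol (st.gr x)) :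
    (∀ x < n, cls x ≤ 2) ∧ (∀ x < n, cls x = 1 ↔
      IsCore E (sd (cmp x)) (out (cmp x)) x ∧ IsCore E (out (cmp x)) (sd (cmp x)) x) ∧
    ∀ k < K, (∀ x ∈ compRows n cmp k, cls x = 0 → RowSub E x (sd k)) ∧
      (∀ x ∈ compRows n cmp k, cls x = 2 → RowSub E x (out k)) ∧
      (∀ x ∈ compRows n cmp k, ∀ y ∈ compRows n cmp k, cls x ≠ 1 → cls x = cls y →
        RowSub E x y ∨ RowSub E y x) := by
  have h1 : ∀ x < n, x ∈ sideRows n E cmp sd out (cmp x) → cls x = 0 ∨ cls x = 2 := by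
    intro x hx hxN
    have hI := h.inv _ (hK x hx)
    rw [hcls x hx]
    exact hI.col _ (hI.gr_mem x hxN)
  have h2 : ∀ x < n, x ∉ sideRows n E cmp sd out (cmp x) → cls x = 1 := by
    intro x hx hxN
    obtain ⟨h2, h3⟩ := h.core x hx hxN
    rw [hcls x hx, h3, h2]
  have h3 : ∀ x < n, cls x ≠ 1 → x ∈ sideRows n E cmp sd out (cmp x) := fun x hx h3 => by
    by_contra h4
    exact h3 (h2 x hx h4)
  refine ⟨fun x hx => ?_, fun x hx => ?_, fun k hk => ?_⟩
  · by_cases hxN : x ∈ sideRows n E cmp sd out (cmp x)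
    · rcases h1 x hx hxN with h | h <;> omega
    · rw [h2 x hx hxN]
      omega
  · constructor
    · intro h4
      by_contra h5
      rcases h1 x hx ⟨⟨hx, rfl⟩, h5⟩ with h | h <;> omega
    · intro h4
      exact h2 x hx fun h5 => h5.2 h4
  · obtain ⟨h4, h5, h6⟩ := (h.inv k hk).finish fun x hx => ho.surj x hx.1.1
    have h7 : ∀ x ∈ compRows n cmp k, cls x ≠ 1 → x ∈ sideRows n E cmp sd out k := by
      rintro x ⟨hx, rfl⟩ h8
      exact h3 x hx h8
    refine ⟨fun x hx h8 => h4 x (h7 x hx (by omega)) ?_, fun x hx h8 => h5 x (h7 x hx (by omega)) ?_,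
      fun x hx y hy h8 h9 => h6 x (h7 x hx h8) y (h7 y hy (h9 ▸ h8)) ?_⟩
    · rw [← hcls x hx.1, h8]
    · rw [← hcls x hx.1, h8]
    · rw [← hcls x hx.1, ← hcls y hy.1, h9]

end SplitAll

namespace RAMProgram

variable {W n m : ℕ} {E : ℕ → ℕ → Prop} {s : RAMState} {Q : ℕ → RAMState → Prop}

theorem Ends.splitRows {sd out : ℕ → ℕ} {K : ℕ} {st : SplitState} (hnW : n + 1 < W) (hmW : m < W)
    (hW : 3 < W) (hin : HasInput n m E s) (hE : ∀ i j, E i j → i < n ∧ j < m)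
    (ho : IsRowOrder n m E (s.mem 8)) (hK : ∀ x < n, s.mem 23 x < K) (hKn : K ≤ n)
    (hrep : SplitRep s st) (hst : SplitAll n m E (s.mem 8) (s.mem 23) sd out K 0 st)
    (hQ : ∀ t s' st', SplitRep s' st' → SplitAll n m E (s.mem 8) (s.mem 23) sd out K n st' →
      t ≤ 500 * ((n + 1) * (m + 1)) → Q t s') : splitRows.Ends W s Q := by
  refine Ends.forTo_bdd n (400 * (m + 1)) (fun p s' => ∃ st', SplitRep s' st' ∧
    SplitAll n m E (s.mem 8) (s.mem 23) sd out K p st') (by omega) ?_ ?_ ?_ ?_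
  · intro s' hF
    simp only [RAMExpr.eval]
    rw [hF.1 0 (by decide), hin.rows]
  · refine ⟨st, ⟨?_, ?_, ?_, ?_, ?_⟩, hst⟩
    all_goals simp [hrep.t₁, hrep.t₂, hrep.pd, hrep.gr, hrep.gcol]
  · rintro p s' hF hp ⟨st', hrep', hst'⟩ hpn
    have hin' : HasInput n m E s' := hin.congr (hF.1 0 (by decide)) (hF.1 1 (by decide))
      (hF.2 0 (by decide))
    have h8 : s'.mem 8 = s.mem 8 := hF.2 8 (by decide)
    have h23 : s'.mem 23 = s.mem 23 := hF.2 23 (by decide)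
    have hy := ho.lt p hpn
    have hk := hK _ hy
    have hev : RAMExpr.eval s' (.read 8 (.reg 8)) = s.mem 8 p := by simp [RAMExpr.eval, h8, hp]
    refine Ends.seq (Ends.assign (by omega) ?_)
    rw [hev]
    refine Ends.ite (fun h => Ends.skip ⟨by simpa using hp, ?_, fun _ => ⟨st', ⟨?_, ?_, ?_, ?_, ?_⟩,
      hst'.skip hK hy ?_⟩⟩) (fun h => ?_)
    · simp only [RAMExpr.cost]
      omega
    any_goals simp [hrep'.t₁, hrep'.t₂, hrep'.pd, hrep'.gr, hrep'.gcol]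
    · simpa [RAMExpr.eval, hrep'.gcol] using h
    · have hI := hst'.inv _ hk
      -- If no row is pending, truncated subtraction gives row `0`; it is compared harmlessly and
      -- the result is ignored.
      have hpd : st'.pd (s.mem 23 (s.mem 8 p)) - 1 < n := by
        by_cases h0 : st'.pd (s.mem 23 (s.mem 8 p)) = 0
        · omega
        · exact (hI.pd_mem h0).1.1.1
      have hg : st'.pd (s.mem 23 (s.mem 8 p)) ≠ 0 →
          st'.gr (st'.pd (s.mem 23 (s.mem 8 p)) - 1) < n := fun h0 =>
        (hI.gr_mem _ (hI.pd_mem h0).1).1.1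
      have hlt := hst'.lt _ hk
      refine Ends.seq (Ends.assign ?_ (Ends.seq (Ends.assign ?_ (Ends.seq
        ((Ends.compareRow (n := n) (m := m) (E := E) (k := s.mem 23 (s.mem 8 p)) (y := s.mem 8 p)
          (p := st'.pd (s.mem 23 (s.mem 8 p)) - 1) (q := st'.t₁ (s.mem 23 (s.mem 8 p)))
          (r := st'.t₂ (s.mem 23 (s.mem 8 p)))
          ?_ hE ?_ ?_ hy ?_ hpd ?_ hlt.1 ?_ hlt.2 (by omega) hmW hW
          (Q := fun t s'' => (s''.mem 40 0 = 0 ↔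
              RowSub E (s.mem 8 p) (st'.pd (s.mem 23 (s.mem 8 p)) - 1)) ∧
            (s''.mem 40 1 = 0 ↔ RowSub E (s.mem 8 p) (st'.t₁ (s.mem 23 (s.mem 8 p)))) ∧
            (s''.mem 40 2 = 0 ↔ RowSub E (s.mem 8 p) (st'.t₂ (s.mem 23 (s.mem 8 p)))) ∧
            t ≤ 250 * (m + 1)) fun t s'' a b c d => ⟨a, b, c, d⟩).frame ?_)))))
      · simp [RAMExpr.eval, h23]; omega
      · simp [RAMExpr.eval, h23, hrep'.pd]; omega
      · exact hin'.congr (by simp) (by simp) (by simp)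
      · simp [RAMExpr.eval, h23]
      · simp
      · simp [RAMExpr.eval, h23, hrep'.pd]
      -- The next two goals identify the chain ends read from arrays `24` and `28`.
      · simp [hrep'.t₁]
      · simp [hrep'.t₂]
      · rintro t s₂ hr ha ⟨t0, t1, t2, ht⟩
        refine (Ends.splitRow (E := E) (st := st') (k := s.mem 23 (s.mem 8 p)) (y := s.mem 8 p)
          ⟨?_, ?_, ?_, ?_, ?_⟩ ?_ ?_ ?_ (by omega) (by omega) (by omega) (by omega)
          (fun h0 => by have := hg h0; omega) t0 t1 t2 (Q := fun t s'' =>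
            SplitRep s'' (st'.step E (s.mem 23 (s.mem 8 p)) (s.mem 8 p)) ∧ t ≤ 50)
          fun t s'' a b => ⟨a, b⟩).frame ?_
        · rw [ha 24 (by decide)]; simp [hrep'.t₁]
        · rw [ha 28 (by decide)]; simp [hrep'.t₂]
        · rw [ha 38 (by decide)]; simp [hrep'.pd]
        · rw [ha 37 (by decide)]; simp [hrep'.gr]
        · rw [ha 36 (by decide)]; simp [hrep'.gcol]
        · rw [hr 10 (by decide)]; simp [RAMExpr.eval, h23]
        · rw [hr 9 (by decide)]; simp
        · rw [hr 11 (by decide)]; simp [RAMExpr.eval, h23, hrep'.pd]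
        · rintro t' s₃ hr' ha' ⟨hrep₃, ht'⟩
          refine ⟨?_, ?_, fun _ => ⟨_, ⟨?_, ?_, ?_, ?_, ?_⟩, hst'.step (fun x c h => (hE x c h).2) ho hK
            hpn ?_⟩⟩
          · rw [hr' 8 (by decide), hr 8 (by decide)]
            simpa using hp
          · simp only [RAMExpr.cost]
            omega
          any_goals simp [hrep₃.t₁, hrep₃.t₂, hrep₃.pd, hrep₃.gr, hrep₃.gcol]
          intro h1
          simp [RAMExpr.eval, hrep'.gcol, h1] at h
  · rintro τ s' hF ⟨st', hrep', hst'⟩ hτ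
    refine hQ τ s' st' hrep' hst' ?_
    simp only [RAMExpr.cost] at hτ
    nlinarith

end RAMProgram

/-! ### The order of the rows -/

/-- Only the low digit of the larger number has to be bounded. This one fact decodes all the
mixed-radix keys below. -/
theorem lt_or_of_horner_le {R a b a' b' : ℕ} (hb' : b' < R)
    (h : a * R + b ≤ a' * R + b') : a < a' ∨ a = a' ∧ b ≤ b' := by
  rcases lt_trichotomy a a' with h1 | rfl | h1
  · exact Or.inl h1
  · exact Or.inr ⟨rfl, by omega⟩
  · exfalso
    have : (a' + 1) * R ≤ a * R := Nat.mul_le_mul_right _ h1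
    rw [add_one_mul] at this
    omega

/-- The number that describes the position of a row of class `cls` in its class. -/
def rowKey (m rd cls cnt deg : ℕ) : ℕ :=
  (if cls = 0 then 1 else 0) * deg +
    (if cls = 1 then 1 else 0) * ((rd * (m + 1) + (m - cnt)) * (m + 1) + deg) +
    (if cls = 2 then 1 else 0) * (m - deg)

/-- The position of a row. -/
def rowPos (n m cmp cls key x : ℕ) : ℕ :=
  ((cmp * 3 + cls) * ((n + 1) * (m + 1) * (m + 1)) + key) * (n + 1) + x + 1

theorem rowKey_lt {n m rd cls cnt deg : ℕ} (hrd : rd ≤ n) (hdeg : deg ≤ m) :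
    rowKey m rd cls cnt deg < (n + 1) * (m + 1) * (m + 1) := by
  have h1 : m - cnt < m + 1 := by omega
  have h2 : rd * (m + 1) + (m - cnt) + 1 ≤ (n + 1) * (m + 1) := by nlinarith
  have h3 : (rd * (m + 1) + (m - cnt)) * (m + 1) + deg < (n + 1) * (m + 1) * (m + 1) := by nlinarith
  have h4 : m < (n + 1) * (m + 1) * (m + 1) := by
    have : 0 ≤ n * (m + 1) * (m + 1) := Nat.zero_le _
    nlinarith
  rw [rowKey]
  by_cases c0 : cls = 0
  · simp [c0]; omega
  by_cases c1 : cls = 1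
  · simpa [c1] using h3
  by_cases c2 : cls = 2
  · simp [c2]; omega
  · simp [c0, c1, c2]

theorem rowPos_le {n m cmp cls key x : ℕ} (hcmp : cmp < n) (hcls : cls ≤ 2) (hx : x < n)
    (hkey : key < (n + 1) * (m + 1) * (m + 1)) :
    rowPos n m cmp cls key x ≤ 3 * n * ((n + 1) * (m + 1) * (m + 1)) * (n + 1) := by
  rw [rowPos]
  set R := (n + 1) * (m + 1) * (m + 1)
  have h1 : (cmp * 3 + cls + 1) * R ≤ 3 * n * R := Nat.mul_le_mul_right _ (by omega)
  have h2 : ((cmp * 3 + cls) * R + key + 1) * (n + 1) ≤ 3 * n * R * (n + 1) :=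
    Nat.mul_le_mul_right _ (by rw [add_one_mul] at h1; omega)
  rw [add_one_mul] at h2
  omega

/-- The last digit is the row itself, which breaks all ties and makes positions distinct. -/
theorem rowPos_inj {n m cmp cls key x cmp' cls' key' x' : ℕ} (hx : x < n) (hx' : x' < n)
    (h : rowPos n m cmp cls key x = rowPos n m cmp' cls' key' x') : x = x' := by
  simp only [rowPos] at h
  rcases lt_or_of_horner_le (by omega) (Nat.le_of_succ_le_succ h.le) with h1 | h1
  · rcases lt_or_of_horner_le (by omega) (Nat.le_of_succ_le_succ h.ge) with h2 | h2
    · omega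
    · omega
  · rw [h1.1] at h
    omega

theorem of_rowPos_le {n m cmp cls key x cmp' cls' key' x' : ℕ} (hx' : x' < n)
    (hcls : cls ≤ 2) (hcls' : cls' ≤ 2)
    (hkey' : key' < (n + 1) * (m + 1) * (m + 1))
    (h : rowPos n m cmp cls key x ≤ rowPos n m cmp' cls' key' x') :
    cmp < cmp' ∨ cmp = cmp' ∧ (cls < cls' ∨ cls = cls' ∧ key ≤ key') := by
  simp only [rowPos] at h
  have h1 := lt_or_of_horner_le (by omega) (Nat.le_of_succ_le_succ h)
  have h2 : (cmp * 3 + cls) * ((n + 1) * (m + 1) * (m + 1)) + key ≤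
      (cmp' * 3 + cls') * ((n + 1) * (m + 1) * (m + 1)) + key' := by
    rcases h1 with h1 | h1 <;> omega
  have h3 := lt_or_of_horner_le hkey' h2
  omega

/-- Criteria sorted in decreasing order enter `rowKey` as complements to `m`, which is legitimate
since all counts are at most `m`. -/
theorem rowLe_of_rowKey_le {m : ℕ} {E : ℕ → ℕ → Prop} {rd cd cls : ℕ → ℕ} {x y : ℕ}
    (hy : cls y ≤ 2)
    (h : cls x < cls y ∨ cls x = cls y ∧
      rowKey m (rd x) (cls x) (rowCount m E (fun c => cd c + 1 = rd x) x) (rowDeg m E x) ≤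
      rowKey m (rd y) (cls y) (rowCount m E (fun c => cd c + 1 = rd y) y) (rowDeg m E y)) :
    RowLe m E rd cd cls x y := by
  rcases h with h | ⟨h, h'⟩
  · exact Or.inl h
  refine Or.inr ⟨h, ?_⟩
  have d1 : rowDeg m E x ≤ m := rowCount_le _ _ _
  have d2 : rowDeg m E y ≤ m := rowCount_le _ _ _
  have d3 := rowCount_le (m := m) E (fun c => cd c + 1 = rd y) y
  have d4 := rowCount_le (m := m) E (fun c => cd c + 1 = rd x) x
  have hc : cls y = 0 ∨ cls y = 1 ∨ cls y = 2 := by omega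
  rcases hc with hc | hc | hc
  · left
    refine ⟨by omega, ?_⟩
    simpa [rowKey, h, hc] using h'
  · right; left
    refine ⟨by omega, ?_⟩
    simp only [rowKey, h, hc] at h'
    norm_num at h'
    rcases lt_or_of_horner_le (by omega) h' with h1 | ⟨h1, h2⟩
    · rcases lt_or_of_horner_le (by omega) h1.le with h3 | ⟨h3, h4⟩
      · exact Or.inl h3
      · refine Or.inr ⟨h3, Or.inl ?_⟩
        rw [h3] at h1 d4 h4 ⊢
        omega
    · rcases lt_or_of_horner_le (by omega) h1.le with h3 | ⟨h3, h4⟩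
      · exact Or.inl h3
      · refine Or.inr ⟨h3, Or.inr ⟨?_, h2⟩⟩
        rw [h3] at h1 d4 h4 ⊢
        omega
  · right; right
    refine ⟨by omega, ?_⟩
    simp only [rowKey, h, hc] at h'
    norm_num at h'
    simp only [rowDeg] at *
    omega

/-- Positions of the rows such that the rows of each column are consecutive. -/
structure IsRowPos (n : ℕ) (E : ℕ → ℕ → Prop) (P : ℕ) (pos : ℕ → ℕ) : Prop where
  pos_pos : ∀ x < n, 0 < pos x
  le : ∀ x < n, pos x ≤ P
  inj : ∀ x < n, ∀ y < n, pos x = pos y → x = y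
  convex : ∀ x y z c, E x c → E z c → y < n → pos x ≤ pos y → pos y ≤ pos z → E y c

theorem PassOut.isRowPos {n m : ℕ} {E : ℕ → ℕ → Prop} {Best' : ℕ → ℕ → Prop} {L' : ℕ → Prop}
    {rd cd cmp sd Dm out rd' cd' cmp' sd' Dm' out' : ℕ → ℕ} {K K' : ℕ} {f g : ℕ → ℤ}
    (h : PassOut n m E (fun x y => rowDeg m E y ≤ rowDeg m E x) L' rd cd cmp sd Dm out K)
    (h' : PassOut n m E Best' (fun x => ∃ p < K, out p = x) rd' cd' cmp' sd' Dm' out' K')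
    (hbi : IsBiconvex n m E f g) {cls pos : ℕ → ℕ} (hcls : ∀ x < n, cls x ≤ 2)
    (hcore : ∀ x < n, cls x = 1 ↔
      IsCore E (sd' (cmp' x)) (out' (cmp' x)) x ∧ IsCore E (out' (cmp' x)) (sd' (cmp' x)) x)
    (hside : ∀ k < K',
      (∀ x ∈ compRows n cmp' k, cls x = 0 → RowSub E x (sd' k)) ∧
      (∀ x ∈ compRows n cmp' k, cls x = 2 → RowSub E x (out' k)) ∧
      (∀ x ∈ compRows n cmp' k, ∀ y ∈ compRows n cmp' k, cls x ≠ 1 → cls x = cls y →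
        RowSub E x y ∨ RowSub E y x))
    (hpos : ∀ x < n, pos x = rowPos n m (cmp' x) (cls x)
      (rowKey m (rd' x) (cls x) (rowCount m E (fun c => cd' c + 1 = rd' x) x) (rowDeg m E x)) x) :
    IsRowPos n E (3 * n * ((n + 1) * (m + 1) * (m + 1)) * (n + 1)) pos := by
  have hkey : ∀ x, rowKey m (rd' x) (cls x) (rowCount m E (fun c => cd' c + 1 = rd' x) x)
      (rowDeg m E x) < (n + 1) * (m + 1) * (m + 1) := fun x =>
    rowKey_lt (h'.rd_le x) (rowCount_le _ _ _)
  refine ⟨fun x hx => ?_, fun x hx => ?_, fun x hx y hy hxy => ?_,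
    fun x y z c hxc hzc hy hxy hyz => ?_⟩
  · rw [hpos x hx, rowPos]
    omega
  · rw [hpos x hx]
    exact rowPos_le ((h'.cmp_lt x hx).trans_le h'.comps_le) (hcls x hx) hx (hkey x)
  · rw [hpos x hx, hpos y hy] at hxy
    exact rowPos_inj hx hy hxy
  · have hx := (hbi.lt x c hxc).1
    have hz := (hbi.lt z c hzc).1
    rw [hpos x hx, hpos y hy] at hxy
    rw [hpos z hz, hpos y hy] at hyz
    have h1 := of_rowPos_le hy (hcls x hx) (hcls y hy) (hkey y) hxy
    have h2 := of_rowPos_le hz (hcls y hy) (hcls z hz) (hkey z) hyz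
    have h3 := h'.share x z c hxc hzc
    exact h.convex h' hbi hcls hcore hside hy hxc hzc (by omega)
      (rowLe_of_rowKey_le (hcls y hy) (by omega))
      (rowLe_of_rowKey_le (hcls z hz) (by omega))

namespace RAMProgram

variable {W n m : ℕ} {E : ℕ → ℕ → Prop} {s : RAMState} {Q : ℕ → RAMState → Prop}

/-! ### Writing the representation -/

/-- `a[i] := e` for `i < b`. -/
def fillMap (a : ℕ) (b e : RAMExpr) : RAMProgram := fillSum a b (.const 1) e

theorem Ends.fillMap {a : ℕ} {b e : RAMExpr} (N : ℕ) (F : ℕ → ℕ) (hN : N + 1 < W)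
    (hb : ∀ s', FillFrame a s s' → b.eval s' = N)
    (he : ∀ s', FillFrame a s s' → s'.reg 2 < N → e.eval s' = F (s'.reg 2))
    (hF : ∀ i < N, F i < W)
    (hQ : ∀ τ s', FillFrame a s s' → (∀ k < N, s'.mem a k = F k) →
      τ ≤ 2 * (e.cost + b.cost + 35) * (N + 1) → Q τ s') : (fillMap a b e).Ends W s Q := by
  refine Ends.fillSum N 1 (fun i _ => F i) (by omega) (by omega) hb (fun _ _ => rfl)
    (fun s' h h2 _ => he s' h h2) (fun i hi => by simpa using hF i hi) ?_
  intro τ s' h1 h2 _ h3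
  refine hQ τ s' h1 (fun k hk => by simp [h2 k hk]) (h3.trans (le_of_eq ?_))
  simp only [RAMExpr.cost]
  ring

/-- One plus the register `x`. -/
def succReg (x : ℕ) : RAMExpr := .add (.reg x) (.const 1)

/-- The class of the row in register `2`. -/
def clsExpr : RAMExpr := .read 36 (.read 37 (.reg 2))

/-- `(n + 1) * (m + 1) * (m + 1)` -/
def keyBound : RAMExpr := .mul (.mul (succReg 0) (succReg 1)) (succReg 1)

/-- The value `rowKey` for the row in register `2`. -/
def keyExpr : RAMExpr :=
  .add (.add (.mul (.eq clsExpr (.const 0)) (.read 7 (.reg 2))) (.mul (.eq clsExpr (.const 1))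
    (.add (.mul (.add (.mul (.read 20 (.reg 2)) (succReg 1)) (.sub (.reg 1) (.read 41 (.reg 2))))
      (succReg 1)) (.read 7 (.reg 2)))))
    (.mul (.eq clsExpr (.const 2)) (.sub (.reg 1) (.read 7 (.reg 2))))

/-- Compute the positions of the rows. -/
def placeRows : RAMProgram :=
  .seq (fillSum 41 (.reg 0) (.reg 1) (.mul (entry (.reg 2) (.reg 3))
    (.eq (.add (.read 21 (.reg 3)) (.const 1)) (.read 20 (.reg 2)))))
    (fillMap 42 (.reg 0) (.add (.add (.mul (.add (.mul (.add (.mul (.read 23 (.reg 2)) (.const 3))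
      clsExpr) keyBound) keyExpr) (succReg 0)) (.reg 2)) (.const 1)))

theorem Ends.placeRows {pos : ℕ → ℕ} (hn : n + 1 < W) (hm : m < W) (hin : HasInput n m E s)
    (hdeg : ∀ x < n, s.mem 7 x = rowDeg m E x)
    (hpos : ∀ x < n, pos x = rowPos n m (s.mem 23 x) (s.mem 36 (s.mem 37 x))
      (rowKey m (s.mem 20 x) (s.mem 36 (s.mem 37 x))
        (rowCount m E (fun c => s.mem 21 c + 1 = s.mem 20 x) x) (rowDeg m E x)) x)
    (hW : ∀ x < n, pos x < W)
    (hQ : ∀ t s', (∀ x < n, s'.mem 42 x = pos x) → t ≤ 350 * ((n + 1) * (m + 1)) → Q t s') :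
    placeRows.Ends W s Q := by
  classical
  refine Ends.seq (Ends.fillSum n m (fun x c => (if E x c then 1 else 0) *
    (if s.mem 21 c + 1 = s.mem 20 x then 1 else 0)) (by omega) hm
    (fun s' h => (hin.fillFrame (by omega) h).rows)
    (fun s' h => (hin.fillFrame (by omega) h).cols) ?_ ?_ ?_)
  · intro s' h h2 h3
    have e1 := (hin.fillFrame (by omega) h).eval_entry (i := .reg 2) (j := .reg 3) rfl rfl h2 h3
    have e2 : s'.mem 21 = s.mem 21 := h.2 _ (by omega)
    have e3 : s'.mem 20 = s.mem 20 := h.2 _ (by omega)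
    simp only [RAMExpr.eval, e1, e2, e3]
    congr!
  · intro x _
    rw [sum_eq_rowCount]
    exact (rowCount_le _ _ _).trans_lt hm
  intro t₁ s₁ hF₁ h41 _ ht₁
  have hin₁ := hin.fillFrame (by omega) hF₁
  refine Ends.fillMap n pos hn (fun s' h => (hin₁.fillFrame (by omega) h).rows) ?_ hW ?_
  · intro s' h h2
    have hin' := hin₁.fillFrame (by omega) h
    have e7 : s'.mem 7 = s.mem 7 := by rw [h.2 _ (by omega), hF₁.2 _ (by omega)]
    have e20 : s'.mem 20 = s.mem 20 := by rw [h.2 _ (by omega), hF₁.2 _ (by omega)]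
    have e23 : s'.mem 23 = s.mem 23 := by rw [h.2 _ (by omega), hF₁.2 _ (by omega)]
    have e36 : s'.mem 36 = s.mem 36 := by rw [h.2 _ (by omega), hF₁.2 _ (by omega)]
    have e37 : s'.mem 37 = s.mem 37 := by rw [h.2 _ (by omega), hF₁.2 _ (by omega)]
    have e41 : s'.mem 41 (s'.reg 2) =
        rowCount m E (fun c => s.mem 21 c + 1 = s.mem 20 (s'.reg 2)) (s'.reg 2) := by
      rw [h.2 _ (by omega), h41 _ h2, sum_eq_rowCount]
    rw [hpos _ h2]
    simp only [RAMExpr.eval, clsExpr, keyBound, keyExpr, succReg, e7, e20, e23, e36, e37, e41,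
      hdeg _ h2, hin'.rows, hin'.cols, rowPos, rowKey]
  · intro t₂ s₂ hF₂ h42 ht₂
    refine hQ _ s₂ h42 ?_
    have h1 : t₁ ≤ 60 * ((n + 1) * (m + 1)) :=
      ht₁.trans (Nat.mul_le_mul_right _ (by simp [RAMExpr.cost, entry]))
    simp [RAMExpr.cost, clsExpr, keyBound, keyExpr, succReg] at ht₂
    nlinarith

/-- A number larger than all positions, times `m + 1`. -/
def sizeExpr : RAMExpr :=
  .mul (.add (.mul (.mul (.mul (.const 3) (.reg 0)) keyBound) (succReg 0)) (.const 1)) (succReg 1)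

/-- Write the coordinates of the segments. -/
def drawSegments : RAMProgram :=
  .seq (fillMax 43 (.reg 1) (.reg 0) (.const 0) (.mul (entry (.reg 3) (.reg 2)) (.read 42 (.reg 3))))
    (.seq (fillMap 1 (.reg 0) (.mul (.read 42 (.reg 2)) (succReg 1)))
    (.seq (fillMap 2 (.reg 0) (.sub sizeExpr (.read 1 (.reg 2))))
    (.seq (fillMap 3 (.reg 0) sizeExpr)
    (.seq (fillMap 4 (.reg 1) (.add (.mul (.read 43 (.reg 2)) (succReg 1)) (succReg 2)))
    (.seq (fillMap 5 (.reg 1) (.sub sizeExpr (.read 4 (.reg 2))))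
    (fillMax 6 (.reg 1) (.reg 0) (.add (.read 5 (.reg 2)) (.const 1))
      (.mul (entry (.reg 3) (.reg 2)) (.read 2 (.reg 3)))))))))

theorem sup_entry [∀ x c, Decidable (E x c)] (N : ℕ) (v : ℕ → ℕ) (c : ℕ) :
    (∀ x < N, E x c → v x ≤ (Finset.range N).sup fun x => (if E x c then 1 else 0) * v x) ∧
    (((Finset.range N).sup fun x => (if E x c then 1 else 0) * v x) = 0 ∨
      ∃ x, E x c ∧ x < N ∧
        ((Finset.range N).sup fun x => (if E x c then 1 else 0) * v x) = v x) := by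
  refine ⟨fun x hx hxc => ?_, ?_⟩
  · have := Finset.le_sup (f := fun x => (if E x c then 1 else 0) * v x) (Finset.mem_range.2 hx)
    simpa [hxc] using this
  · by_cases hN : N = 0
    · simp [hN]
    · obtain ⟨x, hx, h⟩ := Finset.exists_mem_eq_sup (Finset.range N) ⟨0, by simp; omega⟩
        fun x => (if E x c then 1 else 0) * v x
      rw [h]
      by_cases hxc : E x c
      · exact Or.inr ⟨x, hxc, by simpa using hx, by simp [hxc]⟩
      · simp [hxc]

/-- The segments that are determined by positions of the rows are written in `s`. -/
structure Drawing (n m : ℕ) (E : ℕ → ℕ → Prop) (pos : ℕ → ℕ) (Z : ℕ) (s : RAMState) : Prop where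
  row_left : ∀ x < n, s.mem 1 x = pos x * (m + 1) ∧ s.mem 2 x + s.mem 1 x = Z
  row_right : ∀ x < n, s.mem 3 x = Z ∧ s.mem 1 x < Z
  col_left : ∀ c < m, ∃ b, (∀ x, E x c → pos x ≤ b) ∧ (b = 0 ∨ ∃ x, E x c ∧ b = pos x) ∧
    s.mem 4 c = b * (m + 1) + (c + 1)
  col_bot : ∀ c < m, s.mem 5 c + s.mem 4 c = Z
  col_top : ∀ c < m, s.mem 5 c + 1 ≤ s.mem 6 c ∧ (∀ x, E x c → s.mem 2 x ≤ s.mem 6 c) ∧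
    (s.mem 6 c = s.mem 5 c + 1 ∨ ∃ x, E x c ∧ s.mem 6 c = s.mem 2 x)

/-- Scaling positions by `m + 1` leaves room for the offsets `c + 1 ≤ m` of the columns between two
rows. The ground line is `x + y = Z`, and `Z = (P + 1) * (m + 1)` exceeds every left abscissa, so
all coordinates are natural numbers. -/
theorem Ends.drawSegments {P Z : ℕ} {pos : ℕ → ℕ}
    (hP : P = 3 * n * ((n + 1) * (m + 1) * (m + 1)) * (n + 1)) (hZ : Z = (P + 1) * (m + 1))
    (hW : Z + 1 < W) (hn : n + 1 < W) (hm : m + 1 < W) (hin : HasInput n m E s)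
    (hE : ∀ i j, E i j → i < n ∧ j < m) (hpos : ∀ x < n, s.mem 42 x = pos x)
    (hle : ∀ x < n, pos x ≤ P)
    (hQ : ∀ t s', Drawing n m E pos Z s' → t ≤ 2000 * ((n + 1) * (m + 1)) → Q t s') :
    drawSegments.Ends W s Q := by
  classical
  have hsize : ∀ s', HasInput n m E s' → sizeExpr.eval s' = Z := by
    intro s' h
    simp only [sizeExpr, keyBound, succReg, RAMExpr.eval, h.rows, h.cols, hZ, hP]
  have hZP : ∀ b ≤ P, b * (m + 1) + (m + 1) ≤ Z := by
    intro b hb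
    rw [hZ, ← add_one_mul]
    exact Nat.mul_le_mul_right _ (by omega)
  have hPZ : P < Z := by nlinarith
  have hb_le : ∀ c, ((Finset.range n).sup fun x => (if E x c then 1 else 0) * pos x) ≤ P := by
    intro c
    rcases (sup_entry (E := E) n pos c).2 with h | ⟨x, -, hx, h⟩
    · omega
    · rw [h]
      exact hle x hx
  set B : ℕ → ℕ := fun c => (Finset.range n).sup fun x => (if E x c then 1 else 0) * pos x with hB
  refine Ends.seq (Ends.fillMax m n (fun _ => 0) (fun c x => (if E x c then 1 else 0) * pos x)
    (by omega) (by omega) (fun s' h => (hin.fillFrame (by omega) h).cols)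
    (fun s' h => (hin.fillFrame (by omega) h).rows) (fun _ _ _ => rfl) ?_ (by omega) ?_ ?_)
  · intro s' h h2 h3
    have e1 := (hin.fillFrame (by omega) h).eval_entry (i := .reg 3) (j := .reg 2) rfl rfl h3 h2
    have e2 : s'.mem 42 = s.mem 42 := h.2 _ (by omega)
    simp only [RAMExpr.eval, e1, e2, hpos _ h3]
    congr!
  · intro c _ x hx
    have := hle x hx
    split_ifs <;> omega
  intro t₀ s₀ hF₀ h43 ht₀
  have hin₀ := hin.fillFrame (by omega) hF₀
  refine Ends.seq (Ends.fillMap n (fun x => pos x * (m + 1)) hn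
    (fun s' h => (hin₀.fillFrame (by omega) h).rows) ?_ ?_ ?_)
  · intro s' h h2
    have e2 : s'.mem 42 = s.mem 42 := by rw [h.2 _ (by omega), hF₀.2 _ (by omega)]
    simp only [RAMExpr.eval, succReg, (hin₀.fillFrame (by omega) h).cols, e2, hpos _ h2]
  · intro x hx
    have := hZP _ (hle x hx)
    omega
  intro t₁ s₁ hF₁ h1 ht₁
  have hin₁ := hin₀.fillFrame (by omega) hF₁
  refine Ends.seq (Ends.fillMap n (fun x => Z - pos x * (m + 1)) hn
    (fun s' h => (hin₁.fillFrame (by omega) h).rows) ?_ (fun x _ => by omega) ?_)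
  · intro s' h h2
    have e2 : s'.mem 1 = s₁.mem 1 := h.2 _ (by omega)
    simp only [RAMExpr.eval, hsize s' (hin₁.fillFrame (by omega) h), e2, h1 _ h2]
  intro t₂ s₂ hF₂ h2 ht₂
  have hin₂ := hin₁.fillFrame (by omega) hF₂
  refine Ends.seq (Ends.fillMap n (fun x => Z) hn
    (fun s' h => (hin₂.fillFrame (by omega) h).rows)
    (fun s' h _ => hsize s' (hin₂.fillFrame (by omega) h)) (fun x _ => by omega) ?_)
  intro t₃ s₃ hF₃ h3 ht₃
  have hin₃ := hin₂.fillFrame (by omega) hF₃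
  have h43' : ∀ c < m, s₃.mem 43 c = B c := by
    intro c hc
    rw [hF₃.2 _ (by omega), hF₂.2 _ (by omega), hF₁.2 _ (by omega), h43 c hc]
    simp [hB]
  refine Ends.seq (Ends.fillMap m (fun c => B c * (m + 1) + (c + 1)) hm
    (fun s' h => (hin₃.fillFrame (by omega) h).cols) ?_ ?_ ?_)
  · intro s' h h2
    have e2 : s'.mem 43 = s₃.mem 43 := h.2 _ (by omega)
    simp only [RAMExpr.eval, succReg, (hin₃.fillFrame (by omega) h).cols, e2, h43' _ h2]
  · intro c hc
    have := hZP _ (hb_le c)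
    simp only [hB] at this ⊢
    omega
  intro t₄ s₄ hF₄ h4 ht₄
  have hin₄ := hin₃.fillFrame (by omega) hF₄
  refine Ends.seq (Ends.fillMap m (fun c => Z - (B c * (m + 1) + (c + 1))) hm
    (fun s' h => (hin₄.fillFrame (by omega) h).cols) ?_ (fun c _ => by omega) ?_)
  · intro s' h h2
    have e2 : s'.mem 4 = s₄.mem 4 := h.2 _ (by omega)
    simp only [RAMExpr.eval, hsize s' (hin₄.fillFrame (by omega) h), e2, h4 _ h2]
  intro t₅ s₅ hF₅ h5 ht₅
  have hin₅ := hin₄.fillFrame (by omega) hF₅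
  have h2' : ∀ x < n, s₅.mem 2 x = Z - pos x * (m + 1) := by
    intro x hx
    rw [hF₅.2 _ (by omega), hF₄.2 _ (by omega), hF₃.2 _ (by omega), h2 x hx]
  refine Ends.fillMax m n (fun c => Z - (B c * (m + 1) + (c + 1)) + 1)
    (fun c x => (if E x c then 1 else 0) * s₅.mem 2 x) (by omega) (by omega)
    (fun s' h => (hin₅.fillFrame (by omega) h).cols)
    (fun s' h => (hin₅.fillFrame (by omega) h).rows) ?_ ?_ (fun c _ => by omega) ?_ ?_
  · intro s' h h6
    have e2 : s'.mem 5 = s₅.mem 5 := h.2 _ (by omega)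
    simp only [RAMExpr.eval, e2, h5 _ h6]
  · intro s' h h6 h7
    have e1 := (hin₅.fillFrame (by omega) h).eval_entry (i := .reg 3) (j := .reg 2) rfl rfl h7 h6
    have e2 : s'.mem 2 = s₅.mem 2 := h.2 _ (by omega)
    simp only [RAMExpr.eval, e1, e2]
    congr!
  · intro c _ x hx
    have := h2' x hx
    split_ifs <;> omega
  intro t₆ s₆ hF₆ h6 ht₆
  have f1 : ∀ x < n, s₆.mem 1 x = pos x * (m + 1) := by
    intro x hx
    rw [hF₆.2 _ (by omega), hF₅.2 _ (by omega), hF₄.2 _ (by omega), hF₃.2 _ (by omega),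
      hF₂.2 _ (by omega), h1 x hx]
  have f2 : s₆.mem 2 = s₅.mem 2 := hF₆.2 _ (by omega)
  have f3 : ∀ x < n, s₆.mem 3 x = Z := by
    intro x hx
    rw [hF₆.2 _ (by omega), hF₅.2 _ (by omega), hF₄.2 _ (by omega), h3 x hx]
  have f4 : ∀ c < m, s₆.mem 4 c = B c * (m + 1) + (c + 1) := by
    intro c hc
    rw [hF₆.2 _ (by omega), hF₅.2 _ (by omega), h4 c hc]
  have f5 : ∀ c < m, s₆.mem 5 c = Z - (B c * (m + 1) + (c + 1)) := by
    intro c hc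
    rw [hF₆.2 _ (by omega), h5 c hc]
  refine hQ _ s₆ ⟨fun x hx => ⟨f1 x hx, ?_⟩, fun x hx => ⟨f3 x hx, ?_⟩, fun c hc => ⟨B c, ?_, ?_,
    f4 c hc⟩, fun c hc => ?_, fun c hc => ?_⟩ ?_
  · have := hZP _ (hle x hx)
    rw [f2, h2' x hx, f1 x hx]
    omega
  · have := hZP _ (hle x hx)
    rw [f1 x hx]
    omega
  · exact fun x hx => (sup_entry (E := E) n pos c).1 x (hE x c hx).1 hx
  · rcases (sup_entry (E := E) n pos c).2 with h | ⟨x, h7, -, h⟩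
    · exact Or.inl h
    · exact Or.inr ⟨x, h7, h⟩
  · have := hZP _ (hb_le c)
    rw [f4 c hc, f5 c hc]
    simp only [hB] at this ⊢
    omega
  · have h7 := sup_entry (E := E) n (s₅.mem 2) c
    rw [h6 c hc, f2, f5 c hc]
    refine ⟨le_max_left _ _, fun x hx => le_max_of_le_right (h7.1 x (hE x c hx).1 hx), ?_⟩
    rcases le_total ((Finset.range n).sup fun x => (if E x c then 1 else 0) * s₅.mem 2 x)
      (Z - (B c * (m + 1) + (c + 1)) + 1) with h8 | h8
    · exact Or.inl (max_eq_left h8)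
    · right
      rcases h7.2 with h9 | ⟨x, h10, -, h9⟩
      · omega
      · exact ⟨x, h10, by rw [← h9]; exact max_eq_right h8⟩
  · simp [RAMExpr.cost, keyBound, sizeExpr, succReg, entry] at ht₀ ht₁ ht₂ ht₃ ht₄ ht₅ ht₆
    nlinarith

end RAMProgram

namespace RAMProgram

variable {W n m : ℕ} {E : ℕ → ℕ → Prop} {s : RAMState} {Q : ℕ → RAMState → Prop}

/-! ### The complete program -/

/-- The program that computes Stick representations. -/
def stick : RAMProgram :=
  .seq (rowDegs 7) (.seq (sortRows 7 8) (.seq (pass 10 8) (.seq (.assign 13 (.reg 7))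
    (.seq (pass 20 18) (.seq (markCore 23 24 28 30) (.seq (markCore 23 28 24 33)
    (.seq (initClasses 30) (.seq splitRows (.seq placeRows drawSegments)))))))))

theorem HasInput.frame {s' : RAMState} {p : RAMProgram} (h : HasInput n m E s)
    (hr : ∀ x, x ∉ p.regs → s'.reg x = s.reg x) (ha : ∀ a, a ∉ p.arrays → s'.mem a = s.mem a)
    (h0 : 0 ∉ p.regs) (h1 : 1 ∉ p.regs) (h2 : 0 ∉ p.arrays) : HasInput n m E s' :=
  h.congr (hr 0 h0) (hr 1 h1) (ha 0 h2)

/-- Arrays `7` and `8` hold lengths and the sorted rows. The searches use arrays `10` to `18` and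
`20` to `28`; the second leaves components in `23` and the two ends in `24` and `28`. Classes and
representatives are in `36` and `37`, positions in `42`. -/
theorem Ends.stick {P Z : ℕ} {f g : ℕ → ℤ}
    (hP : P = 3 * n * ((n + 1) * (m + 1) * (m + 1)) * (n + 1)) (hZ : Z = (P + 1) * (m + 1))
    (hW : Z + (n + 3) * (m + 3) * (m + 3) < W) (hin : HasInput n m E s)
    (hzero : ∀ a, 0 < a → s.mem a = fun _ => 0) (hbi : IsBiconvex n m E f g)
    (hQ : ∀ t s' pos, IsRowPos n E P pos → Drawing n m E pos Z s' →
      t ≤ 4500 * ((n + 1) * (m + 1)) → Q t s') : RAMProgram.stick.Ends W s Q := by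
  classical
  have h1 : n + 3 ≤ (n + 3) * (m + 3) := Nat.le_mul_of_pos_right _ (by omega)
  -- The second summand of the word bound serves for loop counters and packed keys, which stay below
  -- `(m + 1) * (m + 1)`; it is needed because `Z` alone is small when `n = 0`.
  have h2 : (n + 3) * (m + 3) ≤ (n + 3) * (m + 3) * (m + 3) := Nat.le_mul_of_pos_right _ (by omega)
  have h3 : m + 3 ≤ (n + 3) * (m + 3) * (m + 3) := Nat.le_mul_of_pos_left _ (by positivity)
  have hn1 : n + 3 < W := by omega
  have hm1 : m + 3 < W := by omega
  have hZW : Z + 1 < W := by omega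
  have hnm : (n + 1) * (m + 1) < W := by nlinarith [Nat.zero_le Z]
  have hmm : (m + 1) * (m + 1) < W := by nlinarith [Nat.zero_le Z]
  have hE := hbi.lt
  have hm := fun x c h => (hE x c h).2
  -- degrees
  refine Ends.seq (Ends.rowDegs (by omega) (by omega) (by omega) hin fun t₁ s₁ hF₁ h7 ht₁ => ?_)
  have hin₁ := hin.fillFrame (by omega) hF₁
  -- order
  refine Ends.seq ((Ends.sortRows (s := s₁) (d := 7) (o := 8) (by omega) (by omega) (by omega) hin₁
    h7 (Q := fun t s' => s'.reg 13 = n ∧ IsRowOrder n m E (s'.mem 8) ∧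
      t ≤ 40 * ((n + 1) * (m + 1))) fun t s' a b c => ⟨a, b, c⟩).frame ?_)
  rintro t₂ s₂ hr₂ ha₂ ⟨h13, ho, ht₂⟩
  have hin₂ := hin₁.frame hr₂ ha₂ (by decide) (by decide) (by decide)
  -- first search
  refine Ends.seq ((Ends.pass (s := s₂) (β := 10) (l := 8) (len := n)
    (Best := fun x y => rowDeg m E y ≤ rowDeg m E x) (by omega) hmm (by omega) hin₂ hE ?_
    (by omega) h13 le_rfl ho.lt ?_ ?_
    (Q := fun t s' => ∃ K, s'.reg 7 = K ∧ PassOut n m E (fun x y => rowDeg m E y ≤ rowDeg m E x)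
      (fun x => ∃ p < n, s₂.mem 8 p = x) (s'.mem 10) (s'.mem (10 + 1)) (s'.mem (10 + 3))
      (s'.mem (10 + 4)) (s'.mem (10 + 5)) (s'.mem (10 + 8)) K ∧ t ≤ 300 * ((n + 1) * (m + 1)))
    fun t s' K a b c => ⟨K, a, b, c⟩).frame ?_)
  · intro a ha
    rw [ha₂ a (by simp [RAMProgram.sortRows, RAMProgram.forTo, arrays]; omega), hF₁.2 a (by omega)]
    exact hzero a (by omega)
  · intro p hp y hy hne
    obtain ⟨q, hq, rfl⟩ := ho.surj y hy
    exact ho.anti p q (by by_contra h; exact hne q (by omega) rfl) hq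
  · intro x hx
    obtain ⟨q, hq, rfl⟩ := ho.surj x hx
    exact ⟨q, hq, .refl⟩
  rintro t₃ s₃ hr₃ ha₃ ⟨K, h7K, hA, ht₃⟩
  norm_num at hA
  have hin₃ := hin₂.frame hr₃ ha₃ (by simp [regs_pass]) (by simp [regs_pass])
    (fun h => by have := arrays_pass 10 8 0 h; omega)
  have hKn := hA.comps_le
  refine Ends.seq (Ends.assign (by simp only [RAMExpr.eval]; omega) ?_)
  -- second search
  refine Ends.seq ((Ends.pass (s := s₃.setReg 13 (RAMExpr.eval s₃ (.reg 7))) (β := 20) (l := 18)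
    (len := K) (Best := fun _ _ => True) (by omega) hmm (by omega)
    (hin₃.congr (by simp) (by simp) (by simp)) hE ?_ (by omega) (by simp [RAMExpr.eval, h7K]) hKn
    (fun p hp => (hA.out_mem p hp).1) (fun _ _ _ _ _ => trivial) ?_
    (Q := fun t s' => ∃ K', PassOut n m E (fun _ _ => True)
      (fun x => ∃ p < K, s₃.mem 18 p = x) (s'.mem 20) (s'.mem (20 + 1)) (s'.mem (20 + 3))
      (s'.mem (20 + 4)) (s'.mem (20 + 5)) (s'.mem (20 + 8)) K' ∧ t ≤ 300 * ((n + 1) * (m + 1)))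
    fun t s' K _ b c => ⟨K, b, c⟩).frame ?_)
  · intro a ha
    rw [RAMState.setReg_mem, ha₃ a (fun h => by have := arrays_pass 10 8 a h; omega),
      ha₂ a (by simp [RAMProgram.sortRows, RAMProgram.forTo, arrays]; omega), hF₁.2 a (by omega)]
    exact hzero a (by omega)
  -- Each row is reachable from the output row of its component in the first search, through the
  -- seed of that component.
  · intro x hx
    have hk := hA.cmp_lt x hx
    refine ⟨_, hk, ?_⟩
    have h1 := hA.reach x hx
    have h2 := hA.reach _ (hA.out_mem _ hk).1
    rw [(hA.out_mem _ hk).2] at h2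
    have : Std.Symm (RowShare E) := ⟨fun _ _ => RowShare.symm⟩
    exact (Std.Symm.symm _ _ h2).trans h1
  rintro t₅ s₅ hr₅ ha₅ ⟨K', hB, ht₅⟩
  norm_num at hB
  have hin₅ := (hin₃.congr (s' := s₃.setReg 13 (RAMExpr.eval s₃ (.reg 7))) (by simp) (by simp)
    (by simp)).frame hr₅ ha₅ (by simp [regs_pass]) (by simp [regs_pass])
    (fun h => by have := arrays_pass 20 18 0 h; omega)
  have g5 : ∀ a, a < 10 → s₅.mem a = s₂.mem a := by
    intro a ha
    rw [ha₅ a (fun h => by have := arrays_pass 20 18 a h; omega), RAMState.setReg_mem,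
      ha₃ a (fun h => by have := arrays_pass 10 8 a h; omega)]
  have z5 : ∀ a, 29 ≤ a → s₅.mem a = fun _ => 0 := by
    intro a ha
    rw [ha₅ a (fun h => by have := arrays_pass 20 18 a h; omega), RAMState.setReg_mem,
      ha₃ a (fun h => by have := arrays_pass 10 8 a h; omega),
      ha₂ a (by simp [RAMProgram.sortRows, RAMProgram.forTo, arrays]; omega), hF₁.2 a (by omega)]
    exact hzero a (by omega)
  have hK' := hB.cmp_lt
  have hsd : ∀ k < K', s₅.mem 24 k < n ∧ s₅.mem 23 (s₅.mem 24 k) = k := fun k hk =>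
    (hB.bfs k hk).mem
  have hout : ∀ k < K', s₅.mem 28 k < n ∧ s₅.mem 23 (s₅.mem 28 k) = k := fun k hk =>
    hB.out_mem k hk
  -- core rows
  refine Ends.seq ((Ends.markCore (s := s₅) (cmp := 23) (σ := 24) (τ := 28) (b := 30) hnm hin₅ hE
    (by omega) (by omega) (by omega) (by omega) (fun x hx => hsd _ (hK' x hx)) hB.share
    (Q := fun t s' => (∀ x < n, (s'.mem 30 x = 0 ∧ s'.mem (30 + 2) x ≠ 0) ↔
      ¬ IsCore E (s₅.mem 24 (s₅.mem 23 x)) (s₅.mem 28 (s₅.mem 23 x)) x) ∧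
      t ≤ 200 * ((n + 1) * (m + 1))) fun t s' a b => ⟨a, b⟩).frame ?_)
  rintro t₆ s₆ hr₆ ha₆ ⟨hc₁, ht₆⟩
  have hin₆ := hin₅.frame hr₆ ha₆ (by decide) (by decide) (by decide)
  have e23 : s₆.mem 23 = s₅.mem 23 := ha₆ 23 (by decide)
  have e24 : s₆.mem 24 = s₅.mem 24 := ha₆ 24 (by decide)
  have e28 : s₆.mem 28 = s₅.mem 28 := ha₆ 28 (by decide)
  refine Ends.seq ((Ends.markCore (s := s₆) (cmp := 23) (σ := 28) (τ := 24) (b := 33) hnm hin₆ hE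
    (by omega) (by omega) (by omega) (by omega)
    (fun x hx => by rw [e23, e28]; exact hout _ (hK' x hx)) (by rw [e23]; exact hB.share)
    (Q := fun t s' => (∀ x < n, (s'.mem 33 x = 0 ∧ s'.mem (33 + 2) x ≠ 0) ↔
      ¬ IsCore E (s₆.mem 28 (s₆.mem 23 x)) (s₆.mem 24 (s₆.mem 23 x)) x) ∧
      t ≤ 200 * ((n + 1) * (m + 1))) fun t s' a b => ⟨a, b⟩).frame ?_)
  rintro t₇ s₇ hr₇ ha₇ ⟨hc₂, ht₇⟩
  have hin₇ := hin₆.frame hr₇ ha₇ (by decide) (by decide) (by decide)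
  rw [e23, e24, e28] at hc₂
  refine Ends.seq ((Ends.initClasses (s := s₇) (b := 30) (by omega) (by omega) hin₇
    (fun x => IsCore E (s₅.mem 24 (s₅.mem 23 x)) (s₅.mem 28 (s₅.mem 23 x)) x)
    (fun x => IsCore E (s₅.mem 28 (s₅.mem 23 x)) (s₅.mem 24 (s₅.mem 23 x)) x) ?_ hc₂
    (Q := fun t s' => (∀ x < n, s'.mem 36 x =
      if IsCore E (s₅.mem 24 (s₅.mem 23 x)) (s₅.mem 28 (s₅.mem 23 x)) x ∧
        IsCore E (s₅.mem 28 (s₅.mem 23 x)) (s₅.mem 24 (s₅.mem 23 x)) x then 1 else 0) ∧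
      (∀ x < n, s'.mem 37 x = x) ∧ t ≤ 200 * ((n + 1) * (m + 1))) ?_).frame ?_)
  · rw [ha₇ 30 (by decide), ha₇ (30 + 2) (by decide)]
    exact hc₁
  · intro t s' a b c
    exact ⟨fun x hx => a x hx, b, c⟩
  rintro t₈ s₈ hr₈ ha₈ ⟨h36, h37, ht₈⟩
  have hin₈ := hin₇.frame hr₈ ha₈ (by decide) (by decide) (by decide)
  have g8 : ∀ a, a < 30 → s₈.mem a = s₅.mem a := by
    intro a ha
    have h1 : ∀ b, 29 < b → a ∉ (RAMProgram.markCore 23 24 28 30).arrays ∧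
        a ∉ (RAMProgram.markCore 23 28 24 33).arrays ∧ a ∉ (RAMProgram.initClasses 30).arrays := by
      intro b hb
      simp [RAMProgram.markCore, RAMProgram.initClasses, arrays, RAMProgram.fillSum, arrays_fill]
      omega
    obtain ⟨h2, h3, h4⟩ := h1 30 (by omega)
    rw [ha₈ a h4, ha₇ a h3, ha₆ a h2]
  have h38 : s₈.mem 38 = fun _ => 0 := by
    rw [ha₈ 38 (by decide), ha₇ 38 (by decide), ha₆ 38 (by decide)]
    exact z5 38 (by omega)
  have e8 : s₈.mem 8 = s₂.mem 8 := by rw [g8 8 (by omega), g5 8 (by omega)]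
  have e23 : s₈.mem 23 = s₅.mem 23 := g8 23 (by omega)
  -- other rows
  refine Ends.seq ((Ends.splitRows (s := s₈) (sd := s₅.mem 24) (out := s₅.mem 28) (K := K')
    (st := ⟨s₅.mem 24, s₅.mem 28, s₈.mem 38, s₈.mem 37, s₈.mem 36⟩) (by omega) (by omega)
    (by omega) hin₈ hE (by rw [e8]; exact ho) (by rw [e23]; exact hK') hB.comps_le
    ⟨g8 24 (by omega), g8 28 (by omega), rfl, rfl, rfl⟩ ⟨fun k hk => ?_, fun x hx hxN => ?_,
      fun k hk => ⟨(hsd k hk).1, (hout k hk).1⟩⟩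
    (Q := fun t s' => ∃ st', SplitRep s' st' ∧
      SplitAll n m E (s₈.mem 8) (s₈.mem 23) (s₅.mem 24) (s₅.mem 28) K' n st' ∧
      t ≤ 500 * ((n + 1) * (m + 1))) fun t s' st' a b c => ⟨st', a, b, c⟩).frame ?_)
  · obtain ⟨χ, h1, h2, h3⟩ := hA.exists_coloring hB hbi k
    rw [e23]
    refine SplitInv.start h1 h2 h3 rfl rfl (by simp [h38]) (fun x hx => h37 x hx.1.1)
      (fun x hx => ?_) (by simp)
    obtain ⟨⟨h4, rfl⟩, h5⟩ := hx
    simp only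
    rw [h36 x h4, if_neg h5]
  · refine ⟨?_, h37 x hx⟩
    simp only
    rw [h36 x hx, if_pos]
    by_contra h1
    rw [e23] at hxN
    exact hxN ⟨⟨hx, rfl⟩, h1⟩
  rintro t₉ s₉ hr₉ ha₉ ⟨st, hrep, hst, ht₉⟩
  have hin₉ := hin₈.frame hr₉ ha₉ (by decide) (by decide) (by decide)
  rw [e8, e23] at hst
  have e7 : s₉.mem 7 = s₁.mem 7 := by
    rw [ha₉ 7 (by decide), g8 7 (by omega), g5 7 (by omega), ha₂ 7 (by decide)]
  have e20 : s₉.mem 20 = s₅.mem 20 := by rw [ha₉ 20 (by decide), g8 20 (by omega)]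
  have e21 : s₉.mem 21 = s₅.mem 21 := by rw [ha₉ 21 (by decide), g8 21 (by omega)]
  have e23' : s₉.mem 23 = s₅.mem 23 := by rw [ha₉ 23 (by decide), e23]
  obtain ⟨hcls, hcore, hside⟩ := hst.finish ho hK' (cls := fun x => s₉.mem 36 (s₉.mem 37 x))
    fun x _ => by rw [hrep.gcol, hrep.gr]
  -- positions
  set pos : ℕ → ℕ := fun x => rowPos n m (s₉.mem 23 x) (s₉.mem 36 (s₉.mem 37 x))
    (rowKey m (s₉.mem 20 x) (s₉.mem 36 (s₉.mem 37 x))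
      (rowCount m E (fun c => s₉.mem 21 c + 1 = s₉.mem 20 x) x) (rowDeg m E x)) x with hposdef
  have hpos : IsRowPos n E P pos := by
    rw [hP]
    refine hA.isRowPos hB hbi hcls hcore hside fun x hx => ?_
    simp only [hposdef, e20, e21, e23']
  have hPZ : P < Z := by rw [hZ]; nlinarith
  refine Ends.seq ((Ends.placeRows (s := s₉) (pos := pos) (by omega) (by omega) hin₉
    (by rw [e7]; exact h7) (fun x _ => rfl)
    (fun x hx => by have := hpos.le x hx; omega)
    (Q := fun t s' => (∀ x < n, s'.mem 42 x = pos x) ∧ t ≤ 350 * ((n + 1) * (m + 1)))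
    fun t s' a b => ⟨a, b⟩).frame ?_)
  rintro t₁₀ s₁₀ hr₁₀ ha₁₀ ⟨h42, ht₁₀⟩
  have hin₁₀ := hin₉.frame hr₁₀ ha₁₀ (by decide) (by decide) (by decide)
  refine Ends.drawSegments hP hZ hZW (by omega) (by omega) hin₁₀ hE h42 hpos.le ?_
  intro t₁₁ s₁₁ hD ht₁₁
  refine hQ _ s₁₁ pos hpos hD ?_
  have : 1 ≤ (n + 1) * (m + 1) := Nat.one_le_iff_ne_zero.2 (by positivity)
  simp only [RAMExpr.cost]
  omega

end RAMProgram

/-! ### Drawings are Stick representations -/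

theorem horizontal_inter_vertical_nonempty {x y x' u v v' : ℝ} :
    (horizontalSegment x y x' ∩ verticalSegment u v v').Nonempty ↔
      (x ≤ u ∧ u ≤ x') ∧ v ≤ y ∧ y ≤ v' := by
  constructor
  · rintro ⟨⟨p, q⟩, ⟨hp, rfl⟩, rfl, hq⟩
    exact ⟨hp, hq⟩
  · rintro ⟨h, h'⟩
    exact ⟨(u, y), ⟨h, rfl⟩, rfl, h'⟩

theorem horizontal_ne_vertical {x y x' u v v' : ℝ} (h : x < x') :
    horizontalSegment x y x' ≠ verticalSegment u v v' := by
  intro he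
  have h1 : (x, y) ∈ verticalSegment u v v' := he ▸ ⟨⟨le_rfl, h.le⟩, rfl⟩
  have h2 : (x', y) ∈ verticalSegment u v v' := he ▸ ⟨⟨h.le, le_rfl⟩, rfl⟩
  exact h.ne (h1.1.trans h2.1.symm)

namespace RAMProgram

variable {n m P Z : ℕ} {E : ℕ → ℕ → Prop} {pos : ℕ → ℕ} {s : RAMState}

/-- The vertical segment lies right of the left end of row `x` exactly if `pos x` is at most the
last position `b` in the column, and it reaches the level of `x` only if `x` is not before the first
row of the column. Convexity does the rest. -/
theorem Drawing.entry_iff (h : Drawing n m E pos Z s) (hpos : IsRowPos n E P pos)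
    (hE : ∀ x c, E x c → x < n ∧ c < m) {x c : ℕ} (hx : x < n) (hc : c < m) :
    E x c ↔ (outputRowSegment s x ∩ outputColumnSegment s c).Nonempty := by
  unfold outputRowSegment outputColumnSegment
  rw [horizontal_inter_vertical_nonempty]
  simp only [Nat.cast_le]
  obtain ⟨h1, h2⟩ := h.row_left x hx
  obtain ⟨h3, h4⟩ := h.row_right x hx
  obtain ⟨b, hb, hb', h5⟩ := h.col_left c hc
  have h6 := h.col_bot c hc
  obtain ⟨h7, h8, h9⟩ := h.col_top c hc
  constructor
  · intro hxc
    have := Nat.mul_le_mul_right (m + 1) (hb x hxc)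
    exact ⟨⟨by omega, by omega⟩, by omega, h8 x hxc⟩
  · rintro ⟨⟨h10, -⟩, -, h11⟩
    have hxb : pos x ≤ b := by
      by_contra hlt
      have := Nat.mul_le_mul_right (m + 1) (Nat.succ_le_of_lt (not_le.1 hlt))
      rw [Nat.succ_mul] at this
      omega
    -- An empty column has `b = 0`, to the left of every row since positions are positive.
    obtain rfl | ⟨z, hz, rfl⟩ := hb'
    · exact absurd (hpos.pos_pos x hx) (by omega)
    -- If the top is the default `bottom + 1`, only the last row `z` can be met; otherwise the top
    -- is the level of some row `y` of the column, and `x` lies between `y` and `z`.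
    rcases h9 with h9 | ⟨y, hy, h9⟩
    · have hbx : pos z ≤ pos x := by
        by_contra hlt
        have := Nat.mul_le_mul_right (m + 1) (Nat.succ_le_of_lt (not_le.1 hlt))
        rw [Nat.succ_mul] at this
        omega
      rwa [hpos.inj x hx z (hE z c hz).1 (le_antisymm hxb hbx)]
    · refine hpos.convex y x z c hy hz hx ?_ hxb
      obtain ⟨h12, h13⟩ := h.row_left y (hE y c hy).1
      by_contra hlt
      have := Nat.mul_le_mul_right (m + 1) (Nat.succ_le_of_lt (not_le.1 hlt))
      rw [Nat.succ_mul] at this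
      omega

theorem Drawing.eq_of_row_inter (h : Drawing n m E pos Z s) (hpos : IsRowPos n E P pos)
    {x y : ℕ} (hx : x < n) (hy : y < n)
    (hxy : (outputRowSegment s x ∩ outputRowSegment s y).Nonempty) : x = y := by
  obtain ⟨p, ⟨-, h1⟩, -, h2⟩ := hxy
  have h3 : s.mem 2 x = s.mem 2 y := Nat.cast_injective (R := ℝ) (h1.symm.trans h2)
  obtain ⟨h4, h5⟩ := h.row_left x hx
  obtain ⟨h6, h7⟩ := h.row_left y hy
  exact hpos.inj x hx y hy (Nat.eq_of_mul_eq_mul_right (Nat.succ_pos m) (by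
    change pos x * (m + 1) = pos y * (m + 1); omega))

/-- The abscissa determines the column, being congruent to `c + 1` modulo `m + 1`. -/
theorem Drawing.eq_of_column_inter (h : Drawing n m E pos Z s) {c d : ℕ} (hc : c < m) (hd : d < m)
    (hcd : (outputColumnSegment s c ∩ outputColumnSegment s d).Nonempty) : c = d := by
  obtain ⟨p, ⟨h1, -⟩, h2, -⟩ := hcd
  have h3 : s.mem 4 c = s.mem 4 d := Nat.cast_injective (R := ℝ) (h1.symm.trans h2)
  obtain ⟨b, -, -, h4⟩ := h.col_left c hc
  obtain ⟨b', -, -, h5⟩ := h.col_left d hd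
  have h6 : (b * (m + 1) + (c + 1)) % (m + 1) = (b' * (m + 1) + (d + 1)) % (m + 1) := by
    rw [← h4, ← h5, h3]
  simp only [Nat.mul_add_mod', Nat.mod_eq_of_lt (Nat.succ_lt_succ hc),
    Nat.mod_eq_of_lt (Nat.succ_lt_succ hd)] at h6
  omega

theorem Drawing.exists_isStickRepresentation {V : Type u} {G : SimpleGraph V} {A B : Finset V}
    (hG : G.IsBipartiteWith (A : Set V) (B : Set V)) (hAB : (A : Set V) ∪ (B : Set V) = Set.univ)
    (a : Fin A.card ≃ A) (b : Fin B.card ≃ B) (h : Drawing A.card B.card E pos Z s)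
    (hpos : IsRowPos A.card E P pos) (hE : ∀ x c, E x c → x < A.card ∧ c < B.card)
    (hadj : ∀ i j, G.Adj (a i) (b j) ↔ E i j) :
    ∃ S : V → Set (ℝ × ℝ), IsStickRepresentation G (A : Set V) (B : Set V) S ∧
      (∀ i, S (a i) = outputRowSegment s i) ∧ (∀ j, S (b j) = outputColumnSegment s j) := by
  classical
  have hdisj : ∀ v, v ∈ A → v ∈ B → False := fun v h1 h2 =>
    Set.disjoint_left.1 hG.disjoint h1 h2
  set S : V → Set (ℝ × ℝ) := fun v =>
    if hv : v ∈ A then outputRowSegment s (a.symm ⟨v, hv⟩)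
    else if hv : v ∈ B then outputColumnSegment s (b.symm ⟨v, hv⟩) else ∅ with hS
  have hSa : ∀ i, S (a i) = outputRowSegment s i := fun i => by simp [hS]
  have hSb : ∀ j, S (b j) = outputColumnSegment s j := fun j => by
    have : ((b j : V)) ∉ A := fun h' => hdisj _ h' (b j).2
    simp [hS, this]
  have hcases : ∀ v : V, (∃ i, v = a i) ∨ ∃ j, v = b j := fun v => by
    have hv : v ∈ (A : Set V) ∪ (B : Set V) := hAB ▸ Set.mem_univ v
    rcases hv with hv | hv
    · exact .inl ⟨a.symm ⟨v, hv⟩, by simp⟩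
    · exact .inr ⟨b.symm ⟨v, hv⟩, by simp⟩
  have hrow : ∀ i : Fin A.card, (s.mem 1 i : ℝ) < s.mem 3 i := fun i => by
    have := h.row_right i i.2
    exact_mod_cast this.1 ▸ this.2
  have hcol : ∀ j : Fin B.card, (s.mem 5 j : ℝ) < s.mem 6 j := fun j => by
    exact_mod_cast Nat.lt_of_succ_le (h.col_top j j.2).1
  have hne : ∀ v, (S v).Nonempty := fun v => by
    obtain ⟨i, rfl⟩ | ⟨j, rfl⟩ := hcases v
    · rw [hSa]; exact ⟨(s.mem 1 i, s.mem 2 i), ⟨le_rfl, (hrow i).le⟩, rfl⟩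
    · rw [hSb]; exact ⟨(s.mem 4 j, s.mem 5 j), rfl, ⟨le_rfl, (hcol j).le⟩⟩
  have hiff : ∀ u v, u ≠ v → (G.Adj u v ↔ (S u ∩ S v).Nonempty) := by
    intro u v huv
    obtain ⟨i, rfl⟩ | ⟨j, rfl⟩ := hcases u <;> obtain ⟨i', rfl⟩ | ⟨j', rfl⟩ := hcases v
    · rw [hSa, hSa]
      refine iff_of_false (fun h1 => hdisj _ (a i').2 (hG.mem_of_mem_adj (a i).2 h1)) fun h1 => ?_
      exact huv (by rw [Fin.ext (h.eq_of_row_inter hpos i.2 i'.2 h1)])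
    · rw [hSa, hSb, hadj, h.entry_iff hpos hE i.2 j'.2]
    · rw [hSa, hSb, G.adj_comm, hadj, h.entry_iff hpos hE i'.2 j.2, Set.inter_comm]
    · rw [hSb, hSb]
      refine iff_of_false (fun h1 => hdisj _ (hG.symm.mem_of_mem_adj (b j).2 h1) (b j').2)
        fun h1 => ?_
      exact huv (by rw [Fin.ext (h.eq_of_column_inter j.2 j'.2 h1)])
  refine ⟨S, ⟨(Z : ℝ), ?_, ?_, ?_, hiff⟩, hSa, hSb⟩
  · intro v hv
    obtain ⟨i, hi⟩ := a.surjective ⟨v, hv⟩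
    obtain rfl : (a i : V) = v := by rw [hi]
    refine ⟨_, _, _, hrow i, ?_, hSa i⟩
    rw [add_comm]
    exact_mod_cast (h.row_left i i.2).2
  · intro v hv
    obtain ⟨j, hj⟩ := b.surjective ⟨v, hv⟩
    obtain rfl : (b j : V) = v := by rw [hj]
    refine ⟨_, _, _, hcol j, ?_, hSb j⟩
    rw [add_comm]
    exact_mod_cast h.col_bot j j.2
  · intro u v huv
    by_contra hne'
    -- Equal nonempty segments intersect, so distinct `u` and `v` would be adjacent, one a row and
    -- one a column; but a nondegenerate horizontal segment is not vertical.
    have h1 : G.Adj u v := (hiff u v hne').2 (by rw [huv, Set.inter_self]; exact hne v)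
    obtain ⟨i, rfl⟩ | ⟨j, rfl⟩ := hcases u <;> obtain ⟨i', rfl⟩ | ⟨j', rfl⟩ := hcases v
    · exact hdisj _ (a i').2 (hG.mem_of_mem_adj (a i).2 h1)
    · rw [hSa, hSb] at huv
      exact horizontal_ne_vertical (hrow i) huv
    · rw [hSa, hSb] at huv
      exact horizontal_ne_vertical (hrow i') huv.symm
    · exact hdisj _ (hG.symm.mem_of_mem_adj (b j).2 h1) (b j').2

end RAMProgram

/-! ### Enumerated matrices -/

variable {n m : ℕ}

/-- The positions of the ones of a matrix with numbered rows and columns. -/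
def IsOneEntry {n m : ℕ} (M : Matrix (Fin n) (Fin m) ℕ) (x c : ℕ) : Prop :=
  ∃ (hx : x < n) (hc : c < m), M ⟨x, hx⟩ ⟨c, hc⟩ = 1

theorem hasInput_matrixInput {M : Matrix (Fin n) (Fin m) ℕ} (hM : ∀ i j, M i j = 0 ∨ M i j = 1) :
    RAMProgram.HasInput n m (IsOneEntry M) (matrixInput M) := by
  have key : ∀ i (hi : i < n) j (hj : j < m),
      (matrixInput M).mem 0 (i * m + j) = M ⟨i, hi⟩ ⟨j, hj⟩ := by
    intro i hi j hj
    have h1 : (i * m + j) / m = i := by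
      rw [Nat.mul_comm, Nat.mul_add_div (by omega), Nat.div_eq_of_lt hj, add_zero]
    have h2 : (i * m + j) % m = j := by rw [Nat.mul_add_mod', Nat.mod_eq_of_lt hj]
    simp [matrixInput, h1, h2, hi, hj]
  refine ⟨rfl, rfl, fun i hi j hj h => ?_, fun i hi j hj h => ?_⟩
  · rw [key i hi j hj]
    exact h.2.2
  · rw [key i hi j hj]
    exact (hM _ _).resolve_right fun h' => h ⟨hi, hj, h'⟩

/-- Ranks of the elements of an enumeration in another one, extended by the identity. -/
def relRank {α : Type*} {n k : ℕ} (a : Fin n ≃ α) (σ : Fin k ≃ α) (x : ℕ) : ℤ :=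
  if hx : x < n then ((σ.symm (a ⟨x, hx⟩) : ℕ) : ℤ) else x

theorem relRank_of_lt {α : Type*} {n k : ℕ} {a : Fin n ≃ α} {σ : Fin k ≃ α} {x : ℕ} (hx : x < n) :
    relRank a σ x = ((σ.symm (a ⟨x, hx⟩) : ℕ) : ℤ) := dif_pos hx

/-- Indices outside the enumeration have rank at least `n`, above all proper ranks, so convexity
never leads out of the matrix. -/
theorem lt_of_relRank_le {α : Type*} {n k : ℕ} {a : Fin n ≃ α} {σ : Fin k ≃ α} {x y : ℕ}
    (hy : y < n) (h : relRank a σ x ≤ relRank a σ y) : x < n := by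
  have hk : n = k := by simpa using Fintype.card_congr (a.trans σ.symm)
  rw [relRank_of_lt hy] at h
  by_contra hx
  rw [relRank, dif_neg hx] at h
  have := (σ.symm (a ⟨y, hy⟩)).2
  omega

theorem isBiconvex_submatrix {R C : Type u} [Fintype R] [Fintype C] {M : Matrix R C ℕ}
    {σ : Fin (Fintype.card R) ≃ R} {τ : Fin (Fintype.card C) ≃ C}
    (h : HasConsecutiveOnes (M.submatrix σ τ)) (a : Fin n ≃ R) (b : Fin m ≃ C) :
    IsBiconvex n m (IsOneEntry (M.submatrix a b)) (relRank a σ) (relRank b τ) := by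
  refine ⟨fun x c h => ⟨h.1, h.2.1⟩, ?_, ?_⟩
  · rintro x p q r ⟨hx, hp, h1⟩ ⟨_, hr, h2⟩ hpq hqr
    have hq := lt_of_relRank_le hr hqr
    rw [relRank_of_lt hp, relRank_of_lt hq, Nat.cast_le] at hpq
    rw [relRank_of_lt hr, relRank_of_lt hq, Nat.cast_le] at hqr
    have := h.1 (σ.symm (a ⟨x, hx⟩)) _ _ _ hpq hqr
    simp only [Matrix.submatrix_apply, Equiv.apply_symm_apply] at this h1 h2
    exact ⟨hx, hq, this h1 h2⟩
  · rintro c x y z ⟨hx, hc, h1⟩ ⟨hz, _, h2⟩ hxy hyz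
    have hy := lt_of_relRank_le hz hyz
    rw [relRank_of_lt hx, relRank_of_lt hy, Nat.cast_le] at hxy
    rw [relRank_of_lt hz, relRank_of_lt hy, Nat.cast_le] at hyz
    have := h.2 (τ.symm (b ⟨c, hc⟩)) _ _ _ hxy hyz
    simp only [Matrix.submatrix_apply, Equiv.apply_symm_apply] at this h1 h2
    exact ⟨hy, hc, this h1 h2⟩

/-! ### Word size and assembly of the theorem. -/

theorem coordinate_bound_lt (n m : ℕ) {C : ℕ} (hC : 18 ≤ C) :
    (3 * n * ((n + 1) * (m + 1) * (m + 1)) * (n + 1) + 1) * (m + 1) + (n + 3) * (m + 3) * (m + 3) <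
      (n + m + 2) ^ C := by
  set N := n + m + 2 with hN
  have h2 : 2 ≤ N := by omega
  have h1 : (n + 1) * (m + 1) * (m + 1) ≤ N * N * N := by gcongr <;> omega
  have h3 : 3 * n * ((n + 1) * (m + 1) * (m + 1)) * (n + 1) + 1 ≤ 3 * N * (N * N * N) * N + 1 := by
    gcongr <;> omega
  have h4 : (3 * n * ((n + 1) * (m + 1) * (m + 1)) * (n + 1) + 1) * (m + 1) ≤
      (3 * N * (N * N * N) * N + 1) * N := by
    gcongr
    omega
  have h5 : (n + 3) * (m + 3) * (m + 3) ≤ (2 * N) * (2 * N) * (2 * N) := by gcongr <;> omega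
  -- The left side has degree `6` in `N` and coefficients summing to `12`; since `N ≥ 2`, the factor
  -- `N ^ 12` absorbs them generously.
  have h6 : (3 * N * (N * N * N) * N + 1) * N + (2 * N) * (2 * N) * (2 * N) < N ^ 18 := by
    have e1 : (2 : ℕ) ^ 12 ≤ N ^ 12 := Nat.pow_le_pow_left h2 12
    have e2 : N ≤ N ^ 6 := Nat.le_self_pow (by norm_num) N
    have e3 : N ^ 3 ≤ N ^ 6 := Nat.pow_le_pow_right (by omega) (by norm_num)
    have e4 : 0 < N ^ 6 := by positivity
    calc (3 * N * (N * N * N) * N + 1) * N + (2 * N) * (2 * N) * (2 * N)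
        = 3 * N ^ 6 + N + 8 * N ^ 3 := by ring
      _ < 2 ^ 12 * N ^ 6 := by omega
      _ ≤ N ^ 12 * N ^ 6 := Nat.mul_le_mul_right _ e1
      _ = N ^ 18 := by ring
  calc _ ≤ _ := Nat.add_le_add h4 h5
    _ < N ^ 18 := h6
    _ ≤ N ^ C := Nat.pow_le_pow_right (by omega) hC

theorem stick_runs {V : Type u} {G : SimpleGraph V} {A B : Finset V}
    (hG : G.IsBipartiteWith (A : Set V) (B : Set V)) (hAB : (A : Set V) ∪ (B : Set V) = Set.univ)
    (hM : HasSimultaneousConsecutiveOnes (bipartiteAdjMatrix G A B))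
    (a : Fin A.card ≃ A) (b : Fin B.card ≃ B) :
    ∃ (t : ℕ) (s : RAMState),
      RAMProgram.stick.Runs ((A.card + B.card + 2) ^ 18000)
        (matrixInput ((bipartiteAdjMatrix G A B).submatrix a b)) t s ∧
      t ≤ 18000 * (max 1 A.card * max 1 B.card) ∧
      ∃ S : V → Set (ℝ × ℝ),
        IsStickRepresentation G (A : Set V) (B : Set V) S ∧
        (∀ i, S (a i) = outputRowSegment s i) ∧
        (∀ j, S (b j) = outputColumnSegment s j) := by
  classical
  obtain ⟨σ, τ, hστ⟩ := hM
  have h01 : ∀ i j, (bipartiteAdjMatrix G A B).submatrix a b i j = 0 ∨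
      (bipartiteAdjMatrix G A B).submatrix a b i j = 1 := by
    intro i j
    simp only [Matrix.submatrix_apply, bipartiteAdjMatrix]
    split_ifs <;> simp
  have hbi := isBiconvex_submatrix hστ a b
  have key : RAMProgram.stick.Ends ((A.card + B.card + 2) ^ 18000)
      (matrixInput ((bipartiteAdjMatrix G A B).submatrix a b)) fun t s =>
      t ≤ 18000 * (max 1 A.card * max 1 B.card) ∧
      ∃ S : V → Set (ℝ × ℝ),
        IsStickRepresentation G (A : Set V) (B : Set V) S ∧
        (∀ i, S (a i) = outputRowSegment s i) ∧
        (∀ j, S (b j) = outputColumnSegment s j) := by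
    refine RAMProgram.Ends.stick rfl rfl (coordinate_bound_lt _ _ (by norm_num))
      (hasInput_matrixInput h01) ?_ hbi
      fun t s pos hpos hD ht => ⟨?_, ?_⟩
    · intro k hk
      funext x
      simp [matrixInput, hk.ne']
    -- The constant is `18000 = 4 * 4500`: replacing `k + 1` by `2 * max 1 k` costs a factor `2` on
    -- each side.
    · have h1 : (A.card + 1) * (B.card + 1) ≤ (2 * max 1 A.card) * (2 * max 1 B.card) := by
        gcongr <;> omega
      have h2 : (2 * max 1 A.card) * (2 * max 1 B.card) = 4 * (max 1 A.card * max 1 B.card) := by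
        ring
      omega
    · refine hD.exists_isStickRepresentation hG hAB a b hpos hbi.lt fun i j => ?_
      simp [IsOneEntry, bipartiteAdjMatrix]
  obtain ⟨t, s, h1, h2⟩ := key
  exact ⟨t, s, h1, h2⟩

theorem mainTheorem7 :
    (∀ (V : Type u) (G : SimpleGraph V) (A B : Finset V),
      G.IsBipartiteWith (A : Set V) (B : Set V) → (A : Set V) ∪ (B : Set V) = Set.univ →
      HasSimultaneousConsecutiveOnes (bipartiteAdjMatrix G A B) →
      ∃ S : V → Set (ℝ × ℝ), IsStickRepresentation G (A : Set V) (B : Set V) S) ∧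
    (∃ (P : RAMProgram) (C : ℕ),
      ∀ (V : Type u) (G : SimpleGraph V) (A B : Finset V),
        G.IsBipartiteWith (A : Set V) (B : Set V) → (A : Set V) ∪ (B : Set V) = Set.univ →
        HasSimultaneousConsecutiveOnes (bipartiteAdjMatrix G A B) →
        ∀ (a : Fin A.card ≃ A) (b : Fin B.card ≃ B),
          ∃ (t : ℕ) (s : RAMState),
            P.Runs ((A.card + B.card + 2) ^ C)
              (matrixInput ((bipartiteAdjMatrix G A B).submatrix a b)) t s ∧
            t ≤ C * (max 1 A.card * max 1 B.card) ∧
            ∃ S : V → Set (ℝ × ℝ),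
              IsStickRepresentation G (A : Set V) (B : Set V) S ∧
              (∀ i, S (a i) = outputRowSegment s i) ∧
              (∀ j, S (b j) = outputColumnSegment s j)) := by
  refine ⟨fun V G A B hG hAB hM => ?_, RAMProgram.stick, 18000, fun V G A B hG hAB hM a b =>
    stick_runs hG hAB hM a b⟩
  obtain ⟨_, _, _, _, S, hS, _⟩ := stick_runs hG hAB hM A.equivFin.symm B.equivFin.symm
  exact ⟨S, hS⟩
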